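/- **Setting.** A curve is a finite sequence of points of $\mathbb{R}^d$. An alignment of two curves $P=(p_1,\dots,p_m)$ and $Q=(q_1,\dots,q_m)$ is a sequence $\tau$ of index pairs from $(1,1)$ to $(m,m)$ in which each pair $(i,j)$ is followed by $(i+1,j)$, $(i,j+1)$ or $(i+1,j+1)$. For $1\le p<\infty$ the $\ell_{p,2}$-distance is $$d_{p,2}(P,Q)=\min_\tau\Big(\sum_{(i,j)\in\tau}\|p_i-q_j\|_2^p\Big)^{1/p},$$ and the discrete Fréchet distance is $d_{dF}(P,Q)=\min_\tau\max_{(i,j)\in\tau}\|p_i-q_j\|_2$ (the case $p=\infty$), where $\tau$ ranges over all alignments. Given a distance $\delta$ for curves, $r>0$, $0<\varepsilon\le 1$, and $n$ curves $C_1,\dots,C_n$ of exactly $m$ points in $\mathbb{R}^d$ ($n,m,d\ge 1$), *$(1+\varepsilon,r)$-approximate range counting* asks to preprocess the curves into a data structure which, for every query curve $Q$ of $m$ points in $\mathbb{R}^d$, returns the number of all indices $i$ with $\delta(C_i,Q)\le r$ plus possibly some further indices with $r<\delta(C_i,Q)\le(1+\varepsilon)r$. In other words, it returns $|A|$ for some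 set $A$ with $\{i:\delta(C_i,Q)\le r\}\subseteq A\subseteq\{i:\delta(C_i,Q)\le(1+\varepsilon)r\}$. The algorithms are deterministic programs on a real RAM whose unit-cost operations are arithmetic, powers, rounding down and comparisons of real numbers, arithmetic and comparisons of integers, reading the input, and random access to memory. Addresses and integers do not exceed the number of cells of each of the machine's two memories (one for integers, one for reals), and rounded real numbers are not used as addresses. Space is the number of memory cells, and it also bounds the memory used by the preprocessing and by the queries. **Theorem.** There are a universal constant $c$, a preprocessing program and a query program such that, for all $n,m,d\ge 1$, $p\in[1,\infty)$, $\varepsilon\in(0,1]$, $r>0$ and all $C_1,\dots,C_n$, they solve $(1+\varepsilon,r)$-approximate range counting under the $\ell_{p,2}$-distance with - space at most $n\cdot(c/\varepsilon)^{m(d+1)}$, - preprocessing time at most $n\log(2n/\varepsilon)\cdot(c/\varepsilon)^{m(d+1)}$ (worst case), and - query time at most $c\cdot md\log(2nmd/\varepsilon)$. Under the discrete Fréchet distance the same holds (with a constant and programs of its own) with the exponent $md$ in place of $m(d+1)$ in the space and preprocessing bounds. -/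

import Mathlib

namespace CurveCounting

/-! ### Curves, alignments and distances -/

/-- A curve of `m` points in `d`-dimensional Euclidean space. -/
abbrev Curve (m d : ℕ) : Type := Fin m → EuclideanSpace ℝ (Fin d)

/-- The three admissible steps of an alignment: advance on the first curve, on the second curve,
or on both. -/
def AlignStep {m₁ m₂ : ℕ} (a b : Fin m₁ × Fin m₂) : Prop :=
  ((b.1 : ℕ) = a.1 + 1 ∧ (b.2 : ℕ) = a.2) ∨
  ((b.1 : ℕ) = a.1 ∧ (b.2 : ℕ) = a.2 + 1) ∨
  ((b.1 : ℕ) = a.1 + 1 ∧ (b.2 : ℕ) = a.2 + 1)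

/-- An alignment of a curve of `m₁` points and a curve of `m₂` points (indices start at `0`):
a sequence of index pairs that starts at the first pair, ends at the last pair and proceeds by
admissible steps. -/
structure IsAlignment {m₁ m₂ : ℕ} (τ : List (Fin m₁ × Fin m₂)) : Prop where
  head : ∃ a, τ.head? = some a ∧ (a.1 : ℕ) = 0 ∧ (a.2 : ℕ) = 0
  last : ∃ b, τ.getLast? = some b ∧ (b.1 : ℕ) + 1 = m₁ ∧ (b.2 : ℕ) + 1 = m₂
  chain : τ.IsChain AlignStep

/-- The `ℓ_{p,2}`-cost `(∑_{(i,j) ∈ τ} ‖p_i - q_j‖₂ ^ p) ^ (1/p)` of an alignment. -/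
noncomputable def lpCost {m₁ m₂ d : ℕ} (p : ℝ) (P : Curve m₁ d) (Q : Curve m₂ d)
    (τ : List (Fin m₁ × Fin m₂)) : ℝ :=
  ((τ.map fun a => ‖P a.1 - Q a.2‖ ^ p).sum) ^ (1 / p)

/-- The Fréchet cost `max_{(i,j) ∈ τ} ‖p_i - q_j‖₂` of an alignment. -/
noncomputable def frechetCost {m₁ m₂ d : ℕ} (P : Curve m₁ d) (Q : Curve m₂ d)
    (τ : List (Fin m₁ × Fin m₂)) : ℝ :=
  (τ.map fun a => ‖P a.1 - Q a.2‖).foldr max 0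

/-- The `ℓ_{p,2}`-distance: the minimum of the `ℓ_{p,2}`-cost over all alignments.  There are
finitely many alignments, and at least one when both curves have a point, so that the infimum is
a minimum. -/
noncomputable def lpDist {m₁ m₂ d : ℕ} (p : ℝ) (P : Curve m₁ d) (Q : Curve m₂ d) : ℝ :=
  sInf {x | ∃ τ : List (Fin m₁ × Fin m₂), IsAlignment τ ∧ x = lpCost p P Q τ}

/-- The discrete Fréchet distance: the minimum of the Fréchet cost over all alignments. -/
noncomputable def frechetDist {m₁ m₂ d : ℕ} (P : Curve m₁ d) (Q : Curve m₂ d) : ℝ :=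
  sInf {x | ∃ τ : List (Fin m₁ × Fin m₂), IsAlignment τ ∧ x = frechetCost P Q τ}

/-! ### The machine: a real RAM with unit costs

The machine has integer registers and real registers (a program names only finitely many of
them), an integer memory and a real memory with random access through integer registers, and a
read-only input array of reals.  In a machine of size `S` each of the two memories has the cells
`0, …, S - 1`, and an integer register or cell holds a number between `0` and `S`; an instruction
that leaves these ranges fails.  The real operations are the four arithmetic operations, powers,
rounding down (the result stays a real number: reals never become addresses) and comparisons.
Programs contain no real constants. -/

/-- The integer operations; subtraction is truncated, and division rounds down. -/
inductive IntOp
  | add | sub | mul | div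

def IntOp.eval : IntOp → ℕ → ℕ → ℕ
  | .add, a, b => a + b
  | .sub, a, b => a - b
  | .mul, a, b => a * b
  | .div, a, b => a / b

/-- The binary real operations. -/
inductive RealOp
  | add | sub | mul | div | pow

/-- Division by zero gives `0`, and a negative base of a power is replaced by `0`. -/
noncomputable def RealOp.eval : RealOp → ℝ → ℝ → ℝ
  | .add, a, b => a + b
  | .sub, a, b => a - b
  | .mul, a, b => a * b
  | .div, a, b => a / b
  | .pow, a, b => (max a 0) ^ b

/-- The instructions; `x`, `y`, `z`, `a` are numbers of registers. -/
inductive Instr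
  /-- integer register `x` := the constant `k` -/
  | intConst (x k : ℕ)
  /-- integer register `x` := integer register `y` `o` integer register `z` -/
  | intOp (o : IntOp) (x y z : ℕ)
  /-- integer register `x` := integer cell whose address is in integer register `a` -/
  | intLoad (x a : ℕ)
  /-- integer cell whose address is in integer register `a` := integer register `x` -/
  | intStore (a x : ℕ)
  /-- real register `x` := integer register `y` -/
  | ofInt (x y : ℕ)
  /-- real register `x` := real register `y` `o` real register `z` -/
  | realOp (o : RealOp) (x y z : ℕ)
  /-- real register `x` := real register `y` rounded down to an integer -/
  | floor (x y : ℕ)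
  /-- real register `x` := real cell whose address is in integer register `a` -/
  | realLoad (x a : ℕ)
  /-- real cell whose address is in integer register `a` := real register `x` -/
  | realStore (a x : ℕ)
  /-- real register `x` := input entry whose position is in integer register `a` -/
  | input (x a : ℕ)

/-- The tests: comparisons of two integer registers or of two real registers. -/
inductive Test
  | intLt (x y : ℕ) | intLe (x y : ℕ) | realLt (x y : ℕ) | realLe (x y : ℕ)

/-- Programs: instructions, composition, branching and loops. -/
inductive Cmd
  | skip
  | instr (i : Instr)
  | seq (c₁ c₂ : Cmd)
  | ite (t : Test) (c₁ c₂ : Cmd)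
  | while (t : Test) (c : Cmd)

/-- The contents of the registers and memories. -/
structure State where
  ireg : ℕ → ℕ
  rreg : ℕ → ℝ
  imem : ℕ → ℕ
  rmem : ℕ → ℝ

/-- The state with all memory cells `0`, with the given numbers in the first registers, and with
`0` in the other registers. -/
def State.start (ints : List ℕ) (reals : List ℝ) : State where
  ireg := fun x => ints.getD x 0
  rreg := fun x => reals.getD x 0
  imem := fun _ => 0
  rmem := fun _ => 0

/-- The same memories, with all registers reset to `0`. -/
def State.clearRegs (s : State) : State where
  ireg := fun _ => 0
  rreg := fun _ => 0
  imem := s.imem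
  rmem := s.rmem

/-- The effect of one instruction on a machine of size `S` with input `inp`; `none` is failure. -/
noncomputable def Instr.run (S : ℕ) (inp : ℕ → ℝ) (s : State) : Instr → Option State
  | .intConst x k =>
      if k ≤ S then some { s with ireg := Function.update s.ireg x k } else none
  | .intOp o x y z =>
      if o.eval (s.ireg y) (s.ireg z) ≤ S then
        some { s with ireg := Function.update s.ireg x (o.eval (s.ireg y) (s.ireg z)) }
      else none
  | .intLoad x a =>
      if s.ireg a < S then
        some { s with ireg := Function.update s.ireg x (s.imem (s.ireg a)) }
      else none
  | .intStore a x =>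
      if s.ireg a < S then
        some { s with imem := Function.update s.imem (s.ireg a) (s.ireg x) }
      else none
  | .ofInt x y => some { s with rreg := Function.update s.rreg x (s.ireg y : ℝ) }
  | .realOp o x y z =>
      some { s with rreg := Function.update s.rreg x (o.eval (s.rreg y) (s.rreg z)) }
  | .floor x y => some { s with rreg := Function.update s.rreg x (⌊s.rreg y⌋ : ℝ) }
  | .realLoad x a =>
      if s.ireg a < S then
        some { s with rreg := Function.update s.rreg x (s.rmem (s.ireg a)) }
      else none
  | .realStore a x =>
      if s.ireg a < S then
        some { s with rmem := Function.update s.rmem (s.ireg a) (s.rreg x) }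
      else none
  | .input x a => some { s with rreg := Function.update s.rreg x (inp (s.ireg a)) }

def Test.holds (s : State) : Test → Prop
  | .intLt x y => s.ireg x < s.ireg y
  | .intLe x y => s.ireg x ≤ s.ireg y
  | .realLt x y => s.rreg x < s.rreg y
  | .realLe x y => s.rreg x ≤ s.rreg y

/-- `Exec S inp c s s' t`: on a machine of size `S` with input `inp`, the program `c` started in
the state `s` halts in the state `s'`, without failure, after `t` steps.  Every instruction and
every evaluation of a test is one step. -/
inductive Exec (S : ℕ) (inp : ℕ → ℝ) : Cmd → State → State → ℕ → Prop
  | skip (s : State) : Exec S inp .skip s s 0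
  | instr {i : Instr} {s s' : State} (h : i.run S inp s = some s') :
      Exec S inp (.instr i) s s' 1
  | seq {c₁ c₂ : Cmd} {s s' s'' : State} {t₁ t₂ : ℕ} (h₁ : Exec S inp c₁ s s' t₁)
      (h₂ : Exec S inp c₂ s' s'' t₂) : Exec S inp (.seq c₁ c₂) s s'' (t₁ + t₂)
  | ite_true {b : Test} {c₁ c₂ : Cmd} {s s' : State} {t : ℕ} (hb : b.holds s)
      (h : Exec S inp c₁ s s' t) : Exec S inp (.ite b c₁ c₂) s s' (t + 1)
  | ite_false {b : Test} {c₁ c₂ : Cmd} {s s' : State} {t : ℕ} (hb : ¬ b.holds s)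
      (h : Exec S inp c₂ s s' t) : Exec S inp (.ite b c₁ c₂) s s' (t + 1)
  | while_true {b : Test} {c : Cmd} {s s' s'' : State} {t₁ t₂ : ℕ} (hb : b.holds s)
      (h₁ : Exec S inp c s s' t₁) (h₂ : Exec S inp (.while b c) s' s'' t₂) :
      Exec S inp (.while b c) s s'' (t₁ + t₂ + 1)
  | while_false {b : Test} {c : Cmd} {s : State} (hb : ¬ b.holds s) :
      Exec S inp (.while b c) s s 1

/-! ### Approximate range counting -/

/-- The input array starts with the coordinates of the `n` curves, curve by curve and point by
point.  The later entries are arbitrary. -/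
def EncodesCurves {n m d : ℕ} (inp : ℕ → ℝ) (C : Fin n → Curve m d) : Prop :=
  ∀ (i : Fin n) (j : Fin m) (k : Fin d), inp (((i : ℕ) * m + j) * d + k) = C i j k

/-- The input array starts with the coordinates of the curve, point by point. -/
def EncodesCurve {m d : ℕ} (inp : ℕ → ℝ) (Q : Curve m d) : Prop :=
  ∀ (j : Fin m) (k : Fin d), inp ((j : ℕ) * d + k) = Q j k

/-- `N` is the number of all curves within distance `r` of `Q`, plus possibly additional curves
within distance `(1 + ε) r`. -/
def IsApproxRangeCount {n m d : ℕ} (δ : Curve m d → Curve m d → ℝ) (ε r : ℝ)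
    (C : Fin n → Curve m d) (Q : Curve m d) (N : ℕ) : Prop :=
  ∃ A : Finset (Fin n), (∀ i, δ (C i) Q ≤ r → i ∈ A) ∧
    (∀ i ∈ A, δ (C i) Q ≤ (1 + ε) * r) ∧ N = A.card

/-- The two programs are a data structure for `(1 + ε, r)`-approximate range counting on the
curves `C`, within the given bounds.  The program `prep` gets `n`, `m`, `d`, the real parameters
`params` and the curves, and leaves the data structure in the memories.  The program `query` gets
nothing but these memories and the query curve; it puts its answer into integer register `0`, and
the data structure is left as it was, ready for the next query.  The machine has the same size
throughout, and `space` bounds the total number of cells of its two memories. -/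
def CountsWithin (prep query : Cmd) {n m d : ℕ} (δ : Curve m d → Curve m d → ℝ)
    (params : List ℝ) (ε r : ℝ) (C : Fin n → Curve m d)
    (space prepTime queryTime : ℝ) : Prop :=
  ∀ inp : ℕ → ℝ, EncodesCurves inp C →
    ∃ (S : ℕ) (s : State) (t : ℕ), 2 * (S : ℝ) ≤ space ∧ (t : ℝ) ≤ prepTime ∧
      Exec S inp prep (State.start [n, m, d] params) s t ∧
      ∀ (Q : Curve m d) (qinp : ℕ → ℝ), EncodesCurve qinp Q →
        ∃ (s' : State) (t' : ℕ), (t' : ℝ) ≤ queryTime ∧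
          Exec S qinp query s.clearRegs s' t' ∧
          s'.imem = s.imem ∧ s'.rmem = s.rmem ∧
          IsApproxRangeCount δ ε r C Q (s'.ireg 0)

end CurveCounting

/-! Approximate counting is reduced to an exact lookup on a grid. Rounding every coordinate of the
query down to a grid of side `side m d p ε r` moves each point by at most √d times the side. An
alignment has at most 2m pairs, so by Minkowski's inequality every distance changes by at most
(2m)^(1/p) · √d · side = (ε/2)r (`side_mul`, `lpDist_floor`). For the rounded query G, the set of
all i whose curve has distance at most (1 + ε/2)r from G is therefore always a legitimate answer,
and it depends on G alone.

The preprocessing lists all pairs (G, i) in this relation, each as a row of md + 1 numbers. The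
heart of the proof is that there are few of them and that they can be listed by brute force. Along a
good alignment each point b of G has a partner A(b) on the input curve, with A monotone
(`AlignTail.exists_monotone`). Cauchy–Schwarz and the power mean inequality turn the bound on the
cost into an ℓ₁ bound: measured in grid units, the md coordinate deviations between G and the
partners sum to at most 6md/ε (`sum_abs_sub_le`). With K = ⌈1/ε⌉, write each deviation as a number
of steps of length K, in unary, and a remainder below K. There are at most 8md steps, so 10md digits
to the base 4 spell the steps, the advances of A and the stop marks; md digits to the base K spell
the remainders, and 2m ternary digits the alignment (`exists_guessRow`, `IsAlignment.exists_walk`).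
Hence the numbers below n(cK)^(md) encode all pairs (`exists_emits`). The program decodes every such
number and keeps the row exactly when the decoded alignment certifies the distance
(`Emits.lpDist_le`); senseless codes do no harm, and no optimal alignment is ever computed.

The resulting list has repetitions. It is merge sorted lexicographically, and prefix sums count the
rows that differ from their predecessor. The rows that extend a given G are consecutive, and the
number of distinct ones among them is the answer (`isApproxRangeCount_index`). To find them with
O(md + log N) comparisons of single numbers, tables store, for each row and each prefix length, the
block of rows sharing that prefix. A search step either halves the interval or fixes one more
coordinate by jumping to a block (`queryStep_spec`, `query_spec`).

The logarithm of the number of codes is O(md log(2n/ε)), and polynomial factors in md disappear in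
c^(md). This gives the exponent md for the ℓ_{p,2}-distance too. The Fréchet distance is
approximated by the ℓ_{p,2}-distance with p = 8m/ε (`IsApproxRangeCount.frechet`). All programs are
verified in a small calculus of time-bounded total correctness. -/

namespace CurveCounting

/-! ### Program logic -/

/-- The program halts within `T` steps in a state with the property `P`. -/
def Runs (S : ℕ) (inp : ℕ → ℝ) (c : Cmd) (s : State) (T : ℕ) (P : State → Prop) : Prop :=
  ∃ s' t, Exec S inp c s s' t ∧ t ≤ T ∧ P s'

/-- The integer registers written by an instruction. -/
def Instr.writesInt : Instr → ℕ → Bool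
  | .intConst x _, y | .intOp _ x _ _, y | .intLoad x _, y => y == x
  | _, _ => false

/-- The real registers written by an instruction. -/
def Instr.writesReal : Instr → ℕ → Bool
  | .ofInt x _, y | .realOp _ x _ _, y | .floor x _, y | .realLoad x _, y | .input x _, y => y == x
  | _, _ => false

def Instr.storesInt : Instr → Bool
  | .intStore _ _ => true
  | _ => false

def Instr.storesReal : Instr → Bool
  | .realStore _ _ => true
  | _ => false

def Cmd.writesInt : Cmd → ℕ → Bool
  | .skip, _ => false
  | .instr i, y => i.writesInt y
  | .seq c₁ c₂, y => c₁.writesInt y || c₂.writesInt y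
  | .ite _ c₁ c₂, y => c₁.writesInt y || c₂.writesInt y
  | .while _ c, y => c.writesInt y

def Cmd.writesReal : Cmd → ℕ → Bool
  | .skip, _ => false
  | .instr i, y => i.writesReal y
  | .seq c₁ c₂, y => c₁.writesReal y || c₂.writesReal y
  | .ite _ c₁ c₂, y => c₁.writesReal y || c₂.writesReal y
  | .while _ c, y => c.writesReal y

def Cmd.storesInt : Cmd → Bool
  | .skip => false
  | .instr i => i.storesInt
  | .seq c₁ c₂ => c₁.storesInt || c₂.storesInt
  | .ite _ c₁ c₂ => c₁.storesInt || c₂.storesInt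
  | .while _ c => c.storesInt

def Cmd.storesReal : Cmd → Bool
  | .skip => false
  | .instr i => i.storesReal
  | .seq c₁ c₂ => c₁.storesReal || c₂.storesReal
  | .ite _ c₁ c₂ => c₁.storesReal || c₂.storesReal
  | .while _ c => c.storesReal

/-- Whatever `c` does not write syntactically is the same in both states. -/
structure Frame (c : Cmd) (s s' : State) : Prop where
  i : ∀ x, c.writesInt x = false → s'.ireg x = s.ireg x
  r : ∀ x, c.writesReal x = false → s'.rreg x = s.rreg x
  im : c.storesInt = false → s'.imem = s.imem
  rm : c.storesReal = false → s'.rmem = s.rmem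

theorem Frame.refl (c : Cmd) (s : State) : Frame c s s :=
  ⟨fun _ _ => rfl, fun _ _ => rfl, fun _ => rfl, fun _ => rfl⟩

theorem Frame.trans {c : Cmd} {s s' s'' : State} (h : Frame c s s') (h' : Frame c s' s'') :
    Frame c s s'' :=
  ⟨fun x hx => (h'.i x hx).trans (h.i x hx), fun x hx => (h'.r x hx).trans (h.r x hx),
    fun hx => (h'.im hx).trans (h.im hx), fun hx => (h'.rm hx).trans (h.rm hx)⟩

theorem Frame.mono {c c' : Cmd} {s s' : State} (h : Frame c s s')
    (hi : ∀ x, c'.writesInt x = false → c.writesInt x = false)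
    (hr : ∀ x, c'.writesReal x = false → c.writesReal x = false)
    (him : c'.storesInt = false → c.storesInt = false)
    (hrm : c'.storesReal = false → c.storesReal = false) : Frame c' s s' :=
  ⟨fun x hx => h.i x (hi x hx), fun x hx => h.r x (hr x hx), fun hx => h.im (him hx),
    fun hx => h.rm (hrm hx)⟩

theorem Frame.instr {S : ℕ} {inp : ℕ → ℝ} {i : Instr} {s s' : State}
    (h : i.run S inp s = some s') : Frame (.instr i) s s' := by
  cases i <;> simp only [Instr.run] at h <;> (try split_ifs at h) <;>
    simp only [Option.some.injEq] at h <;> subst h <;>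
    constructor <;>
    simp +contextual [Cmd.writesInt, Cmd.writesReal, Cmd.storesInt, Cmd.storesReal,
      Instr.writesInt, Instr.writesReal, Instr.storesInt, Instr.storesReal]

/-- The write sets are computable Boolean functions of the program. For concrete programs, the fact
that a register or memory survives is therefore settled by `rfl`, and the specifications only need
to mention what changes. -/
theorem Exec.frame {S : ℕ} {inp : ℕ → ℝ} {c : Cmd} {s s' : State} {t : ℕ}
    (h : Exec S inp c s s' t) : Frame c s s' := by
  induction h with
  | skip s => exact Frame.refl _ _
  | instr h => exact Frame.instr h
  | seq _ _ ih₁ ih₂ =>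
    refine Frame.trans (ih₁.mono ?_ ?_ ?_ ?_) (ih₂.mono ?_ ?_ ?_ ?_) <;>
      simp +contextual [Cmd.writesInt, Cmd.writesReal, Cmd.storesInt, Cmd.storesReal]
  | ite_true _ _ ih =>
    refine ih.mono ?_ ?_ ?_ ?_ <;>
      simp +contextual [Cmd.writesInt, Cmd.writesReal, Cmd.storesInt, Cmd.storesReal]
  | ite_false _ _ ih =>
    refine ih.mono ?_ ?_ ?_ ?_ <;>
      simp +contextual [Cmd.writesInt, Cmd.writesReal, Cmd.storesInt, Cmd.storesReal]
  | while_true _ _ _ ih₁ ih₂ =>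
    refine Frame.trans (ih₁.mono ?_ ?_ ?_ ?_) ih₂ <;>
      simp +contextual [Cmd.writesInt, Cmd.writesReal, Cmd.storesInt, Cmd.storesReal]
  | while_false _ => exact Frame.refl _ _

section rules

variable {S : ℕ} {inp : ℕ → ℝ}

theorem Runs.mono {c : Cmd} {s : State} {T T' : ℕ} {P P' : State → Prop}
    (h : Runs S inp c s T P) (hT : T ≤ T') (hP : ∀ s', Frame c s s' → P s' → P' s') :
    Runs S inp c s T' P' := by
  obtain ⟨s', t, he, ht, hp⟩ := h
  exact ⟨s', t, he, ht.trans hT, hP s' he.frame hp⟩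

theorem Runs.skip {s : State} {T : ℕ} {P : State → Prop} (h : P s) : Runs S inp .skip s T P :=
  ⟨s, 0, .skip s, Nat.zero_le _, h⟩

theorem Runs.seq {c₁ c₂ : Cmd} {s : State} (T₁ T₂ : ℕ) {T : ℕ} {Q P : State → Prop}
    (hT : T₁ + T₂ ≤ T) (h₁ : Runs S inp c₁ s T₁ Q)
    (h₂ : ∀ s', Frame c₁ s s' → Q s' → Runs S inp c₂ s' T₂ P) :
    Runs S inp (.seq c₁ c₂) s T P := by
  obtain ⟨s', t, he, ht, hq⟩ := h₁
  obtain ⟨s'', t', he', ht', hp⟩ := h₂ s' he.frame hq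
  exact ⟨s'', t + t', .seq he he', by omega, hp⟩

theorem Runs.ite {b : Test} {c₁ c₂ : Cmd} {s : State} (T : ℕ) {T' : ℕ} {P : State → Prop}
    (hT : T + 1 ≤ T') (h₁ : b.holds s → Runs S inp c₁ s T P)
    (h₂ : ¬ b.holds s → Runs S inp c₂ s T P) : Runs S inp (.ite b c₁ c₂) s T' P := by
  by_cases hb : b.holds s
  · obtain ⟨s', t, he, ht, hp⟩ := h₁ hb
    exact ⟨s', t + 1, .ite_true hb he, by omega, hp⟩
  · obtain ⟨s', t, he, ht, hp⟩ := h₂ hb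
    exact ⟨s', t + 1, .ite_false hb he, by omega, hp⟩

/-- The rule for loops with the time as variant. -/
theorem Runs.while_time {b : Test} {c : Cmd} {s₀ : State} (I : ℕ → State → Prop) (k : ℕ) {T' : ℕ}
    {P : State → Prop} (hT : k + 1 ≤ T') (h₀ : I k s₀)
    (hbody : ∀ k s, Frame c s₀ s → I k s → b.holds s →
      ∃ k' T, k' + T + 1 ≤ k ∧ Runs S inp c s T (I k'))
    (hend : ∀ k s, Frame c s₀ s → I k s → ¬ b.holds s → P s) :
    Runs S inp (.while b c) s₀ T' P := by
  have key : ∀ k s, Frame c s₀ s → I k s → Runs S inp (.while b c) s (k + 1) P := by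
    intro k
    induction k using Nat.strong_induction_on with
    | _ k ih =>
      intro s hf hi
      by_cases hb : b.holds s
      · obtain ⟨k', T, hk, s', t, he, ht, hi'⟩ := hbody k s hf hi hb
        obtain ⟨s'', t', he', ht', hp⟩ := ih k' (by omega) s' (hf.trans he.frame) hi'
        exact ⟨s'', t + t' + 1, .while_true hb he he', by omega, hp⟩
      · exact ⟨s, 1, .while_false hb, by omega, hend k s hf hi hb⟩
  exact (key k s₀ (Frame.refl _ _) h₀).mono hT fun _ _ h => h

theorem Runs.while {b : Test} {c : Cmd} {s₀ : State} (I : ℕ → State → Prop) (k T : ℕ) {T' : ℕ}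
    {P : State → Prop} (hT : k * (T + 1) + 1 ≤ T') (h₀ : I k s₀)
    (hbody : ∀ k s, Frame c s₀ s → I k s → b.holds s →
      ∃ k' < k, Runs S inp c s T (I k'))
    (hend : ∀ k s, Frame c s₀ s → I k s → ¬ b.holds s → P s) :
    Runs S inp (.while b c) s₀ T' P := by
  refine Runs.while_time (fun k s => ∃ j, k = j * (T + 1) ∧ I j s) (k * (T + 1)) hT ⟨k, rfl, h₀⟩
    ?_ ?_
  · rintro _ s hf ⟨k, rfl, hi⟩ hb
    obtain ⟨k', hk, h⟩ := hbody k s hf hi hb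
    refine ⟨k' * (T + 1), T, ?_, h.mono le_rfl fun s' _ h' => ⟨k', rfl, h'⟩⟩
    have : (k' + 1) * (T + 1) ≤ k * (T + 1) := Nat.mul_le_mul_right _ hk
    rw [Nat.add_mul] at this
    omega
  · rintro _ s hf ⟨k, rfl, hi⟩ hb
    exact hend k s hf hi hb

theorem Runs.for {b : Test} {c : Cmd} {s₀ : State} (I : ℕ → State → Prop) (N T : ℕ) {T' : ℕ}
    {P : State → Prop} (hT : N * (T + 1) + 1 ≤ T') (h₀ : I 0 s₀)
    (htest : ∀ i s, Frame c s₀ s → i ≤ N → I i s → (b.holds s ↔ i < N))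
    (hbody : ∀ i s, Frame c s₀ s → i < N → I i s → Runs S inp c s T (I (i + 1)))
    (hend : ∀ s, Frame c s₀ s → I N s → P s) :
    Runs S inp (.while b c) s₀ T' P := by
  refine Runs.while (fun k s => k ≤ N ∧ I (N - k) s) N T hT ⟨le_rfl, by simpa using h₀⟩ ?_ ?_
  · rintro k s hf ⟨hk, hi⟩ hb
    have hlt := (htest _ s hf (Nat.sub_le _ _) hi).1 hb
    refine ⟨k - 1, by omega, (hbody _ s hf hlt hi).mono le_rfl fun s' _ h => ⟨by omega, ?_⟩⟩
    rwa [show N - (k - 1) = N - k + 1 by omega]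
  · rintro k s hf ⟨hk, hi⟩ hb
    have := (htest _ s hf (Nat.sub_le _ _) hi).not.1 hb
    exact hend s hf (by rwa [show N - k = N by omega] at hi)

/-- The weakest precondition of an instruction. -/
def Instr.wp (S : ℕ) (inp : ℕ → ℝ) (s : State) (P : State → Prop) : Instr → Prop
  | .intConst x k => k ≤ S ∧ P { s with ireg := Function.update s.ireg x k }
  | .intOp o x y z => o.eval (s.ireg y) (s.ireg z) ≤ S ∧
      P { s with ireg := Function.update s.ireg x (o.eval (s.ireg y) (s.ireg z)) }
  | .intLoad x a => s.ireg a < S ∧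
      P { s with ireg := Function.update s.ireg x (s.imem (s.ireg a)) }
  | .intStore a x => s.ireg a < S ∧
      P { s with imem := Function.update s.imem (s.ireg a) (s.ireg x) }
  | .ofInt x y => P { s with rreg := Function.update s.rreg x (s.ireg y : ℝ) }
  | .realOp o x y z =>
      P { s with rreg := Function.update s.rreg x (o.eval (s.rreg y) (s.rreg z)) }
  | .floor x y => P { s with rreg := Function.update s.rreg x (⌊s.rreg y⌋ : ℝ) }
  | .realLoad x a => s.ireg a < S ∧
      P { s with rreg := Function.update s.rreg x (s.rmem (s.ireg a)) }
  | .realStore a x => s.ireg a < S ∧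
      P { s with rmem := Function.update s.rmem (s.ireg a) (s.rreg x) }
  | .input x a => P { s with rreg := Function.update s.rreg x (inp (s.ireg a)) }

theorem Runs.instr {i : Instr} {s : State} {P : State → Prop} (h : i.wp S inp s P) :
    Runs S inp (.instr i) s 1 P := by
  cases i <;> simp only [Instr.wp] at h <;>
    first
    | exact ⟨_, 1, .instr (if_pos h.1), le_rfl, h.2⟩
    | exact ⟨_, 1, .instr rfl, le_rfl, h⟩

/-- A block of instructions. -/
def block : List Instr → Cmd
  | [] => .skip
  | i :: l => .seq (.instr i) (block l)

/-- The weakest precondition of a block. -/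
def wps (S : ℕ) (inp : ℕ → ℝ) : List Instr → State → (State → Prop) → Prop
  | [], s, P => P s
  | i :: l, s, P => i.wp S inp s fun s' => wps S inp l s' P

theorem Runs.block {l : List Instr} {s : State} {T : ℕ} {P : State → Prop}
    (hT : l.length ≤ T) (h : wps S inp l s P) : Runs S inp (block l) s T P := by
  induction l generalizing s T with
  | nil => exact Runs.skip h
  | cons i l ih =>
    simp only [List.length_cons] at hT
    exact Runs.seq 1 (T - 1) (by omega) (Runs.instr h) fun s' _ h' => ih (by omega) h'

end rules

/-! ### Guessing a row -/

/-- Reading the digits of `q` to base `4`: stop at `0`, add `K` at `1`, subtract `K` at `2`, and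
proceed to the next starting value at `3`. -/
noncomputable def guess (K : ℝ) (f : ℕ → ℝ) (q a : ℕ) (x : ℝ) : ℕ × ℕ × ℝ :=
  if q % 4 = 0 then (q / 4, a, x)
  else if q % 4 = 1 then guess K f (q / 4) a (x + K)
  else if q % 4 = 2 then guess K f (q / 4) a (x - K)
  else guess K f (q / 4) (a + 1) (f (a + 1))
termination_by q
decreasing_by all_goals omega

/-- The registers that hold the size parameters and small constants. -/
structure Consts (n m d K : ℕ) (s : State) : Prop where
  r0 : s.ireg 0 = n
  r1 : s.ireg 1 = m
  r2 : s.ireg 2 = d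
  r3 : s.ireg 3 = m * d
  r4 : s.ireg 4 = m * d + 1
  r5 : s.ireg 5 = K
  r20 : s.ireg 20 = 1
  r21 : s.ireg 21 = 2
  r22 : s.ireg 22 = 3
  r23 : s.ireg 23 = 4
  r24 : s.ireg 24 = 0

theorem Consts.frame {n m d K : ℕ} {s s' : State} {c : Cmd} (h : Consts n m d K s)
    (hf : Frame c s s')
    (hc : ([0, 1, 2, 3, 4, 5, 20, 21, 22, 23, 24].all fun x => !c.writesInt x) = true) :
    Consts n m d K s' := by
  simp only [List.all_cons, List.all_nil, Bool.and_true, Bool.and_eq_true,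
    Bool.not_eq_true'] at hc
  obtain ⟨h0, h1, h2, h3, h4, h5, h20, h21, h22, h23, h24⟩ := hc
  constructor
  · rw [hf.i _ h0, h.r0]
  · rw [hf.i _ h1, h.r1]
  · rw [hf.i _ h2, h.r2]
  · rw [hf.i _ h3, h.r3]
  · rw [hf.i _ h4, h.r4]
  · rw [hf.i _ h5, h.r5]
  · rw [hf.i _ h20, h.r20]
  · rw [hf.i _ h21, h.r21]
  · rw [hf.i _ h22, h.r22]
  · rw [hf.i _ h23, h.r23]
  · rw [hf.i _ h24, h.r24]

/-- Read the starting value for the coordinate in register `15`. -/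
def loadStart : List Instr :=
  [.intOp .mul 16 10 1, .intOp .add 16 16 12, .intOp .mul 16 16 2, .intOp .add 16 16 15,
    .input 6 16, .realOp .div 6 6 3, .floor 6 6]

/-- Split a digit to the base in register `b` off the code in register `9`. -/
def readDigit (b : ℕ) : List Instr :=
  [.intOp .div 18 9 b, .intOp .mul 18 18 b, .intOp .sub 18 9 18, .intOp .div 9 9 b]

/-- Integer register 18 holds the digit to be executed and register 9 the code above it. The next
digit is split off last, so that the loop test in `guessCoord` can recognise the stop digit 0. -/
def guessStep : Cmd :=
  .seq (.ite (.intLt 18 21) (block [.realOp .add 6 6 7])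
    (.ite (.intLt 18 22) (block [.realOp .sub 6 6 7])
      (block (.intOp .add 12 12 20 :: loadStart)))) (block (readDigit 23))

def guessCoord : Cmd :=
  .seq (block ([.intOp .div 15 14 2, .intOp .mul 15 15 2, .intOp .sub 15 14 15] ++ loadStart ++
      readDigit 23))
    (.seq (.while (.intLt 24 18) guessStep)
      (block (readDigit 5 ++ [.ofInt 8 18, .realOp .add 6 6 8, .intOp .add 16 11 14,
        .realStore 16 6, .intOp .add 14 14 20])))

theorem guess_zero {K : ℝ} {f : ℕ → ℝ} {q a : ℕ} {x : ℝ} (h : q % 4 = 0) :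
    guess K f q a x = (q / 4, a, x) := by
  rw [guess, if_pos h]

/-- A digit 3 raises the index by one while the code loses at least that much. A senseless code may
push the index beyond the curve; this bound still keeps the input addresses within the range of the
integer registers. -/
theorem guess_bound (K : ℝ) (f : ℕ → ℝ) (q a : ℕ) (x : ℝ) :
    (guess K f q a x).2.1 + (guess K f q a x).1 ≤ a + q := by
  fun_induction guess K f q a x <;> (try simp only) <;> omega

theorem mod_eq_sub (q b : ℕ) : q - q / b * b = q % b := by
  have := Nat.div_add_mod q b
  rw [Nat.mul_comm] at this
  omega

section

variable {S : ℕ} {inp : ℕ → ℝ} {n m d K : ℕ}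

theorem guessStep_spec {s : State} (hc : Consts n m d K s) (sd : ℝ) (i k M : ℕ)
    (h3 : s.rreg 3 = sd) (h7 : s.rreg 7 = K) (h10 : s.ireg 10 = i) (h15 : s.ireg 15 = k)
    (q : ℕ) (hq0 : q % 4 ≠ 0) (hq : s.ireg 9 = q / 4) (hdig : s.ireg 18 = q % 4)
    (haq : s.ireg 12 + q ≤ M) (hM : (i * m + M) * d + k ≤ S) (hd : 1 ≤ d) :
    Runs S inp guessStep s 14 fun s' => s'.ireg 18 = (q / 4) % 4 ∧ s'.ireg 9 = q / 4 / 4 ∧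
      s'.ireg 12 + q / 4 ≤ M ∧
      guess K (fun a => ⌊inp ((i * m + a) * d + k) / sd⌋) (q / 4) (s'.ireg 12) (s'.rreg 6) =
      guess K (fun a => ⌊inp ((i * m + a) * d + k) / sd⌋) q (s.ireg 12) (s.rreg 6) := by
  have hMS : M ≤ S := by
    have : i * m + M ≤ (i * m + M) * d := Nat.le_mul_of_pos_right _ hd
    omega
  refine Runs.seq 10 4 (by norm_num) (Q := fun s' => 
      s'.ireg 12 + q / 4 ≤ M ∧
      guess K (fun a => ⌊inp ((i * m + a) * d + k) / sd⌋) (q / 4) (s'.ireg 12) (s'.rreg 6) =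
      guess K (fun a => ⌊inp ((i * m + a) * d + k) / sd⌋) q (s.ireg 12) (s.rreg 6)) ?_ ?_
  · refine Runs.ite 9 (by norm_num) (fun h => ?_) (fun h => ?_)
    · simp only [Test.holds, hdig, hc.r21] at h
      refine Runs.block (by simp) ?_
      have : q % 4 = 1 := by omega
      rw [guess.eq_1 _ _ q]
      simp [wps, Instr.wp, h7, RealOp.eval, this]
      omega
    · refine Runs.ite 8 (by norm_num) (fun h' => ?_) (fun h' => ?_)
      · simp only [Test.holds, hdig, hc.r21, hc.r22] at h h'
        refine Runs.block (by simp) ?_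
        have : q % 4 = 2 := by omega
        rw [guess.eq_1 _ _ q]
        simp [wps, Instr.wp, h7, RealOp.eval, this]
        omega
      · simp only [Test.holds, hdig, hc.r21, hc.r22] at h h'
        refine Runs.block (by simp [loadStart]) ?_
        have : q % 4 = 3 := by omega
        have ha : s.ireg 12 + 1 ≤ M := by omega
        rw [guess.eq_1 _ _ q]
        have e1 : (i * m + (s.ireg 12 + 1)) * d ≤ (i * m + M) * d :=
          Nat.mul_le_mul_right _ (by omega)
        have e2 : i * m + (s.ireg 12 + 1) ≤ (i * m + (s.ireg 12 + 1)) * d :=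
          Nat.le_mul_of_pos_right _ hd
        simp [wps, Instr.wp, RealOp.eval, IntOp.eval, this, loadStart,
          hc.r1, hc.r2, hc.r20, h10, h3, h15]
        omega
  · rintro s' hf ⟨h1, h2⟩
    have h9 := hf.i 9 rfl
    have h23 := hf.i 23 rfl
    rw [hq] at h9
    rw [hc.r23] at h23
    refine Runs.block (by simp [readDigit]) ?_
    simp [wps, Instr.wp, readDigit, IntOp.eval, h9, h23, mod_eq_sub, h1, h2]
    omega

/-- The guess of one coordinate: the remaining code, the index of the point, and the value. -/
noncomputable def guessValue (K : ℕ) (sd : ℝ) (X : ℕ → ℕ → ℝ) (k q a : ℕ) : ℕ × ℕ × ℝ :=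
  ((guess K (fun a => ⌊X a k / sd⌋) q a ⌊X a k / sd⌋).1 / K,
    (guess K (fun a => ⌊X a k / sd⌋) q a ⌊X a k / sd⌋).2.1,
    (guess K (fun a => ⌊X a k / sd⌋) q a ⌊X a k / sd⌋).2.2 +
      ((guess K (fun a => ⌊X a k / sd⌋) q a ⌊X a k / sd⌋).1 % K : ℕ))

/-- The remaining code and the index of the point after `l` coordinates. -/
noncomputable def guessState (K d : ℕ) (sd : ℝ) (X : ℕ → ℕ → ℝ) (q : ℕ) : ℕ → ℕ × ℕ
  | 0 => (q, 0)
  | l + 1 => ((guessValue K sd X (l % d) (guessState K d sd X q l).1 (guessState K d sd X q l).2).1,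
      (guessValue K sd X (l % d) (guessState K d sd X q l).1 (guessState K d sd X q l).2).2.1)

/-- The row guessed from the code `q`. -/
noncomputable def guessRow (K d : ℕ) (sd : ℝ) (X : ℕ → ℕ → ℝ) (q l : ℕ) : ℝ :=
  (guessValue K sd X (l % d) (guessState K d sd X q l).1 (guessState K d sd X q l).2).2.2

theorem guessCoord_spec {s : State} (hc : Consts n m d K s) (sd : ℝ) (i l M L R : ℕ)
    (h3 : s.rreg 3 = sd) (h7 : s.rreg 7 = K) (h10 : s.ireg 10 = i) (h14 : s.ireg 14 = l)
    (haq : s.ireg 12 + s.ireg 9 ≤ M) (hM : (i * m + M) * d + d ≤ S) (hd : 1 ≤ d)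
    (hL : s.ireg 9 < 2 ^ L) (hR : s.ireg 11 = R) (hRS : R + l < S) :
    Runs S inp guessCoord s (15 * L + 38) fun s' =>
      s'.ireg 14 = l + 1 ∧
      s'.ireg 9 = (guessValue K sd (fun a k => inp ((i * m + a) * d + k)) (l % d)
        (s.ireg 9) (s.ireg 12)).1 ∧
      s'.ireg 12 = (guessValue K sd (fun a k => inp ((i * m + a) * d + k)) (l % d)
        (s.ireg 9) (s.ireg 12)).2.1 ∧
      s'.rmem = Function.update s.rmem (R + l)
        (guessValue K sd (fun a k => inp ((i * m + a) * d + k)) (l % d)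
        (s.ireg 9) (s.ireg 12)).2.2 := by
  have hk : l % d < d := Nat.mod_lt _ hd
  have e1 : (i * m + s.ireg 12) * d ≤ (i * m + M) * d := Nat.mul_le_mul_right _ (by omega)
  have e2 : i * m + s.ireg 12 ≤ (i * m + s.ireg 12) * d := Nat.le_mul_of_pos_right _ hd
  have e3 : i * m + M ≤ (i * m + M) * d := Nat.le_mul_of_pos_right _ hd
  have e4 : s.ireg 9 / 4 * 4 ≤ s.ireg 9 := Nat.div_mul_le_self _ _
  have e5 : l / d * d ≤ l := Nat.div_mul_le_self _ _
  have e6 : l / d ≤ l := Nat.div_le_self _ _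
  have e7 : l % d ≤ l := Nat.mod_le _ _
  have e8 : s.ireg 9 % 4 ≤ s.ireg 9 := Nat.mod_le _ _
  refine Runs.seq 14 (15 * L + 24) (by omega) (Q := fun s' => s'.ireg 15 = l % d ∧
      s'.ireg 18 = s.ireg 9 % 4 ∧ s'.ireg 9 = s.ireg 9 / 4 ∧
      s'.rreg 6 = ⌊inp ((i * m + s.ireg 12) * d + l % d) / sd⌋) ?_ ?_
  · refine Runs.block (by simp [loadStart, readDigit]) ?_
    simp [wps, Instr.wp, readDigit, loadStart, IntOp.eval, RealOp.eval, hc.r2, hc.r1, hc.r23,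
      h14, h10, h3, mod_eq_sub]
    omega
  rintro s1 hf1 ⟨h1, h2, h4, h5⟩
  have c1 := hc.frame hf1 rfl
  refine Runs.seq (L * 15 + 1) 9 (by omega) (Q := fun s' =>
      guess K (fun a => ⌊inp ((i * m + a) * d + l % d) / sd⌋) (s.ireg 9) (s.ireg 12)
      ⌊inp ((i * m + s.ireg 12) * d + l % d) / sd⌋ = (s'.ireg 9, s'.ireg 12, s'.rreg 6)) ?_ ?_
  -- The code q of the invariant still includes the digit already split off into register 18. Each
  -- round divides q by 4, so its bound on the binary length k drops by at least one; k = 0 would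
  -- make the digit 0.
  · refine Runs.while (fun k s' => ∃ q, s'.ireg 18 = q % 4 ∧ s'.ireg 9 = q / 4 ∧ q < 2 ^ k ∧
      s'.ireg 12 + q ≤ M ∧
      guess K (fun a => ⌊inp ((i * m + a) * d + l % d) / sd⌋) (s.ireg 9) (s.ireg 12)
      ⌊inp ((i * m + s.ireg 12) * d + l % d) / sd⌋ =
      guess K (fun a => ⌊inp ((i * m + a) * d + l % d) / sd⌋) q (s'.ireg 12) (s'.rreg 6))
      L 14 (by omega) ?_ ?_ ?_
    · refine ⟨s.ireg 9, h2, h4, hL, ?_, ?_⟩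
      · rw [hf1.i 12 rfl]; exact haq
      · rw [hf1.i 12 rfl, h5]
    · rintro k s2 hf2 ⟨q, g1, g2, g3, g4, g5⟩ hb
      have c2 := c1.frame hf2 rfl
      simp only [Test.holds, c2.r24, g1] at hb
      have hk1 : 1 ≤ k := by
        by_contra h
        have : k = 0 := by omega
        subst this
        simp at g3
        omega
      refine ⟨k - 1, by omega, ?_⟩
      refine (guessStep_spec (S := S) (inp := inp) c2 sd i (l % d) M ?_ ?_ ?_ ?_ q (by omega)
        g2 g1 g4 (by omega) hd).mono le_rfl ?_
      · rw [hf2.r 3 rfl, hf1.r 3 rfl, h3]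
      · rw [hf2.r 7 rfl, hf1.r 7 rfl, h7]
      · rw [hf2.i 10 rfl, hf1.i 10 rfl, h10]
      · rw [hf2.i 15 rfl, h1]
      · rintro s3 - ⟨k1, k2, k3, k4⟩
        refine ⟨q / 4, k1, k2, ?_, k3, by rw [g5, k4]⟩
        obtain ⟨j, rfl⟩ : ∃ j, k = j + 1 := ⟨k - 1, by omega⟩
        rw [pow_succ] at g3
        simp only [Nat.add_sub_cancel]
        omega
    · rintro k s2 hf2 ⟨q, g1, g2, g3, g4, g5⟩ hb
      have c2 := c1.frame hf2 rfl
      simp only [Test.holds, c2.r24, g1] at hb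
      rw [g5, guess_zero (by omega), g2]
  · intro s2 hf2 hg
    have c2 := c1.frame hf2 rfl
    have gb := guess_bound K (fun a => ⌊inp ((i * m + a) * d + l % d) / sd⌋) (s.ireg 9) (s.ireg 12)
      ⌊inp ((i * m + s.ireg 12) * d + l % d) / sd⌋
    rw [hg] at gb
    simp only at gb
    have j7 : s2.rreg 7 = K := by rw [hf2.r 7 rfl, hf1.r 7 rfl, h7]
    have j11 : s2.ireg 11 = R := by rw [hf2.i 11 rfl, hf1.i 11 rfl, hR]
    have j14 : s2.ireg 14 = l := by rw [hf2.i 14 rfl, hf1.i 14 rfl, h14]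
    have jm : s2.rmem = s.rmem := by rw [hf2.rm rfl, hf1.rm rfl]
    have k1 : s2.ireg 9 / K ≤ s2.ireg 9 := Nat.div_le_self _ _
    have k2 : s2.ireg 9 / K * K ≤ s2.ireg 9 := Nat.div_mul_le_self _ _
    have k3 : s2.ireg 9 % K ≤ s2.ireg 9 := Nat.mod_le _ _
    refine Runs.block (by simp [readDigit]) ?_
    simp [wps, Instr.wp, readDigit, IntOp.eval, RealOp.eval, c2.r5, c2.r20, j11, j14, mod_eq_sub,
      guessValue, hg, jm]
    omega

end

section

variable {S : ℕ} {inp : ℕ → ℝ} {n m d K : ℕ}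

theorem guessState_bound (K d : ℕ) (sd : ℝ) (X : ℕ → ℕ → ℝ) (q l : ℕ) :
    (guessState K d sd X q l).2 + (guessState K d sd X q l).1 ≤ q := by
  induction l with
  | zero => simp [guessState]
  | succ l ih =>
    have := guess_bound K (fun a => ⌊X a (l % d) / sd⌋) (guessState K d sd X q l).1
      (guessState K d sd X q l).2 ⌊X (guessState K d sd X q l).2 (l % d) / sd⌋
    have h2 := Nat.div_le_self (guess K (fun a => ⌊X a (l % d) / sd⌋) (guessState K d sd X q l).1
      (guessState K d sd X q l).2 ⌊X (guessState K d sd X q l).2 (l % d) / sd⌋).1 K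
    simp only [guessState, guessValue]
    omega

def guessCoords : Cmd := .while (.intLt 14 3) guessCoord

theorem guessCoords_spec {s : State} (hc : Consts n m d K s) (sd : ℝ) (i q L R : ℕ)
    (h3 : s.rreg 3 = sd) (h7 : s.rreg 7 = K) (h10 : s.ireg 10 = i) (h14 : s.ireg 14 = 0)
    (h9 : s.ireg 9 = q) (h12 : s.ireg 12 = 0) (hM : (i * m + q) * d + d ≤ S) (hd : 1 ≤ d)
    (hL : q < 2 ^ L) (hR : s.ireg 11 = R) (hRS : R + m * d ≤ S) :
    Runs S inp guessCoords s (m * d * (15 * L + 39) + 1) fun s' =>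
      s'.ireg 9 = (guessState K d sd (fun a k => inp ((i * m + a) * d + k)) q (m * d)).1 ∧
      (∀ l < m * d, s'.rmem (R + l) =
        guessRow K d sd (fun a k => inp ((i * m + a) * d + k)) q l) ∧
      ∀ x, (x < R ∨ R + m * d ≤ x) → s'.rmem x = s.rmem x := by
  set X : ℕ → ℕ → ℝ := fun a k => inp ((i * m + a) * d + k) with hX
  refine Runs.for (fun l s' => s'.ireg 14 = l ∧
      s'.ireg 9 = (guessState K d sd X q l).1 ∧ s'.ireg 12 = (guessState K d sd X q l).2 ∧
      (∀ l' < l, s'.rmem (R + l') = guessRow K d sd X q l') ∧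
      ∀ x, (x < R ∨ R + m * d ≤ x) → s'.rmem x = s.rmem x) (m * d) (15 * L + 38) le_rfl ?_ ?_ ?_ ?_
  · exact ⟨h14, h9, h12, by simp, fun _ _ => rfl⟩
  · rintro l s' hf hl ⟨g1, -⟩
    simp only [Test.holds, g1, (hc.frame hf rfl).r3]
  · rintro l s' hf hl ⟨g1, g2, g3, g4, g5⟩
    have gb := guessState_bound K d sd X q l
    refine (guessCoord_spec (S := S) (inp := inp) (hc.frame hf rfl) sd i l q L R
      ?_ ?_ ?_ g1 ?_ hM hd ?_ ?_ ?_).mono le_rfl ?_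
    · rw [hf.r 3 rfl, h3]
    · rw [hf.r 7 rfl, h7]
    · rw [hf.i 10 rfl, h10]
    · omega
    · omega
    · rw [hf.i 11 rfl, hR]
    · omega
    · rintro s'' - ⟨k1, k2, k3, k4⟩
      rw [g2, g3] at k2 k3 k4
      refine ⟨k1, k2, k3, ?_, ?_⟩
      · intro l' hl'
        rw [k4]
        rcases Nat.lt_succ_iff_lt_or_eq.1 hl' with h | rfl
        · rw [Function.update_of_ne (by omega), g4 l' h]
        · rw [Function.update_self, guessRow]
      · intro x hx
        rw [k4, Function.update_of_ne (by omega), g5 x hx]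
  · rintro s' hf ⟨-, g2, -, g4, g5⟩
    exact ⟨g2, g4, g5⟩

/-! ### The cost of a walk -/

/-- The contribution of a pair of points to the cost. -/
noncomputable def pairCost (d : ℕ) (e : ℝ) (x y : ℕ → ℝ) : ℝ :=
  (max (∑ k ∈ Finset.range d, (x k - y k) * (x k - y k)) 0) ^ e

/-- The rows are stored in units of the grid, hence the multiplication by the side in real register
3. Real register 10 holds the exponent for the squared norm; in the preprocessing it is p/2, so that
no square root is taken. -/
def addCost : Cmd :=
  .seq (block [.intConst 15 0, .ofInt 9 24, .intOp .mul 16 10 1, .intOp .add 16 16 12,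
      .intOp .mul 16 16 2, .intOp .mul 17 13 2, .intOp .add 17 17 11])
    (.seq (.while (.intLt 15 2) (block [.input 6 16, .realLoad 8 17, .realOp .mul 8 8 3,
        .realOp .sub 6 6 8, .realOp .mul 6 6 6, .realOp .add 9 9 6, .intOp .add 16 16 20,
        .intOp .add 17 17 20, .intOp .add 15 15 20]))
      (block [.realOp .pow 9 9 10, .realOp .add 5 5 9]))

theorem addCost_spec {s : State} (hc : Consts n m d K s) (sd e : ℝ) (i R a b : ℕ)
    (h3 : s.rreg 3 = sd) (h10 : s.ireg 10 = i) (hR : s.ireg 11 = R) (ha : s.ireg 12 = a)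
    (hb : s.ireg 13 = b) (he : s.rreg 10 = e) (haS : (i * m + a) * d + d ≤ S)
    (hbS : R + b * d + d ≤ S) (hd : 1 ≤ d) :
    Runs S inp addCost s (10 * d + 10) fun s' => s'.rreg 5 = s.rreg 5 +
      pairCost d e (fun k => inp ((i * m + a) * d + k)) fun k => s.rmem (R + (b * d + k)) * sd := by
  have e1 : i * m + a ≤ (i * m + a) * d := Nat.le_mul_of_pos_right _ hd
  refine Runs.seq 7 (10 * d + 3) (by omega) (Q := fun s' => s'.ireg 15 = 0 ∧ s'.rreg 9 = 0 ∧
      s'.ireg 16 = (i * m + a) * d ∧ s'.ireg 17 = R + b * d) ?_ ?_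
  · refine Runs.block (by simp) ?_
    simp [wps, Instr.wp, IntOp.eval, hc.r1, hc.r2, hc.r24, ha, hb, hR, h10]
    omega
  rintro s1 hf1 ⟨g1, g2, g3, g4⟩
  have c1 := hc.frame hf1 rfl
  refine Runs.seq (d * 10 + 1) 2 (by omega) (Q := fun s' => s'.rreg 9 = ∑ k ∈ Finset.range d,
    (inp ((i * m + a) * d + k) - s.rmem (R + (b * d + k)) * sd) *
      (inp ((i * m + a) * d + k) - s.rmem (R + (b * d + k)) * sd)) ?_ ?_
  · refine Runs.for (fun l s' => s'.ireg 15 = l ∧ s'.ireg 16 = (i * m + a) * d + l ∧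
      s'.ireg 17 = R + b * d + l ∧ s'.rreg 9 = ∑ k ∈ Finset.range l,
    (inp ((i * m + a) * d + k) - s.rmem (R + (b * d + k)) * sd) *
      (inp ((i * m + a) * d + k) - s.rmem (R + (b * d + k)) * sd)) d 9 (by omega) ?_ ?_ ?_ ?_
    · simp [g1, g2, g3, g4]
    · rintro l s' hf hl ⟨k1, -⟩
      simp only [Test.holds, k1, (c1.frame hf rfl).r2]
    · rintro l s' hf hl ⟨k1, k2, k3, k4⟩
      have j3 : s'.rreg 3 = sd := by rw [hf.r 3 rfl, hf1.r 3 rfl, h3]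
      have jm : s'.rmem = s.rmem := by rw [hf.rm rfl, hf1.rm rfl]
      refine Runs.block (by simp) ?_
      simp [wps, Instr.wp, IntOp.eval, RealOp.eval, k1, k2, k3, k4, (c1.frame hf rfl).r20, j3, jm,
        Finset.sum_range_succ, Nat.add_assoc]
      omega
    · rintro s' hf ⟨-, -, -, k4⟩
      exact k4
  · intro s2 hf2 k
    have j10 : s2.rreg 10 = e := by rw [hf2.r 10 rfl, hf1.r 10 rfl, he]
    have j5 : s2.rreg 5 = s.rreg 5 := by rw [hf2.r 5 rfl, hf1.r 5 rfl]
    refine Runs.block (by simp) ?_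
    simp [wps, Instr.wp, RealOp.eval, k, j10, j5, pairCost]

/-- The pairs visited by the walk with the code `q` (digits to the base `3`) from the pair `(a, b)`
until both indices are `m`, if it gets there. -/
def walk (m : ℕ) : ℕ → ℕ → ℕ → ℕ → Option (List (ℕ × ℕ))
  | 0, _, a, b => if a = m ∧ b = m then some [] else none
  | f + 1, q, a, b =>
    if a < m then
      if b < m then
        (walk m f (q / 3) (if q % 3 = 2 then a else a + 1) (if q % 3 = 1 then b else b + 1)).map
          ((a, b) :: ·)
      else none
    else if a = m ∧ b = m then some [] else none

theorem walk_end (m f q b : ℕ) : walk m f q m b = if b = m then some [] else none := by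
  cases f <;> simp [walk]

def walkStep : Cmd :=
  .seq addCost (.seq (block (readDigit 22))
    (.ite (.intLe 18 24) (block [.intOp .add 12 12 20, .intOp .add 13 13 20])
      (.ite (.intLt 18 21) (block [.intOp .add 12 12 20]) (block [.intOp .add 13 13 20]))))

/-- If the second index runs out first, the loop is left with the indices m and 0. Since m ≥ 1,
register 13 ends up equal to m exactly for walks that arrive at (m, m). -/
def walkCost : Cmd :=
  .while (.intLt 12 1) (.ite (.intLt 13 1) walkStep
    (block [.intOp .add 12 1 24, .intConst 13 0]))

theorem walkCost_spec {s : State} (hc : Consts n m d K s) (sd e : ℝ) (i R q : ℕ)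
    (h3 : s.rreg 3 = sd) (h10 : s.ireg 10 = i) (hR : s.ireg 11 = R) (ha : s.ireg 12 = 0)
    (hb : s.ireg 13 = 0) (hq : s.ireg 9 = q) (h5 : s.rreg 5 = 0)
    (he : s.rreg 10 = e) (haS : (i * m + m) * d ≤ S) (hqS : q ≤ S)
    (hbS : R + m * d ≤ S) (hd : 1 ≤ d) (hm : 1 ≤ m) :
    Runs S inp walkCost s (2 * m * (10 * d + 20) + 1) fun s' =>
      (s'.ireg 13 = m ∧ ∃ τ, walk m (2 * m) q 0 0 = some τ ∧ s'.rreg 5 = (τ.map fun x =>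
        pairCost d e (fun k => inp ((i * m + x.1) * d + k))
          fun k => s.rmem (R + (x.2 * d + k)) * sd).sum) ∨
      (s'.ireg 13 < m ∧ walk m (2 * m) q 0 0 = none) := by
  set F : ℕ × ℕ → ℝ := fun x => pairCost d e (fun k => inp ((i * m + x.1) * d + k))
          fun k => s.rmem (R + (x.2 * d + k)) * sd with hF
  -- Here k is the fuel left for `walk`. Every step raises the sum of the indices, so the inequality
  -- with 2m persists as long as the first index is below m, and it shows that the fuel cannot run
  -- out before then.
  refine Runs.while (fun k s' => s'.ireg 12 ≤ m ∧ s'.ireg 13 ≤ m ∧ s'.ireg 9 ≤ S ∧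
    (s'.ireg 12 < m → 2 * m ≤ s'.ireg 12 + s'.ireg 13 + k) ∧
    ∃ τ, walk m (2 * m) q 0 0 = (walk m k (s'.ireg 9) (s'.ireg 12) (s'.ireg 13)).map (τ ++ ·) ∧
      s'.rreg 5 = (τ.map F).sum) (2 * m) (10 * d + 19) le_rfl ?_ ?_ ?_
  · refine ⟨by omega, by omega, by omega, by omega, [], ?_, by simp [h5]⟩
    simp [ha, hb, hq]
  · rintro k s' hf ⟨k1, k2, k3, k4, τ, k5, k6⟩ ht
    have c' := hc.frame hf rfl
    simp only [Test.holds, c'.r1] at ht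
    have hk : 1 ≤ k := by omega
    obtain ⟨k, rfl⟩ : ∃ j, k = j + 1 := ⟨k - 1, by omega⟩
    refine ⟨k, by omega, ?_⟩
    refine Runs.ite (10 * d + 18) (by omega) (fun h => ?_) (fun h => ?_)
    · simp only [Test.holds, c'.r1] at h
      generalize haa : s'.ireg 12 = a at *
      generalize hbb : s'.ireg 13 = b at *
      generalize hqq : s'.ireg 9 = q' at *
      have e1 : (i * m + a) * d + d ≤ (i * m + m) * d := by
        rw [← Nat.succ_mul]; exact Nat.mul_le_mul_right _ (by omega)
      have e2 : b * d + d ≤ m * d := by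
        rw [← Nat.succ_mul]; exact Nat.mul_le_mul_right _ (by omega)
      have hmS : m ≤ S := by
        have : m ≤ m * d := Nat.le_mul_of_pos_right _ hd
        omega
      refine Runs.seq (10 * d + 10) 8 (by omega) (addCost_spec (S := S) (inp := inp) c' sd e i R a b
        (by rw [hf.r 3 rfl, h3]) (by rw [hf.i 10 rfl, h10]) (by rw [hf.i 11 rfl, hR]) haa hbb
        (by rw [hf.r 10 rfl, he]) (by omega) (by omega) hd) ?_
      intro s1 hf1 j1
      have c1 := c'.frame hf1 rfl
      rw [k6, hf.rm rfl] at j1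
      have l1 : s1.ireg 9 = q' := by rw [hf1.i 9 rfl, hqq]
      have l2 : s1.ireg 12 = a := by rw [hf1.i 12 rfl, haa]
      have l3 : s1.ireg 13 = b := by rw [hf1.i 13 rfl, hbb]
      have e3 : q' / 3 * 3 ≤ q' := Nat.div_mul_le_self _ _
      refine Runs.seq 4 4 (by omega) (Q := fun s' => s'.ireg 18 = q' % 3 ∧
        s'.ireg 9 = q' / 3 ∧ s'.ireg 12 = a ∧ s'.ireg 13 = b ∧ s'.rreg 5 = s1.rreg 5) ?_ ?_
      · refine Runs.block (by simp [readDigit]) ?_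
        simp [wps, Instr.wp, readDigit, IntOp.eval, c1.r22, l1, l2, l3, mod_eq_sub]
        omega
      rintro s2 hf2 ⟨m1, m2, m3, m4, m5⟩
      have c2 := c1.frame hf2 rfl
      have key : ∀ a' b', a' = (if q' % 3 = 2 then a else a + 1) →
          b' = (if q' % 3 = 1 then b else b + 1) →
          a' ≤ m ∧ b' ≤ m ∧ q' / 3 ≤ S ∧ (a' < m → 2 * m ≤ a' + b' + k) ∧
          ∃ τ, walk m (2 * m) q 0 0 = (walk m k (q' / 3) a' b').map (τ ++ ·) ∧
            s2.rreg 5 = (τ.map F).sum := by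
        rintro a' b' rfl rfl
        refine ⟨by split_ifs <;> omega, by split_ifs <;> omega, by omega,
          by split_ifs <;> omega, τ ++ [(a, b)], ?_, ?_⟩
        · rw [k5, walk, if_pos ht, if_pos h, Option.map_map]
          congr 1
          funext l
          simp
        · rw [m5, j1]
          simp [hF]
      refine Runs.ite 3 (by omega) (fun h' => ?_) (fun h' => ?_)
      · simp only [Test.holds, m1, c2.r24] at h'
        refine Runs.block (by simp) ?_
        have := key (a + 1) (b + 1) (by rw [if_neg (by omega)]) (by rw [if_neg (by omega)])
        simp [wps, Instr.wp, IntOp.eval, c2.r20, m2, m3, m4]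
        exact ⟨by omega, by omega, this⟩
      · simp only [Test.holds, m1, c2.r24] at h'
        refine Runs.ite 2 (by omega) (fun h'' => ?_) (fun h'' => ?_)
        · simp only [Test.holds, m1, c2.r21] at h''
          refine Runs.block (by simp) ?_
          have := key (a + 1) b (by rw [if_neg (by omega)]) (by rw [if_pos (by omega)])
          simp [wps, Instr.wp, IntOp.eval, c2.r20, m2, m3, m4]
          exact ⟨by omega, this⟩
        · simp only [Test.holds, m1, c2.r21] at h''
          refine Runs.block (by simp) ?_
          have := key a (b + 1) (by rw [if_pos (by omega)]) (by rw [if_neg (by omega)])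
          simp [wps, Instr.wp, IntOp.eval, c2.r20, m2, m3, m4]
          exact ⟨by omega, this⟩
    · simp only [Test.holds, c'.r1] at h
      have hmS : m ≤ S := by
        have : m ≤ m * d := Nat.le_mul_of_pos_right _ hd
        omega
      refine Runs.block (by simp) ?_
      simp [wps, Instr.wp, IntOp.eval, c'.r1, c'.r24, k3, hmS]
      refine ⟨τ, ?_, k6⟩
      rw [k5, walk_end, walk, if_pos ht, if_neg h, if_neg (by omega)]
  · rintro k s' hf ⟨k1, k2, k3, k4, τ, k5, k6⟩ ht
    simp only [Test.holds, (hc.frame hf rfl).r1] at ht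
    have : s'.ireg 12 = m := by omega
    rw [this, walk_end] at k5
    by_cases hbm : s'.ireg 13 = m
    · exact Or.inl ⟨hbm, τ, by simpa [hbm] using k5, k6⟩
    · exact Or.inr ⟨by omega, by simpa [hbm] using k5⟩

end

/-! ### Enumerating the candidate rows -/

/-- The coordinate `k` of the point `a` of the curve `i` of the input. -/
def inputPoint (inp : ℕ → ℝ) (m d i a k : ℕ) : ℝ := inp ((i * m + a) * d + k)

/-- The code `z` stands for the curve `z % n`, a row and a walk within the allowed cost. -/
def Emits (inp : ℕ → ℝ) (n m d K : ℕ) (sd e θ : ℝ) (z : ℕ) : Prop :=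
  ∃ τ, walk m (2 * m)
      (guessState K d sd (inputPoint inp m d (z % n)) (z / n) (m * d)).1 0 0 = some τ ∧
    (τ.map fun x => pairCost d e (inputPoint inp m d (z % n) x.1) fun k =>
      guessRow K d sd (inputPoint inp m d (z % n)) (z / n) (x.2 * d + k) * sd).sum ≤ θ

/-- The row `k` of the real memory is the one that belongs to the code `z`. -/
def HoldsRow (inp : ℕ → ℝ) (n m d K : ℕ) (sd : ℝ) (mem : ℕ → ℝ) (k z : ℕ) : Prop :=
  (∀ l < m * d, mem (1 + k * (m * d + 1) + l) =
    guessRow K d sd (inputPoint inp m d (z % n)) (z / n) l) ∧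
  mem (1 + k * (m * d + 1) + m * d) = (z % n : ℕ)

/-- The row is written directly into the next free slot, numbered by register 7. The counter
advances only on acceptance, so a rejected row is overwritten by the next candidate. -/
def enumBody : Cmd :=
  .seq (block [.intOp .div 9 8 0, .intOp .mul 15 9 0, .intOp .sub 10 8 15, .intOp .mul 11 7 4,
      .intOp .add 11 11 20, .intConst 12 0, .intConst 14 0])
    (.seq guessCoords
      (.seq (block [.intConst 12 0, .intConst 13 0, .ofInt 5 24])
        (.seq walkCost
          (.seq (.ite (.intLe 1 13) (.ite (.realLe 5 4) (block [.intOp .add 15 11 3, .ofInt 6 10,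
              .realStore 15 6, .intOp .add 7 7 20]) .skip) .skip)
            (block [.intOp .add 8 8 20])))))

theorem walk_lt {m f q a b : ℕ} {τ : List (ℕ × ℕ)} (h : walk m f q a b = some τ) :
    ∀ x ∈ τ, x.1 < m ∧ x.2 < m := by
  induction f generalizing q a b τ with
  | zero =>
    simp only [walk] at h
    split_ifs at h
    simp_all
  | succ f ih =>
    simp only [walk] at h
    by_cases h1 : a < m
    · by_cases h2 : b < m
      · rw [if_pos h1, if_pos h2] at h
        simp only [Option.map_eq_some_iff] at h
        obtain ⟨τ', h, rfl⟩ := h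
        simp only [List.mem_cons, forall_eq_or_imp]
        exact ⟨⟨h1, h2⟩, ih h⟩
      · simp [h1, h2] at h
    · rw [if_neg h1] at h
      split_ifs at h
      simp_all

section

variable {S : ℕ} {inp : ℕ → ℝ} {n m d K : ℕ}

theorem enumBody_spec {s : State} (hc : Consts n m d K s) (sd e θ : ℝ) (z N L : ℕ)
    (h3 : s.rreg 3 = sd) (h4 : s.rreg 4 = θ) (hK : s.rreg 7 = K) (h10 : s.rreg 10 = e)
    (h7 : s.ireg 7 = N) (h8 : s.ireg 8 = z) (hzL : z < 2 ^ L)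
    (hn : 1 ≤ n) (hm : 1 ≤ m) (hd : 1 ≤ d) (hS1 : (n * m + z) * d + d ≤ S)
    (hS2 : N * (m * d + 1) + m * d + 2 ≤ S) (hzS : z < S) :
    Runs S inp enumBody s (m * d * (15 * L + 39) + 2 * m * (10 * d + 20) + 20) fun s' =>
      s'.ireg 8 = z + 1 ∧ (∀ x ≤ N * (m * d + 1), s'.rmem x = s.rmem x) ∧
      ((Emits inp n m d K sd e θ z ∧ s'.ireg 7 = N + 1 ∧ HoldsRow inp n m d K sd s'.rmem N z) ∨
        (¬ Emits inp n m d K sd e θ z ∧ s'.ireg 7 = N)) := by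
  set R := 1 + N * (m * d + 1) with hRdef
  have hmod : z % n < n := Nat.mod_lt _ hn
  have b1 : z / n * n ≤ z := Nat.div_mul_le_self _ _
  have b2 : z / n ≤ z := Nat.div_le_self _ _
  have b3 : (z % n) * m + m ≤ n * m := by
    rw [← Nat.succ_mul]; exact Nat.mul_le_mul_right _ hmod
  have b4 : (z % n * m + z / n) * d ≤ (n * m + z) * d := Nat.mul_le_mul_right _ (by omega)
  have b5 : (z % n * m + m) * d ≤ (n * m + z) * d := Nat.mul_le_mul_right _ (by omega)
  refine Runs.seq 7 (m * d * (15 * L + 39) + 2 * m * (10 * d + 20) + 13) (by omega)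
    (Q := fun s' => s'.ireg 9 = z / n ∧ s'.ireg 10 = z % n ∧ s'.ireg 11 = R ∧ s'.ireg 12 = 0 ∧
      s'.ireg 14 = 0) ?_ ?_
  · refine Runs.block (by simp) ?_
    simp [wps, Instr.wp, IntOp.eval, hc.r0, hc.r4, hc.r20, h7, h8, mod_eq_sub, hRdef]
    have := Nat.mod_le z n
    omega
  rintro s1 hf1 ⟨g9, g10, g11, g12, g14⟩
  have c1 := hc.frame hf1 rfl
  refine Runs.seq (m * d * (15 * L + 39) + 1) (2 * m * (10 * d + 20) + 12) (by omega)
    (guessCoords_spec (S := S) (inp := inp) c1 sd (z % n) (z / n) L R (by rw [hf1.r 3 rfl, h3])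
      (by rw [hf1.r 7 rfl, hK]) g10 g14 g9 g12 (by omega) hd (by omega) g11 (by omega)) ?_
  rintro s2 hf2 ⟨k9, krow, kmem⟩
  have c2 := c1.frame hf2 rfl
  rw [hf1.rm rfl] at kmem
  have gb := guessState_bound K d sd (fun a k => inp (((z % n) * m + a) * d + k)) (z / n) (m * d)
  refine Runs.seq 3 (2 * m * (10 * d + 20) + 9) (by omega) (Q := fun s' => s'.ireg 12 = 0 ∧
      s'.ireg 13 = 0 ∧ s'.rreg 5 = 0) ?_ ?_
  · refine Runs.block (by simp) ?_
    simp [wps, Instr.wp, c2.r24]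
  rintro s3 hf3 ⟨l12, l13, l5⟩
  have c3 := c2.frame hf3 rfl
  refine Runs.seq (2 * m * (10 * d + 20) + 1) 8 (by omega)
    (walkCost_spec (S := S) (inp := inp) c3 sd e (z % n) R
      (guessState K d sd (fun a k => inp (((z % n) * m + a) * d + k)) (z / n) (m * d)).1
      (by rw [hf3.r 3 rfl, hf2.r 3 rfl, hf1.r 3 rfl, h3])
      (by rw [hf3.i 10 rfl, hf2.i 10 rfl, g10]) (by rw [hf3.i 11 rfl, hf2.i 11 rfl, g11])
      l12 l13 (by rw [hf3.i 9 rfl, k9]) l5 (by rw [hf3.r 10 rfl, hf2.r 10 rfl, hf1.r 10 rfl, h10])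
      (by omega) (by omega) (by omega) hd hm) ?_
  intro s4 hf4 hw
  have c4 := c3.frame hf4 rfl
  have m4 : s4.rmem = s2.rmem := by rw [hf4.rm rfl, hf3.rm rfl]
  -- The machine computed the cost from the row in memory, which is known to be the guessed one only
  -- in its first md entries. The indices of a successful walk are below m, so no other entry is
  -- read.
  have hE : ∀ τ, walk m (2 * m) (guessState K d sd
      (fun a k => inp (((z % n) * m + a) * d + k)) (z / n) (m * d)).1 0 0 = some τ →
      (τ.map fun x => pairCost d e (fun k => inp (((z % n) * m + x.1) * d + k)) fun k =>
        s3.rmem (R + (x.2 * d + k)) * sd) =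
      (τ.map fun x => pairCost d e (inputPoint inp m d (z % n) x.1) fun k =>
      guessRow K d sd (inputPoint inp m d (z % n)) (z / n) (x.2 * d + k) * sd) := by
    intro τ hτ
    refine List.map_congr_left fun x hx => ?_
    have hx2 := (walk_lt hτ x hx).2
    have e2 : x.2 * d + d ≤ m * d := by
      rw [← Nat.succ_mul]; exact Nat.mul_le_mul_right _ (by omega)
    simp only [pairCost, hf3.rm rfl]
    congr 2
    refine Finset.sum_congr rfl fun k hk => ?_
    have := Finset.mem_range.1 hk
    rw [krow _ (by omega)]
    rfl
  have j7 : s4.ireg 7 = N := by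
    rw [hf4.i 7 rfl, hf3.i 7 rfl, hf2.i 7 rfl, hf1.i 7 rfl, h7]
  have j11 : s4.ireg 11 = R := by rw [hf4.i 11 rfl, hf3.i 11 rfl, hf2.i 11 rfl, g11]
  have j10 : s4.ireg 10 = z % n := by rw [hf4.i 10 rfl, hf3.i 10 rfl, hf2.i 10 rfl, g10]
  have jθ : s4.rreg 4 = θ := by
    rw [hf4.r 4 rfl, hf3.r 4 rfl, hf2.r 4 rfl, hf1.r 4 rfl, h4]
  have j8 : s4.ireg 8 = z := by
    rw [hf4.i 8 rfl, hf3.i 8 rfl, hf2.i 8 rfl, hf1.i 8 rfl, h8]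
  refine Runs.seq 6 1 (by omega) (Q := fun s' =>
      (∀ x ≤ N * (m * d + 1), s'.rmem x = s.rmem x) ∧
      ((Emits inp n m d K sd e θ z ∧ s'.ireg 7 = N + 1 ∧ HoldsRow inp n m d K sd s'.rmem N z) ∨
        (¬ Emits inp n m d K sd e θ z ∧ s'.ireg 7 = N))) ?_ ?_
  · refine Runs.ite 5 (by omega) (fun h => ?_) (fun h => ?_)
    · simp only [Test.holds, c4.r1] at h
      obtain ⟨-, τ, hτ, hcost⟩ : _ ∧ _ := hw.resolve_right (by omega)
      rw [hE τ hτ] at hcost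
      refine Runs.ite 4 (by omega) (fun h' => ?_) (fun h' => ?_)
      · simp only [Test.holds, jθ, hcost] at h'
        refine Runs.block (by simp) ?_
        simp [wps, Instr.wp, IntOp.eval, c4.r3, c4.r20, j7, j11, j10]
        have hN : N ≤ N * (m * d + 1) := Nat.le_mul_of_pos_right _ (by omega)
        refine ⟨by omega, by omega, by omega, ?_, ⟨τ, hτ, h'⟩, ?_, ?_⟩
        · intro x hx
          rw [Function.update_of_ne (by omega), m4, kmem x (by omega)]
        · intro l hl
          rw [← hRdef, Function.update_of_ne (by omega), m4, krow l hl]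
          rfl
        · simp [hRdef]
      · simp only [Test.holds, jθ, hcost] at h'
        refine Runs.skip ⟨?_, Or.inr ⟨?_, j7⟩⟩
        · intro x hx
          rw [m4, kmem x (by omega)]
        · rintro ⟨τ', hτ', h''⟩
          obtain rfl : τ = τ' := Option.some.inj (hτ.symm.trans hτ')
          exact h' h''
    · simp only [Test.holds, c4.r1] at h
      have hw' := (hw.resolve_left (by omega)).2
      refine Runs.skip ⟨?_, Or.inr ⟨?_, j7⟩⟩
      · intro x hx
        rw [m4, kmem x (by omega)]
      · rintro ⟨τ', hτ', -⟩
        exact absurd (hw'.symm.trans hτ') (by simp)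
  · rintro s5 hf5 ⟨p1, p2⟩
    have c5 := c4.frame hf5 rfl
    have j8' : s5.ireg 8 = z := by rw [hf5.i 8 rfl, j8]
    refine Runs.block (by simp) ?_
    simp only [wps, Instr.wp, IntOp.eval, c5.r20, j8']
    exact ⟨by omega, by simp, p1, by simpa using p2⟩

def enumerate : Cmd :=
  .seq (block [.intConst 7 0, .intConst 8 0]) (.while (.intLt 8 6) enumBody)

theorem enumerate_spec {s : State} (hc : Consts n m d K s) (sd e θ : ℝ) (Z L : ℕ)
    (h3 : s.rreg 3 = sd) (h4 : s.rreg 4 = θ) (hK : s.rreg 7 = K) (h10 : s.rreg 10 = e)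
    (h6 : s.ireg 6 = Z) (hZL : Z ≤ 2 ^ L) (hn : 1 ≤ n) (hm : 1 ≤ m) (hd : 1 ≤ d)
    (hS1 : (n * m + Z) * d + d ≤ S) (hS2 : Z * (m * d + 1) + m * d + 2 ≤ S) :
    Runs S inp enumerate s (Z * (m * d * (15 * L + 39) + 2 * m * (10 * d + 20) + 21) + 3)
      fun s' => ∃ N ≤ Z, s'.ireg 7 = N ∧
        (∀ k < N, ∃ z < Z, Emits inp n m d K sd e θ z ∧ HoldsRow inp n m d K sd s'.rmem k z) ∧
        ∀ z < Z, Emits inp n m d K sd e θ z → ∃ k < N, HoldsRow inp n m d K sd s'.rmem k z := by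
  refine Runs.seq 2 (Z * (m * d * (15 * L + 39) + 2 * m * (10 * d + 20) + 21) + 1) (by omega)
    (Q := fun s' => s'.ireg 7 = 0 ∧ s'.ireg 8 = 0) ?_ ?_
  · refine Runs.block (by simp) ?_
    simp [wps, Instr.wp]
  rintro s1 hf1 ⟨g7, g8⟩
  have c1 := hc.frame hf1 rfl
  have i6 : s1.ireg 6 = Z := by rw [hf1.i 6 rfl, h6]
  refine Runs.for (fun z s' => s'.ireg 8 = z ∧ ∃ N ≤ z, s'.ireg 7 = N ∧
      (∀ k < N, ∃ z' < z, Emits inp n m d K sd e θ z' ∧ HoldsRow inp n m d K sd s'.rmem k z') ∧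
      ∀ z' < z, Emits inp n m d K sd e θ z' → ∃ k < N, HoldsRow inp n m d K sd s'.rmem k z')
    Z (m * d * (15 * L + 39) + 2 * m * (10 * d + 20) + 20) le_rfl ?_ ?_ ?_ ?_
  · exact ⟨g8, 0, le_rfl, g7, by simp, by simp⟩
  · rintro z s' hf hz ⟨k8, -⟩
    simp only [Test.holds, k8, hf.i 6 rfl, i6]
  · rintro z s' hf hz ⟨k8, N, hN, k7, hsound, hcompl⟩
    have e1 : N * (m * d + 1) ≤ Z * (m * d + 1) := Nat.mul_le_mul_right _ (by omega)
    have e2 : (n * m + z) * d ≤ (n * m + Z) * d := Nat.mul_le_mul_right _ (by omega)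
    have e3 : Z ≤ Z * (m * d + 1) := Nat.le_mul_of_pos_right _ (by omega)
    refine (enumBody_spec (S := S) (inp := inp) (c1.frame hf rfl) sd e θ z N L
      (by rw [hf.r 3 rfl, hf1.r 3 rfl, h3]) (by rw [hf.r 4 rfl, hf1.r 4 rfl, h4])
      (by rw [hf.r 7 rfl, hf1.r 7 rfl, hK]) (by rw [hf.r 10 rfl, hf1.r 10 rfl, h10]) k7 k8
      (by omega) hn hm hd (by omega) (by omega) (by omega)).mono le_rfl ?_
    rintro s'' - ⟨p8, pmem, hp⟩
    have hkeep : ∀ k < N, ∀ z', HoldsRow inp n m d K sd s'.rmem k z' →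
        HoldsRow inp n m d K sd s''.rmem k z' := by
      rintro k hk z' ⟨r1, r2⟩
      have : k * (m * d + 1) + (m * d + 1) ≤ N * (m * d + 1) := by
        rw [← Nat.succ_mul]; exact Nat.mul_le_mul_right _ hk
      refine ⟨fun l hl => ?_, ?_⟩
      · rw [pmem _ (by omega), r1 l hl]
      · rw [pmem _ (by omega), r2]
    refine ⟨p8, ?_⟩
    rcases hp with ⟨hE, p7, hrow⟩ | ⟨hE, p7⟩
    · refine ⟨N + 1, by omega, p7, ?_, ?_⟩
      · intro k hk
        rcases Nat.lt_succ_iff_lt_or_eq.1 hk with h | rfl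
        · obtain ⟨z', hz', hz'', hr⟩ := hsound k h
          exact ⟨z', by omega, hz'', hkeep k h z' hr⟩
        · exact ⟨z, by omega, hE, hrow⟩
      · intro z' hz' hE'
        rcases Nat.lt_succ_iff_lt_or_eq.1 hz' with h | rfl
        · obtain ⟨k, hk, hr⟩ := hcompl z' h hE'
          exact ⟨k, by omega, hkeep k hk z' hr⟩
        · exact ⟨N, by omega, hrow⟩
    · refine ⟨N, by omega, p7, ?_, ?_⟩
      · intro k hk
        obtain ⟨z', hz', hz'', hr⟩ := hsound k hk
        exact ⟨z', by omega, hz'', hkeep k hk z' hr⟩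
      · intro z' hz' hE'
        rcases Nat.lt_succ_iff_lt_or_eq.1 hz' with h | rfl
        · obtain ⟨k, hk, hr⟩ := hcompl z' h hE'
          exact ⟨k, hk, hkeep k hk z' hr⟩
        · exact absurd hE' hE
  · rintro s' hf ⟨-, N, hN, k7, h1, h2⟩
    exact ⟨N, hN, k7, h1, h2⟩

end

/-! ### Comparing rows -/

/-- The row `k` of the real memory, ordered lexicographically. -/
def memRow (mem : ℕ → ℝ) (E k : ℕ) : Lex (Fin E → ℝ) := toLex fun l => mem (1 + k * E + l)

/-- Compare the rows with the numbers in the registers `12` and `13`: register `14` gets the length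
of the longest common prefix, and register `15` tells whether the second row is smaller. -/
def compareRows : Cmd :=
  .seq (block [.intOp .mul 16 12 4, .intOp .add 16 16 20, .intOp .mul 17 13 4,
      .intOp .add 17 17 20, .intConst 14 0, .intConst 15 0, .intOp .add 18 4 24])
    (.while (.intLt 14 18) (.seq (block [.realLoad 6 16, .realLoad 8 17])
      (.ite (.realLt 6 8) (block [.intConst 18 0])
        (.ite (.realLt 8 6) (block [.intConst 18 0, .intConst 15 1])
          (block [.intOp .add 14 14 20, .intOp .add 16 16 20, .intOp .add 17 17 20])))))

section

variable {S : ℕ} {inp : ℕ → ℝ} {n m d K : ℕ}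

theorem compareRows_spec {s : State} (hc : Consts n m d K s) (E a b : ℕ) (hE : E = m * d + 1)
    (h12 : s.ireg 12 = a) (h13 : s.ireg 13 = b) (ha : 1 + a * E + E ≤ S)
    (hb : 1 + b * E + E ≤ S) :
    Runs S inp compareRows s (8 * E + 8) fun s' => ∃ l ≤ E, s'.ireg 14 = l ∧
      (∀ j < l, s.rmem (1 + a * E + j) = s.rmem (1 + b * E + j)) ∧
      (l < E → s.rmem (1 + a * E + l) ≠ s.rmem (1 + b * E + l)) ∧
      (s'.ireg 15 = 0 ∧ (l < E → s.rmem (1 + a * E + l) < s.rmem (1 + b * E + l)) ∨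
        s'.ireg 15 = 1 ∧ l < E ∧ s.rmem (1 + b * E + l) < s.rmem (1 + a * E + l)) := by
  refine Runs.seq 7 (E * 8 + 1) (by omega) (Q := fun s' => s'.ireg 14 = 0 ∧ s'.ireg 15 = 0 ∧
    s'.ireg 16 = 1 + a * E ∧ s'.ireg 17 = 1 + b * E ∧ s'.ireg 18 = E) ?_ ?_
  · refine Runs.block (by simp) ?_
    simp [wps, Instr.wp, IntOp.eval, hc.r4, hc.r20, hc.r24, h12, h13, ← hE]
    omega
  rintro s1 hf1 ⟨g14, g15, g16, g17, g18⟩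
  have c1 := hc.frame hf1 rfl
  have m1 : s1.rmem = s.rmem := hf1.rm rfl
  -- Register 18 is the loop bound, and setting it to 0 breaks off the loop. The two alternatives of
  -- the invariant are that all entries so far agree with the scan going on, and that a difference
  -- has been found.
  refine Runs.while (fun k s' => ∃ l ≤ E, s'.ireg 14 = l ∧
      (∀ j < l, s.rmem (1 + a * E + j) = s.rmem (1 + b * E + j)) ∧
      ((s'.ireg 18 = E ∧ l + k = E ∧ s'.ireg 15 = 0 ∧ s'.ireg 16 = 1 + a * E + l ∧
        s'.ireg 17 = 1 + b * E + l) ∨ (s'.ireg 18 = 0 ∧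
      (l < E → s.rmem (1 + a * E + l) ≠ s.rmem (1 + b * E + l)) ∧
      (s'.ireg 15 = 0 ∧ (l < E → s.rmem (1 + a * E + l) < s.rmem (1 + b * E + l)) ∨
        s'.ireg 15 = 1 ∧ l < E ∧ s.rmem (1 + b * E + l) < s.rmem (1 + a * E + l)))))
      E 7 (by omega) ?_ ?_ ?_
  · exact ⟨0, by omega, g14, by simp, Or.inl ⟨g18, by omega, g15, by simp [g16], by simp [g17]⟩⟩
  · rintro k s' hf ⟨l, hl, k14, hpre, h⟩ ht
    have c' := c1.frame hf rfl
    simp only [Test.holds, k14] at ht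
    obtain ⟨k18, hlk, k15, k16, k17⟩ : _ ∧ _ := h.resolve_right (by omega)
    obtain ⟨k, rfl⟩ : ∃ j, k = j + 1 := ⟨k - 1, by omega⟩
    refine ⟨k, by omega, ?_⟩
    refine Runs.seq 2 5 (by omega) (Q := fun s'' => s''.rreg 6 = s.rmem (1 + a * E + l) ∧
      s''.rreg 8 = s.rmem (1 + b * E + l)) ?_ ?_
    · refine Runs.block (by simp) ?_
      have m' : s'.rmem = s.rmem := by rw [hf.rm rfl, m1]
      simp [wps, Instr.wp, k16, k17, m']
      omega
    rintro s2 hf2 ⟨r6, r8⟩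
    have c2 := c'.frame hf2 rfl
    have l14 : s2.ireg 14 = l := by rw [hf2.i 14 rfl, k14]
    have l15 : s2.ireg 15 = 0 := by rw [hf2.i 15 rfl, k15]
    have l16 : s2.ireg 16 = 1 + a * E + l := by rw [hf2.i 16 rfl, k16]
    have l17 : s2.ireg 17 = 1 + b * E + l := by rw [hf2.i 17 rfl, k17]
    have l18 : s2.ireg 18 = E := by rw [hf2.i 18 rfl, k18]
    refine Runs.ite 4 (by omega) (fun hlt => ?_) (fun hlt => ?_)
    · simp only [Test.holds, r6, r8] at hlt
      refine Runs.block (by simp) ?_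
      simp only [wps, Instr.wp]
      exact ⟨by omega, l, hl, by simpa using l14, hpre, Or.inr ⟨by simp, fun _ => hlt.ne,
        Or.inl ⟨by simpa using l15, fun _ => hlt⟩⟩⟩
    · refine Runs.ite 3 (by omega) (fun hlt' => ?_) (fun hlt' => ?_)
      · simp only [Test.holds, r6, r8] at hlt'
        refine Runs.block (by simp) ?_
        simp only [wps, Instr.wp]
        exact ⟨by omega, by omega, l, hl, by simpa using l14, hpre, Or.inr ⟨by simp,
          fun _ => hlt'.ne', Or.inr ⟨by simp, by omega, hlt'⟩⟩⟩
      · simp only [Test.holds, r6, r8] at hlt hlt'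
        refine Runs.block (by simp) ?_
        simp only [wps, Instr.wp, IntOp.eval, c2.r20]
        simp [c2.r20, l14, l15, l16, l17, l18]
        refine ⟨by omega, by omega, by omega, by omega, ?_, Or.inl ⟨by omega, by omega, by omega⟩⟩
        intro j hj
        rcases Nat.lt_or_eq_of_le hj with h | rfl
        · exact hpre j h
        · exact le_antisymm (not_lt.1 hlt') (not_lt.1 hlt)
  · rintro k s' hf ⟨l, hl, k14, hpre, h⟩ ht
    simp only [Test.holds, k14] at ht
    rcases h with ⟨k18, hlk, k15, -⟩ | ⟨-, h1, h2⟩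
    · exact ⟨l, hl, k14, hpre, by omega, Or.inl ⟨k15, by omega⟩⟩
    · exact ⟨l, hl, k14, hpre, h1, h2⟩

theorem memRow_lt {mem : ℕ → ℝ} {E a b l : ℕ}
    (hpre : ∀ j < l, mem (1 + a * E + j) = mem (1 + b * E + j)) (hl : l < E)
    (hlt : mem (1 + a * E + l) < mem (1 + b * E + l)) : memRow mem E a < memRow mem E b :=
  ⟨⟨l, hl⟩, fun j hj => hpre j hj, hlt⟩

theorem memRow_eq {mem : ℕ → ℝ} {E a b : ℕ}
    (hpre : ∀ j < E, mem (1 + a * E + j) = mem (1 + b * E + j)) :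
    memRow mem E a = memRow mem E b := by
  unfold memRow
  congr 1
  funext j
  exact hpre j j.2

/-! ### Merge sort -/

/-- The values of `f` on `[a, b)`. -/
def seg (f : ℕ → ℕ) (a b : ℕ) : List ℕ := (List.range' a (b - a)).map f

theorem seg_self (f : ℕ → ℕ) (a : ℕ) : seg f a a = [] := by simp [seg]

theorem seg_cons (f : ℕ → ℕ) {a b : ℕ} (h : a < b) : seg f a b = f a :: seg f (a + 1) b := by
  obtain ⟨k, rfl⟩ := Nat.exists_eq_add_of_lt h
  rw [seg, show a + k + 1 - a = k + 1 by omega, List.range'_succ, seg,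
    show a + k + 1 - (a + 1) = k by omega]
  simp

theorem seg_append (f : ℕ → ℕ) {a b c : ℕ} (h : a ≤ b) (h' : b ≤ c) :
    seg f a b ++ seg f b c = seg f a c := by
  obtain ⟨k, rfl⟩ := Nat.exists_eq_add_of_le h
  obtain ⟨j, rfl⟩ := Nat.exists_eq_add_of_le h'
  simp only [seg, ← List.map_append]
  rw [show a + k - a = k by omega, show a + k + j - (a + k) = j by omega,
    show a + k + j - a = k + j by omega, List.range'_append_1]

theorem seg_congr {f g : ℕ → ℕ} {a b : ℕ} (h : ∀ x, a ≤ x → x < b → f x = g x) :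
    seg f a b = seg g a b := by
  refine List.map_congr_left fun x hx => ?_
  rw [List.mem_range'_1] at hx
  exact h x (by omega) (by omega)

theorem seg_snoc (f : ℕ → ℕ) {a b : ℕ} (h : a ≤ b) : seg f a (b + 1) = seg f a b ++ [f b] := by
  rw [← seg_append f h (Nat.le_succ b), seg_cons f (Nat.lt_succ_self b), seg_self]

/-- The comparison used for sorting. -/
noncomputable def rowLe (mem : ℕ → ℝ) (E a b : ℕ) : Bool := decide (memRow mem E a ≤ memRow mem E b)

/-- Only numbers of rows are moved, never the rows. Register 33 is 1 if the next entry comes from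
the second run; ties go to the first run, as in `List.merge`. The output goes to a buffer behind the
N cells of the current order. -/
def takeNext : Cmd :=
  .seq (block [.intConst 33 0])
    (.seq (.ite (.intLt 29 27) (.ite (.intLt 30 28) (.seq (block [.intOp .add 19 29 21,
        .intLoad 12 19, .intOp .add 19 30 21, .intLoad 13 19])
        (.seq compareRows (block [.intOp .add 33 15 24]))) .skip) (block [.intConst 33 1]))
      (.seq (.ite (.intLt 24 33) (block [.intOp .add 19 30 21, .intLoad 12 19,
          .intOp .add 30 30 20])
        (block [.intOp .add 19 29 21, .intLoad 12 19, .intOp .add 29 29 20]))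
        (block [.intOp .add 19 31 32, .intStore 19 12, .intOp .add 31 31 20])))

/-- One call peels one element off `List.merge` of the remaining runs. Sortedness and the
permutation property then come from the general facts about `List.merge`. -/
theorem takeNext_spec {s : State} (hc : Consts n m d K s) (E N i j k mid hi : ℕ) (hE : E = m * d + 1)
    (h27 : s.ireg 27 = mid) (h28 : s.ireg 28 = hi) (h29 : s.ireg 29 = i) (h30 : s.ireg 30 = j)
    (h31 : s.ireg 31 = k) (h32 : s.ireg 32 = N + 2) (him : i ≤ mid) (hjh : j ≤ hi)
    (hmN : mid ≤ N) (hhN : hi ≤ N) (hk : k < N) (hij : i < mid ∨ j < hi)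
    (hS1 : 2 * N + 2 ≤ S) (hS2 : N * E + 1 ≤ S) (hσ : ∀ x < N, s.imem (x + 2) < N) :
    Runs S inp takeNext s (8 * E + 24) fun s' => ∃ i' j', i' ≤ mid ∧ j' ≤ hi ∧
      s'.ireg 29 = i' ∧ s'.ireg 30 = j' ∧ s'.ireg 31 = k + 1 ∧ i' + j' = i + j + 1 ∧
      i ≤ i' ∧ j ≤ j' ∧
      (∀ x, x ≠ k + (N + 2) → s'.imem x = s.imem x) ∧
      List.merge (seg (fun x => s.imem (x + 2)) i mid) (seg (fun x => s.imem (x + 2)) j hi)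
        (rowLe s.rmem E) = s'.imem (k + (N + 2)) ::
      List.merge (seg (fun x => s.imem (x + 2)) i' mid) (seg (fun x => s.imem (x + 2)) j' hi)
        (rowLe s.rmem E) := by
  set σ : ℕ → ℕ := fun x => s.imem (x + 2) with hσd
  have hrow : ∀ x < N, 1 + σ x * E + E ≤ S := by
    intro x hx
    have : σ x * E + E ≤ N * E := by
      rw [← Nat.succ_mul]; exact Nat.mul_le_mul_right _ (hσ x hx)
    omega
  refine Runs.seq 1 (8 * E + 23) (by omega) (Q := fun s' => s'.ireg 33 = 0) ?_ ?_
  · refine Runs.block (by simp) ?_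
    simp [wps, Instr.wp]
  intro s1 hf1 g33
  have c1 := hc.frame hf1 rfl
  have a27 : s1.ireg 27 = mid := by rw [hf1.i 27 rfl, h27]
  have a28 : s1.ireg 28 = hi := by rw [hf1.i 28 rfl, h28]
  have a29 : s1.ireg 29 = i := by rw [hf1.i 29 rfl, h29]
  have a30 : s1.ireg 30 = j := by rw [hf1.i 30 rfl, h30]
  have aim : s1.imem = s.imem := hf1.im rfl
  have arm : s1.rmem = s.rmem := hf1.rm rfl
  refine Runs.seq (8 * E + 15) 8 (by omega) (Q := fun s' =>
    (s'.ireg 33 = 0 ∧ i < mid ∧ (j < hi → rowLe s.rmem E (σ i) (σ j) = true)) ∨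
    (s'.ireg 33 = 1 ∧ j < hi ∧ (i < mid → rowLe s.rmem E (σ i) (σ j) = false))) ?_ ?_
  · refine Runs.ite (8 * E + 14) (by omega) (fun h => ?_) (fun h => ?_)
    · simp only [Test.holds, a27, a29] at h
      refine Runs.ite (8 * E + 13) (by omega) (fun h' => ?_) (fun h' => ?_)
      · simp only [Test.holds, a28, a30] at h'
        refine Runs.seq 4 (8 * E + 9) (by omega) (Q := fun s' => s'.ireg 12 = σ i ∧
          s'.ireg 13 = σ j) ?_ ?_
        · refine Runs.block (by simp) ?_
          simp [wps, Instr.wp, IntOp.eval, c1.r21, a29, a30, aim, hσd]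
          omega
        rintro s2 hf2 ⟨b12, b13⟩
        have c2 := c1.frame hf2 rfl
        have brm : s2.rmem = s.rmem := by rw [hf2.rm rfl, arm]
        refine Runs.seq (8 * E + 8) 1 (by omega) (compareRows_spec (S := S) (inp := inp) c2 E _ _ hE
          b12 b13 (hrow i (by omega)) (hrow j (by omega))) ?_
        rintro s3 hf3 ⟨l, hl, -, q1, q2, q3⟩
        have c3 := c2.frame hf3 rfl
        rw [brm] at q1 q2 q3
        refine Runs.block (by simp) ?_
        rcases q3 with ⟨q3, q4⟩ | ⟨q3, q4, q5⟩
        · have : rowLe s.rmem E (σ i) (σ j) = true := by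
            rw [rowLe, decide_eq_true_eq]
            rcases lt_or_eq_of_le hl with hl' | rfl
            · exact (memRow_lt q1 hl' (q4 hl')).le
            · exact (memRow_eq q1).le
          simp [wps, Instr.wp, IntOp.eval, c3.r24, q3, h, this]
        · have : rowLe s.rmem E (σ i) (σ j) = false := by
            rw [rowLe, decide_eq_false_iff_not, not_le]
            exact memRow_lt (fun x hx => (q1 x hx).symm) q4 q5
          simp [wps, Instr.wp, IntOp.eval, c3.r24, q3, h', this]
          omega
      · simp only [Test.holds, a28, a30] at h'
        exact Runs.skip (Or.inl ⟨g33, h, fun hh => absurd hh h'⟩)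
    · simp only [Test.holds, a27, a29] at h
      refine Runs.block (by simp) ?_
      simp [wps, Instr.wp]
      omega
  intro s2 hf2 hq
  have c2 := c1.frame hf2 rfl
  have b29 : s2.ireg 29 = i := by rw [hf2.i 29 rfl, a29]
  have b30 : s2.ireg 30 = j := by rw [hf2.i 30 rfl, a30]
  have bim : s2.imem = s.imem := by rw [hf2.im rfl, aim]
  refine Runs.seq 4 3 (by omega) (Q := fun s' => ∃ i' j', i' ≤ mid ∧ j' ≤ hi ∧
      s'.ireg 29 = i' ∧ s'.ireg 30 = j' ∧ i' + j' = i + j + 1 ∧ i ≤ i' ∧ j ≤ j' ∧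
      List.merge (seg σ i mid) (seg σ j hi) (rowLe s.rmem E) = s'.ireg 12 ::
      List.merge (seg σ i' mid) (seg σ j' hi) (rowLe s.rmem E)) ?_ ?_
  · refine Runs.ite 3 (by omega) (fun h => ?_) (fun h => ?_)
    · simp only [Test.holds, c2.r24] at h
      obtain ⟨-, p1, p2⟩ := hq.resolve_left (by omega)
      refine Runs.block (by simp) ?_
      simp [wps, Instr.wp, IntOp.eval, c2.r21, c2.r20, b29, b30, bim]
      refine ⟨by omega, by omega, by omega, him, by omega, by omega, ?_⟩
      rw [seg_cons σ p1]
      rcases lt_or_eq_of_le him with h1 | rfl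
      · rw [seg_cons σ h1, List.cons_merge_cons, p2 h1]
        simp [hσd]
      · simp [seg_self, hσd]
    · simp only [Test.holds, c2.r24] at h
      obtain ⟨-, p1, p2⟩ := hq.resolve_right (by omega)
      refine Runs.block (by simp) ?_
      simp [wps, Instr.wp, IntOp.eval, c2.r21, c2.r20, b29, b30, bim]
      refine ⟨by omega, by omega, by omega, by omega, hjh, by omega, ?_⟩
      rw [seg_cons σ p1]
      rcases lt_or_eq_of_le hjh with h1 | rfl
      · rw [seg_cons σ h1, List.cons_merge_cons, p2 h1]
        simp [hσd]
      · simp [seg_self, hσd]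
  rintro s3 hf3 ⟨i', j', q1, q2, q3, q4, q5, q6, q7, q8⟩
  have c3 := c2.frame hf3 rfl
  have d31 : s3.ireg 31 = k := by rw [hf3.i 31 rfl, hf2.i 31 rfl, hf1.i 31 rfl, h31]
  have d32 : s3.ireg 32 = N + 2 := by rw [hf3.i 32 rfl, hf2.i 32 rfl, hf1.i 32 rfl, h32]
  have dim : s3.imem = s.imem := by rw [hf3.im rfl, bim]
  refine Runs.block (by simp) ?_
  simp [wps, Instr.wp, IntOp.eval, c3.r20, d31, d32]
  refine ⟨by omega, by omega, by omega, by omega, by omega, by omega, by omega, by omega, ?_, ?_⟩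
  · intro x hx
    rw [Function.update_of_ne hx, dim]
  · rw [q8, q3, q4]

end

section

variable {S : ℕ} {inp : ℕ → ℝ} {n m d K : ℕ}

theorem seg_perm_range {f : ℕ → ℕ} {N : ℕ} (h : (seg f 0 N).Perm (List.range N)) :
    ∀ x < N, f x < N := by
  intro x hx
  rw [← List.mem_range, ← h.mem_iff, seg, List.mem_map]
  exact ⟨x, by rw [List.mem_range'_1]; omega, rfl⟩

theorem rowLe_trans (mem : ℕ → ℝ) (E a b c : ℕ) (h₁ : rowLe mem E a b = true)
    (h₂ : rowLe mem E b c = true) : rowLe mem E a c = true := by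
  simp only [rowLe, decide_eq_true_eq] at *
  exact h₁.trans h₂

theorem rowLe_total (mem : ℕ → ℝ) (E a b : ℕ) : (rowLe mem E a b || rowLe mem E b a) = true := by
  simp only [rowLe, Bool.or_eq_true, decide_eq_true_eq]
  exact le_total _ _

/-- The rows with the numbers in the list increase. -/
def RowsSorted (mem : ℕ → ℝ) (E : ℕ) (l : List ℕ) : Prop :=
  l.Pairwise fun a b => rowLe mem E a b = true

def mergeRuns : Cmd :=
  .seq (block [.intOp .add 27 26 25])
    (.seq (.ite (.intLt 7 27) (block [.intOp .add 27 7 24]) .skip)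
      (.seq (block [.intOp .add 28 27 25])
        (.seq (.ite (.intLt 7 28) (block [.intOp .add 28 7 24]) .skip)
          (.seq (block [.intOp .add 29 26 24, .intOp .add 30 27 24, .intOp .add 31 26 24])
            (.seq (.while (.intLt 31 28) takeNext) (block [.intOp .add 26 28 24]))))))

theorem mergeRuns_spec {s : State} (hc : Consts n m d K s) (E N lo w : ℕ) (hE : E = m * d + 1)
    (h7 : s.ireg 7 = N) (h25 : s.ireg 25 = w) (h26 : s.ireg 26 = lo) (h32 : s.ireg 32 = N + 2)
    (hlo : lo < N) (hw : w < N)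
    (hS1 : 2 * N + 2 ≤ S) (hS2 : N * E + 1 ≤ S) (hσ : ∀ x < N, s.imem (x + 2) < N) :
    Runs S inp mergeRuns s ((min (lo + 2 * w) N - lo) * (8 * E + 25) + 12) fun s' =>
      s'.ireg 26 = min (lo + 2 * w) N ∧
      (∀ x < lo + (N + 2), s'.imem x = s.imem x) ∧
      seg (fun x => s'.imem (x + (N + 2))) lo (min (lo + 2 * w) N) =
        List.merge (seg (fun x => s.imem (x + 2)) lo (min (lo + w) N))
          (seg (fun x => s.imem (x + 2)) (min (lo + w) N) (min (lo + 2 * w) N))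
          (rowLe s.rmem E) := by
  set mid := min (lo + w) N with hmid
  set hi := min (lo + 2 * w) N with hhi
  refine Runs.seq 1 ((hi - lo) * (8 * E + 25) + 11) (by omega)
    (Q := fun s' => s'.ireg 27 = lo + w) ?_ ?_
  · refine Runs.block (by simp) ?_
    simp [wps, Instr.wp, IntOp.eval, h25, h26]
    omega
  intro s1 hf1 g1
  have c1 := hc.frame hf1 rfl
  refine Runs.seq 2 ((hi - lo) * (8 * E + 25) + 9) (by omega) (Q := fun s' => s'.ireg 27 = mid) ?_ ?_
  · refine Runs.ite 1 (by omega) (fun h => ?_) (fun h => ?_)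
    · simp only [Test.holds, g1, hf1.i 7 rfl, h7] at h
      refine Runs.block (by simp) ?_
      simp [wps, Instr.wp, IntOp.eval, hf1.i 7 rfl, h7, c1.r24]
      omega
    · simp only [Test.holds, g1, hf1.i 7 rfl, h7] at h
      refine Runs.skip (by omega)
  intro s2 hf2 g2
  have c2 := c1.frame hf2 rfl
  have a25 : s2.ireg 25 = w := by rw [hf2.i 25 rfl, hf1.i 25 rfl, h25]
  have a7 : s2.ireg 7 = N := by rw [hf2.i 7 rfl, hf1.i 7 rfl, h7]
  refine Runs.seq 1 ((hi - lo) * (8 * E + 25) + 8) (by omega)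
    (Q := fun s' => s'.ireg 28 = mid + w) ?_ ?_
  · refine Runs.block (by simp) ?_
    simp [wps, Instr.wp, IntOp.eval, a25, g2]
    omega
  intro s3 hf3 g3
  have c3 := c2.frame hf3 rfl
  have b7 : s3.ireg 7 = N := by rw [hf3.i 7 rfl, a7]
  refine Runs.seq 2 ((hi - lo) * (8 * E + 25) + 6) (by omega) (Q := fun s' => s'.ireg 28 = hi) ?_ ?_
  · refine Runs.ite 1 (by omega) (fun h => ?_) (fun h => ?_)
    · simp only [Test.holds, g3, b7] at h
      refine Runs.block (by simp) ?_
      simp [wps, Instr.wp, IntOp.eval, b7, c3.r24]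
      omega
    · simp only [Test.holds, g3, b7] at h
      refine Runs.skip (by omega)
  intro s4 hf4 g4
  have c4 := c3.frame hf4 rfl
  have d26 : s4.ireg 26 = lo := by
    rw [hf4.i 26 rfl, hf3.i 26 rfl, hf2.i 26 rfl, hf1.i 26 rfl, h26]
  have d27 : s4.ireg 27 = mid := by rw [hf4.i 27 rfl, hf3.i 27 rfl, g2]
  refine Runs.seq 3 ((hi - lo) * (8 * E + 25) + 3) (by omega) (Q := fun s' => s'.ireg 29 = lo ∧
      s'.ireg 30 = mid ∧ s'.ireg 31 = lo) ?_ ?_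
  · refine Runs.block (by simp) ?_
    simp [wps, Instr.wp, IntOp.eval, d26, d27, c4.r24]
    omega
  rintro s5 hf5 ⟨e29, e30, e31⟩
  have c5 := c4.frame hf5 rfl
  have eim : s5.imem = s.imem := by
    rw [hf5.im rfl, hf4.im rfl, hf3.im rfl, hf2.im rfl, hf1.im rfl]
  have erm : s5.rmem = s.rmem := by
    rw [hf5.rm rfl, hf4.rm rfl, hf3.rm rfl, hf2.rm rfl, hf1.rm rfl]
  have e27 : s5.ireg 27 = mid := by rw [hf5.i 27 rfl, d27]
  have e28 : s5.ireg 28 = hi := by rw [hf5.i 28 rfl, g4]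
  have e32 : s5.ireg 32 = N + 2 := by
    rw [hf5.i 32 rfl, hf4.i 32 rfl, hf3.i 32 rfl, hf2.i 32 rfl, hf1.i 32 rfl, h32]
  set σ : ℕ → ℕ := fun x => s.imem (x + 2) with hσd
  refine Runs.seq ((hi - lo) * (8 * E + 25) + 1) 1 (by omega) (Q := fun s' =>
      (∀ x < lo + (N + 2), s'.imem x = s.imem x) ∧
      seg (fun x => s'.imem (x + (N + 2))) lo hi =
        List.merge (seg σ lo mid) (seg σ mid hi) (rowLe s.rmem E)) ?_ ?_
  -- The invariant: the output so far, followed by the merge of what is left of the two runs, is the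
  -- merge of the full runs.
  · refine Runs.for (fun t s' => ∃ i j, i ≤ mid ∧ j ≤ hi ∧ lo ≤ i ∧ mid ≤ j ∧
      s'.ireg 29 = i ∧ s'.ireg 30 = j ∧ s'.ireg 31 = lo + t ∧ i + j = lo + mid + t ∧
      (∀ x < lo + (N + 2), s'.imem x = s.imem x) ∧
      seg (fun x => s'.imem (x + (N + 2))) lo (lo + t) ++
        List.merge (seg σ i mid) (seg σ j hi) (rowLe s.rmem E) =
        List.merge (seg σ lo mid) (seg σ mid hi) (rowLe s.rmem E)) (hi - lo) (8 * E + 24) le_rfl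
        ?_ ?_ ?_ ?_
    · refine ⟨lo, mid, by omega, by omega, le_rfl, le_rfl, e29, e30, e31, rfl, ?_, ?_⟩
      · simp [eim]
      · simp [seg_self]
    · rintro t s' hf ht ⟨i, j, -, -, -, -, -, -, k31, -⟩
      simp only [Test.holds, k31, hf.i 28 rfl, e28]
      omega
    · rintro t s' hf ht ⟨i, j, hi1, hj1, hi2, hj2, k29, k30, k31, hij, kim, kseg⟩
      have hfr : s'.rmem = s.rmem := by rw [hf.rm rfl, erm]
      have hsig : ∀ x < N, s'.imem (x + 2) = s.imem (x + 2) := fun x hx => kim _ (by omega)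
      refine (takeNext_spec (S := S) (inp := inp) (c5.frame hf rfl) E N i j (lo + t) mid hi hE
        (by rw [hf.i 27 rfl, e27]) (by rw [hf.i 28 rfl, e28]) k29 k30 k31
        (by rw [hf.i 32 rfl, e32]) hi1 hj1 (by omega) (by omega) (by omega) (by omega) hS1 hS2
        (fun x hx => by rw [hsig x hx]; exact hσ x hx)).mono le_rfl ?_
      rintro s'' - ⟨i', j', p1, p2, p3, p4, p5, p6, p7, p8, p9, p10⟩
      rw [hfr] at p10
      rw [seg_congr (f := fun x => s'.imem (x + 2)) (g := σ) (a := i) (b := mid)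
          (fun x _ hx => hsig x (by omega)),
        seg_congr (f := fun x => s'.imem (x + 2)) (g := σ) (a := j) (b := hi)
          (fun x _ hx => hsig x (by omega)),
        seg_congr (f := fun x => s'.imem (x + 2)) (g := σ) (a := i') (b := mid)
          (fun x _ hx => hsig x (by omega)),
        seg_congr (f := fun x => s'.imem (x + 2)) (g := σ) (a := j') (b := hi)
          (fun x _ hx => hsig x (by omega))] at p10
      refine ⟨i', j', p1, p2, by omega, by omega, p3, p4, by omega, by omega, ?_, ?_⟩
      · intro x hx
        rw [p9 x (by omega), kim x hx]
      · rw [← kseg, ← add_assoc, seg_snoc _ (by omega), p10,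
          seg_congr (f := fun x => s''.imem (x + (N + 2))) (g := fun x => s'.imem (x + (N + 2)))
            (fun x _ hx => p9 _ (by omega))]
        simp
    · rintro s' hf ⟨i, j, hi1, hj1, hi2, hj2, k29, k30, k31, hij, kim, kseg⟩
      refine ⟨kim, ?_⟩
      have hi' : i = mid := by omega
      have hj' : j = hi := by omega
      rw [← kseg, hi', hj', show lo + (hi - lo) = hi by omega]
      simp [seg_self]
  · rintro s6 hf6 ⟨q1, q2⟩
    have c6 := c5.frame hf6 rfl
    refine Runs.block (by simp) ?_
    simp only [wps, Instr.wp, IntOp.eval, c6.r24, hf6.i 28 rfl, e28]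
    exact ⟨by omega, by simp, q1, q2⟩

/-- Runs of `w` entries are sorted. -/
def RunsSorted (mem : ℕ → ℝ) (E N w : ℕ) (f : ℕ → ℕ) : Prop :=
  ∀ b, b * w < N → RowsSorted mem E (seg f (b * w) (min (b * w + w) N))

def mergePass : Cmd :=
  .seq (block [.intConst 26 0])
    (.seq (.while (.intLt 26 7) mergeRuns)
      (.seq (block [.intConst 31 0])
        (.seq (.while (.intLt 31 7) (block [.intOp .add 19 31 32, .intLoad 12 19,
          .intOp .add 19 31 21, .intStore 19 12, .intOp .add 31 31 20]))
          (block [.intOp .add 25 25 25]))))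

theorem mergePass_spec {s : State} (hc : Consts n m d K s) (E N w : ℕ) (hE : E = m * d + 1)
    (h7 : s.ireg 7 = N) (h25 : s.ireg 25 = w) (h32 : s.ireg 32 = N + 2)
    (hw : w < N) (hw1 : 1 ≤ w)
    (hS1 : 2 * N + 2 ≤ S) (hS2 : N * E + 1 ≤ S)
    (hp : (seg (fun x => s.imem (x + 2)) 0 N).Perm (List.range N))
    (hs : RunsSorted s.rmem E N w fun x => s.imem (x + 2)) :
    Runs S inp mergePass s (N * (8 * E + 45) + 5) fun s' =>
      s'.ireg 25 = 2 * w ∧ (seg (fun x => s'.imem (x + 2)) 0 N).Perm (List.range N) ∧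
      RunsSorted s.rmem E N (2 * w) fun x => s'.imem (x + 2) := by
  have hσ := seg_perm_range hp
  set σ : ℕ → ℕ := fun x => s.imem (x + 2) with hσd
  refine Runs.seq 1 (N * (8 * E + 45) + 4) (by omega) (Q := fun s' => s'.ireg 26 = 0) ?_ ?_
  · refine Runs.block (by simp) ?_
    simp [wps, Instr.wp]
  intro s1 hf1 g26
  have c1 := hc.frame hf1 rfl
  have a7 : s1.ireg 7 = N := by rw [hf1.i 7 rfl, h7]
  have a25 : s1.ireg 25 = w := by rw [hf1.i 25 rfl, h25]
  have a32 : s1.ireg 32 = N + 2 := by rw [hf1.i 32 rfl, h32]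
  have aim : s1.imem = s.imem := hf1.im rfl
  have arm : s1.rmem = s.rmem := hf1.rm rfl
  refine Runs.seq (N * (8 * E + 38) + 1) (N * 6 + 3) ?_ (Q := fun s' =>
      (seg (fun x => s'.imem (x + (N + 2))) 0 N).Perm (seg σ 0 N) ∧
      RunsSorted s.rmem E N (2 * w) fun x => s'.imem (x + (N + 2))) ?_ ?_
  · have : N * (8 * E + 45) = N * (8 * E + 38) + N * 6 + N := by ring
    omega
  -- The rounds take different times, since a merge is paid for per entry. The fixed cost 12 of a
  -- merge and 1 for the test are charged to its entries, of which there is at least one; this turns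
  -- 25 into 38.
  · refine Runs.while_time (fun k s' => ∃ lo ≤ N, k = (N - lo) * (8 * E + 38) ∧ s'.ireg 26 = lo ∧
        (lo < N → ∃ q, lo = q * (2 * w)) ∧
        (∀ x < N, s'.imem (x + 2) = s.imem (x + 2)) ∧
        (seg (fun x => s'.imem (x + (N + 2))) 0 lo).Perm (seg σ 0 lo) ∧
        ∀ b, b * (2 * w) < lo → RowsSorted s.rmem E
          (seg (fun x => s'.imem (x + (N + 2))) (b * (2 * w)) (min (b * (2 * w) + 2 * w) N)))
        (N * (8 * E + 38)) le_rfl ?_ ?_ ?_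
    · exact ⟨0, by omega, by simp, g26, fun _ => ⟨0, by simp⟩, fun x _ => by rw [aim],
        by simp [seg_self], by simp⟩
    · rintro k s' hf ⟨lo, hlo, rfl, k26, hq, kσ, kp, ks⟩ ht
      simp only [Test.holds, k26, hf.i 7 rfl, a7] at ht
      obtain ⟨q, rfl⟩ := hq ht
      set lo := q * (2 * w) with hlod
      have hfr : s'.rmem = s.rmem := by rw [hf.rm rfl, arm]
      refine ⟨(N - min (lo + 2 * w) N) * (8 * E + 38),
        (min (lo + 2 * w) N - lo) * (8 * E + 25) + 12, ?_, ?_⟩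
      · have h1 : (N - lo) * (8 * E + 38) = (N - min (lo + 2 * w) N) * (8 * E + 38) +
            (min (lo + 2 * w) N - lo) * (8 * E + 25) + (min (lo + 2 * w) N - lo) * 13 := by
          rw [show N - lo = (N - min (lo + 2 * w) N) + (min (lo + 2 * w) N - lo) by omega]
          ring
        omega
      refine (mergeRuns_spec (S := S) (inp := inp) (c1.frame hf rfl) E N lo w hE
        (by rw [hf.i 7 rfl, a7]) (by rw [hf.i 25 rfl, a25]) k26 (by rw [hf.i 32 rfl, a32]) ht hw
        hS1 hS2 fun x hx => by rw [kσ x hx]; exact hσ x hx).mono le_rfl ?_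
      rintro s'' - ⟨p1, p2, p3⟩
      rw [hfr, seg_congr (f := fun x => s'.imem (x + 2)) (g := σ)
          (fun x _ hx => kσ x (by omega)),
        seg_congr (f := fun x => s'.imem (x + 2)) (g := σ)
          (fun x _ hx => kσ x (by omega))] at p3
      have hold : ∀ a b, b ≤ lo → seg (fun x => s''.imem (x + (N + 2))) a b =
          seg (fun x => s'.imem (x + (N + 2))) a b := fun a b hb =>
        seg_congr fun x _ hx => p2 _ (by omega)
      refine ⟨min (lo + 2 * w) N, min_le_right _ _, rfl, p1, ?_, ?_, ?_, ?_⟩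
      · intro h
        exact ⟨q + 1, by rw [hlod, Nat.add_mul]; omega⟩
      · intro x hx
        rw [p2 _ (by omega), kσ x hx]
      · rw [← seg_append _ (Nat.zero_le lo) (by omega), hold 0 lo le_rfl, p3,
          ← seg_append σ (Nat.zero_le lo) (show lo ≤ min (lo + 2 * w) N by omega),
          ← seg_append σ (show lo ≤ min (lo + w) N by omega)
            (show min (lo + w) N ≤ min (lo + 2 * w) N by omega)]
        exact kp.append (List.merge_perm_append _)
      · intro b hb
        by_cases hbq : b < q
        · have h1 : b * (2 * w) + 2 * w ≤ lo := by
            rw [hlod, ← Nat.succ_mul]; exact Nat.mul_le_mul_right _ hbq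
          rw [hold _ _ (by omega)]
          exact ks b (by omega)
        · have hbq' : b = q := by
            by_contra hne
            have h1 : lo + 2 * w ≤ b * (2 * w) := by
              rw [hlod, ← Nat.succ_mul]; exact Nat.mul_le_mul_right _ (by omega)
            omega
          subst hbq'
          rw [← hlod, p3]
          -- The two merged pieces are the runs 2b and 2b + 1 of width w. The second one is empty
          -- when the first reaches the end of the list.
          refine List.pairwise_merge (rowLe_trans _ _) (rowLe_total _ _) _ _ ?_ ?_
          · have e1 : 2 * b * w = lo := by rw [hlod]; ring
            have := hs (2 * b) (by omega)
            rwa [e1] at this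
          · have e1 : (2 * b + 1) * w = lo + w := by rw [hlod]; ring
            rcases lt_or_ge (lo + w) N with h | h
            · have := hs (2 * b + 1) (by omega)
              rwa [e1, show lo + w + w = lo + 2 * w by omega,
                show lo + w = min (lo + w) N by omega] at this
            · rw [show min (lo + w) N = N by omega, show min (lo + 2 * w) N = N by omega, seg_self]
              exact List.Pairwise.nil
    · rintro k s' hf ⟨lo, hlo, rfl, k26, hq, kσ, kp, ks⟩ ht
      simp only [Test.holds, k26, hf.i 7 rfl, a7] at ht
      obtain rfl : lo = N := by omega
      exact ⟨kp, ks⟩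
  · rintro s2 hf2 ⟨k1, k2⟩
    have c2 := c1.frame hf2 rfl
    have b7 : s2.ireg 7 = N := by rw [hf2.i 7 rfl, a7]
    have b25 : s2.ireg 25 = w := by rw [hf2.i 25 rfl, a25]
    have b32 : s2.ireg 32 = N + 2 := by rw [hf2.i 32 rfl, a32]
    refine Runs.seq 1 (N * 6 + 2) (by omega) (Q := fun s' => s'.ireg 31 = 0) ?_ ?_
    · refine Runs.block (by simp) ?_
      simp [wps, Instr.wp]
    intro s3 hf3 g31
    have c3 := c2.frame hf3 rfl
    have d7 : s3.ireg 7 = N := by rw [hf3.i 7 rfl, b7]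
    have d25 : s3.ireg 25 = w := by rw [hf3.i 25 rfl, b25]
    have d32 : s3.ireg 32 = N + 2 := by rw [hf3.i 32 rfl, b32]
    have dim : s3.imem = s2.imem := hf3.im rfl
    refine Runs.seq (N * 6 + 1) 1 (by omega) (Q := fun s' =>
      ∀ x < N, s'.imem (x + 2) = s2.imem (x + (N + 2))) ?_ ?_
    · refine Runs.for (fun t s' => s'.ireg 31 = t ∧ (∀ x < t, s'.imem (x + 2) = s2.imem (x + (N + 2)))
        ∧ ∀ x, N + 2 ≤ x → s'.imem x = s2.imem x) N 5 le_rfl ?_ ?_ ?_ ?_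
      · exact ⟨g31, by simp, fun x _ => by rw [dim]⟩
      · rintro t s' hf ht ⟨q1, -⟩
        simp only [Test.holds, q1, hf.i 7 rfl, d7]
      · rintro t s' hf ht ⟨q1, q2, q3⟩
        refine Runs.block (by simp) ?_
        simp [wps, Instr.wp, IntOp.eval, (c3.frame hf rfl).r20, (c3.frame hf rfl).r21, q1,
          hf.i 32 rfl, d32]
        refine ⟨by omega, by omega, by omega, by omega, by omega, ?_, ?_⟩
        · intro x hx
          rcases Nat.lt_or_eq_of_le hx with h | rfl
          · rw [Function.update_of_ne (by omega), q2 x h]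
          · rw [Function.update_self, q3 _ (by omega)]
        · intro x hx
          rw [Function.update_of_ne (by omega), q3 x hx]
      · rintro s' hf ⟨-, q2, -⟩
        exact q2
    · intro s4 hf4 hcopy
      have hsg : ∀ a b, b ≤ N → seg (fun x => s4.imem (x + 2)) a b =
          seg (fun x => s2.imem (x + (N + 2))) a b := fun a b hb =>
        seg_congr fun x _ hx => hcopy x (by omega)
      refine Runs.block (by simp) ?_
      simp only [wps, Instr.wp, IntOp.eval, hf4.i 25 rfl, d25]
      refine ⟨by omega, by simp; omega, ?_, ?_⟩
      · rw [hsg 0 N le_rfl]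
        exact k1.trans hp
      · intro b hb
        rw [hsg _ _ (min_le_right _ _)]
        exact k2 b hb

def mergeSort : Cmd :=
  .seq (block [.intConst 31 0, .intConst 25 1, .intOp .add 32 7 21])
    (.seq (.while (.intLt 31 7) (block [.intOp .add 19 31 21, .intStore 19 31,
        .intOp .add 31 31 20]))
      (.while (.intLt 25 7) mergePass))

theorem mergeSort_spec {s : State} (hc : Consts n m d K s) (E N L : ℕ) (hE : E = m * d + 1)
    (h7 : s.ireg 7 = N) (hNL : N ≤ 2 ^ L)
    (hS1 : 2 * N + 2 ≤ S) (hS2 : N * E + 1 ≤ S) :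
    Runs S inp mergeSort s (L * (N * (8 * E + 45) + 6) + N * 4 + 5) fun s' =>
      (seg (fun x => s'.imem (x + 2)) 0 N).Perm (List.range N) ∧
      RowsSorted s.rmem E (seg (fun x => s'.imem (x + 2)) 0 N) := by
  refine Runs.seq 3 (L * (N * (8 * E + 45) + 6) + N * 4 + 2) (by omega)
    (Q := fun s' => s'.ireg 31 = 0 ∧ s'.ireg 25 = 1 ∧ s'.ireg 32 = N + 2) ?_ ?_
  · refine Runs.block (by simp) ?_
    simp [wps, Instr.wp, IntOp.eval, h7, hc.r21]
    omega
  rintro s1 hf1 ⟨g31, g25, g32⟩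
  have c1 := hc.frame hf1 rfl
  have a7 : s1.ireg 7 = N := by rw [hf1.i 7 rfl, h7]
  refine Runs.seq (N * 4 + 1) (L * (N * (8 * E + 45) + 6) + 1) (by omega)
    (Q := fun s' => ∀ x < N, s'.imem (x + 2) = x) ?_ ?_
  · refine Runs.for (fun t s' => s'.ireg 31 = t ∧ ∀ x < t, s'.imem (x + 2) = x) N 3 le_rfl
      ?_ ?_ ?_ ?_
    · exact ⟨g31, by simp⟩
    · rintro t s' hf ht ⟨q1, -⟩
      simp only [Test.holds, q1, hf.i 7 rfl, a7]
    · rintro t s' hf ht ⟨q1, q2⟩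
      refine Runs.block (by simp) ?_
      simp [wps, Instr.wp, IntOp.eval, (c1.frame hf rfl).r20, (c1.frame hf rfl).r21, q1]
      refine ⟨by omega, by omega, by omega, ?_⟩
      intro x hx
      rcases Nat.lt_or_eq_of_le hx with h | rfl
      · rw [Function.update_of_ne (by omega), q2 x h]
      · rw [Function.update_self]
    · rintro s' hf ⟨-, q2⟩
      exact q2
  intro s2 hf2 hid
  have c2 := c1.frame hf2 rfl
  have b7 : s2.ireg 7 = N := by rw [hf2.i 7 rfl, a7]
  have b25 : s2.ireg 25 = 1 := by rw [hf2.i 25 rfl, g25]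
  have b32 : s2.ireg 32 = N + 2 := by rw [hf2.i 32 rfl, g32]
  have brm : s2.rmem = s.rmem := by rw [hf2.rm rfl, hf1.rm rfl]
  -- The width w of the sorted runs doubles with every pass, so k counts passes that may still be
  -- needed and L of them suffice.
  refine Runs.while (fun k s' => ∃ w, 1 ≤ w ∧ s'.ireg 25 = w ∧ N ≤ w * 2 ^ k ∧
    (seg (fun x => s'.imem (x + 2)) 0 N).Perm (List.range N) ∧
    RunsSorted s.rmem E N w fun x => s'.imem (x + 2)) L (N * (8 * E + 45) + 5) le_rfl ?_ ?_ ?_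
  · have hseg : seg (fun x => s2.imem (x + 2)) 0 N = List.range N := by
      rw [seg_congr (g := fun x => x) (fun x _ hx => hid x hx), seg, List.range_eq_range']
      simp
    refine ⟨1, le_rfl, b25, by omega, by rw [hseg], ?_⟩
    intro b hb
    rw [show min (b * 1 + 1) N = b * 1 + 1 by omega, seg_cons _ (Nat.lt_succ_self _), seg_self]
    exact List.pairwise_singleton _ _
  · rintro k s' hf ⟨w, hw1, q25, qk, qp, qs⟩ ht
    simp only [Test.holds, q25, hf.i 7 rfl, b7] at ht
    obtain _ | k := k
    · simp at qk
      omega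
    have hfr : s'.rmem = s.rmem := by rw [hf.rm rfl, brm]
    refine ⟨k, by omega, (mergePass_spec (S := S) (inp := inp) (c2.frame hf rfl) E N w hE
      (by rw [hf.i 7 rfl, b7]) q25 (by rw [hf.i 32 rfl, b32]) ht hw1 hS1 hS2 qp
      (by rwa [hfr])).mono le_rfl ?_⟩
    rintro s'' - ⟨p1, p2, p3⟩
    refine ⟨2 * w, by omega, p1, ?_, p2, by rwa [hfr] at p3⟩
    rw [pow_succ] at qk
    calc N ≤ w * (2 ^ k * 2) := qk
      _ = 2 * w * 2 ^ k := by ring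
  · rintro k s' hf ⟨w, hw1, q25, qk, qp, qs⟩ ht
    simp only [Test.holds, q25, hf.i 7 rfl, b7] at ht
    refine ⟨qp, ?_⟩
    rcases Nat.eq_zero_or_pos N with rfl | hN
    · rw [seg_self]
      exact List.Pairwise.nil
    · have := qs 0 (by omega)
      rwa [Nat.zero_mul, Nat.zero_add, min_eq_right (by omega)] at this

end

/-! ### Blocks of rows with a common prefix -/

/-- The rows `a` and `b` agree in the first `l` coordinates. -/
def Agree (T : ℕ → ℕ → ℝ) (l a b : ℕ) : Prop := ∀ j < l, T a j = T b j

theorem Agree.symm {T : ℕ → ℕ → ℝ} {l a b : ℕ} (h : Agree T l a b) : Agree T l b a :=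
  fun j hj => (h j hj).symm

theorem Agree.trans {T : ℕ → ℕ → ℝ} {l a b c : ℕ} (h : Agree T l a b) (h' : Agree T l b c) :
    Agree T l a c := fun j hj => (h j hj).trans (h' j hj)

theorem Agree.mono {T : ℕ → ℕ → ℝ} {l l' a b : ℕ} (h : Agree T l a b) (hl : l' ≤ l) :
    Agree T l' a b := fun j hj => h j (hj.trans_le hl)

/-- The rows `0, …, N - 1` of length `E` increase lexicographically. -/
def SortedTable (T : ℕ → ℕ → ℝ) (E N : ℕ) : Prop :=
  ∀ a b, a ≤ b → b < N → ∀ j < E, Agree T j a b → T a j ≤ T b j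

/-- In a lexicographically sorted table, a row between two rows with a common prefix is squeezed
between them, coordinate by coordinate. Rows sharing a prefix are thus consecutive. -/
theorem SortedTable.agree {T : ℕ → ℕ → ℝ} {E N a b c l : ℕ} (h : SortedTable T E N) (hab : a ≤ b)
    (hbc : b ≤ c) (hc : c < N) (hl : l ≤ E) (hac : Agree T l a c) : Agree T l a b := by
  intro j
  induction j using Nat.strong_induction_on with
  | _ j ih =>
    intro hj
    have h1 : Agree T j a b := fun i hi => ih i hi (hi.trans hj)
    have h2 : Agree T j b c := h1.symm.trans (hac.mono hj.le)
    refine le_antisymm (h a b hab (by omega) j (by omega) h1) ?_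
    rw [hac j hj]
    exact h b c hbc hc j (by omega) h2

theorem sortedTable_of_rowsSorted {mem : ℕ → ℝ} {σ : ℕ → ℕ} {E N : ℕ}
    (h : RowsSorted mem E (seg σ 0 N)) : SortedTable (fun c j => mem (1 + σ c * E + j)) E N := by
  intro a b hab hb j hj hag
  rcases Nat.eq_or_lt_of_le hab with rfl | hab
  · exact le_rfl
  have h1 : rowLe mem E (σ a) (σ b) = true := by
    have := List.pairwise_iff_getElem.1 h a b (by simp [seg]; omega) (by simp [seg]; omega) hab
    simpa [seg] using this
  rw [rowLe, decide_eq_true_eq] at h1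
  by_contra hlt
  exact absurd h1 (not_le.2 (memRow_lt (fun i hi => (hag i hi).symm) hj (not_le.1 hlt)))

/-- Among the first `P` rows, the rows related to the row `p` are those from `A p` up to, but not
including, `B (A p)`. -/
def BlocksOK (R : ℕ → ℕ → Prop) (A B : ℕ → ℕ) (P : ℕ) : Prop :=
  ∀ p < P, A p ≤ p ∧ p < B (A p) ∧ B (A p) ≤ P ∧ ∀ c < P, (A p ≤ c ∧ c < B (A p)) ↔ R c p

/-- By `hconv`, a new last row either joins the block of its predecessor or starts a block of its
own. The end of a block is recorded only at its first row `a`, so that appending a row changes a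
single end. -/
theorem BlocksOK.step {R : ℕ → ℕ → Prop} {A B A' B' : ℕ → ℕ} {P a : ℕ} (h : BlocksOK R A B P)
    (hrefl : ∀ x, R x x) (hsymm : ∀ x y, R x y → R y x) (htrans : ∀ x y z, R x y → R y z → R x z)
    (hconv : ∀ c < P, R c P → R (P - 1) P)
    (ha : (0 < P ∧ R (P - 1) P ∧ a = A (P - 1)) ∨ ((P = 0 ∨ ¬ R (P - 1) P) ∧ a = P))
    (hA : ∀ p < P, A' p = A p) (hAP : A' P = a) (hB : ∀ p ≤ P, p ≠ a → B' p = B p)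
    (hBa : B' a = P + 1) : BlocksOK R A' B' (P + 1) := by
  have hself : ∀ p < P, R (A p) p := fun p hp => by
    obtain ⟨h1, h2, h3, h4⟩ := h p hp
    exact (h4 _ (by omega)).1 ⟨le_rfl, by omega⟩
  intro p hp
  rcases ha with ⟨hP, hR, rfl⟩ | ⟨hR, rfl⟩
  · obtain ⟨g1, g2, g3, g4⟩ := h (P - 1) (by omega)
    rcases Nat.lt_succ_iff_lt_or_eq.1 hp with hp | rfl
    · obtain ⟨h1, h2, h3, h4⟩ := h p hp
      rw [hA p hp]
      by_cases heq : A p = A (P - 1)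
      · rw [heq, hBa]
        rw [heq] at h1 h2 h3 h4
        refine ⟨h1, by omega, le_rfl, fun c hc => ?_⟩
        rcases Nat.lt_succ_iff_lt_or_eq.1 hc with hc | rfl
        · rw [← h4 c hc]
          omega
        · have := (h4 (c - 1) (by omega)).1 (by omega)
          exact ⟨fun _ => htrans _ _ _ (hsymm _ _ hR) this, fun _ => by omega⟩
      · rw [hB _ (by omega) heq]
        refine ⟨h1, h2, by omega, fun c hc => ?_⟩
        rcases Nat.lt_succ_iff_lt_or_eq.1 hc with hc | rfl
        · exact h4 c hc
        · refine ⟨fun hh => by omega, fun hh => ?_⟩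
          have hq : R p (c - 1) := hsymm _ _ (htrans _ _ _ hR hh)
          have e1 := (g4 (A p) (by omega)).2 (htrans _ _ _ (hself p hp) hq)
          have e2 := (h4 (A (c - 1)) (by omega)).2
            (htrans _ _ _ (hself (c - 1) (by omega)) (hsymm _ _ hq))
          omega
    · rw [hAP, hBa]
      refine ⟨by omega, by omega, le_rfl, fun c hc => ?_⟩
      rcases Nat.lt_succ_iff_lt_or_eq.1 hc with hc | rfl
      · have := g4 c hc
        refine ⟨fun hh => htrans _ _ _ (this.1 (by omega)) hR, fun hh => ?_⟩
        have := this.2 (htrans _ _ _ hh (hsymm _ _ hR))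
        omega
      · exact ⟨fun _ => hrefl _, fun _ => by omega⟩
  · have hno : ∀ c < a, ¬ R c a := by
      intro c hc hh
      rcases hR with rfl | hR
      · omega
      · exact hR (hconv c hc hh)
    rcases Nat.lt_succ_iff_lt_or_eq.1 hp with hp | rfl
    · obtain ⟨h1, h2, h3, h4⟩ := h p hp
      rw [hA p hp, hB _ (by omega) (by omega)]
      refine ⟨h1, h2, by omega, fun c hc => ?_⟩
      rcases Nat.lt_succ_iff_lt_or_eq.1 hc with hc | rfl
      · exact h4 c hc
      · exact ⟨fun hh => by omega, fun hh => absurd (hsymm _ _ hh) (hno p hp)⟩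
    · rw [hAP, hBa]
      refine ⟨le_rfl, by omega, le_rfl, fun c hc => ?_⟩
      rcases Nat.lt_succ_iff_lt_or_eq.1 hc with hc | rfl
      · exact ⟨fun hh => by omega, fun hh => absurd hh (hno c hc)⟩
      · exact ⟨fun _ => hrefl _, fun _ => by omega⟩

theorem rowAddr_inj {E p p' l l' : ℕ} (hl : l < E) (hl' : l' < E)
    (h : p * E + l = p' * E + l') : p = p' ∧ l = l' := by
  have hE : 0 < E := by omega
  have h1 : (p * E + l) / E = p := by
    rw [Nat.mul_comm, Nat.mul_add_div hE, Nat.div_eq_of_lt hl, Nat.add_zero]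
  have h2 : (p' * E + l') / E = p' := by
    rw [Nat.mul_comm, Nat.mul_add_div hE, Nat.div_eq_of_lt hl', Nat.add_zero]
  have h3 : p = p' := by rw [← h1, h, h2]
  subst h3
  exact ⟨rfl, by omega⟩

/-- The new row joins the block of its predecessor at level l exactly when l is below the length of
their common prefix in register 14. One comparison of rows thus serves all levels. Each level
occupies a pair of cells per row: the start of the block, and the end, valid at the start row only.
-/
def tableLevel : Cmd :=
  .seq (.ite (.intLt 15 14) (block [.intOp .sub 19 16 36, .intLoad 17 19])
      (block [.intOp .add 17 31 24]))
    (block [.intStore 16 17, .intOp .mul 19 17 36, .intOp .add 19 19 35, .intOp .add 19 19 15,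
      .intOp .add 19 19 15, .intOp .add 19 19 20, .intStore 19 18, .intOp .add 16 16 21,
      .intOp .add 15 15 20])

section

variable {S : ℕ} {inp : ℕ → ℝ} {n m d K : ℕ}

theorem tableLevel_spec {s : State} (hc : Consts n m d K s) (E D N l lcp P tb : ℕ)
    (hD : D = m * d) (hE : E = D + 1) (T : ℕ → ℕ → ℝ) (hT : SortedTable T E N)
    (h14 : s.ireg 14 = lcp) (h15 : s.ireg 15 = l) (h16 : s.ireg 16 = tb + 2 * (P * E + l))
    (h18 : s.ireg 18 = P + 1) (h31 : s.ireg 31 = P) (h35 : s.ireg 35 = tb)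
    (h36 : s.ireg 36 = 2 * E) (hl : l < D) (hP : P < N) (hS : tb + 2 * (N * E) + 2 ≤ S)
    (hlcp : ∀ l < D, l < lcp ↔ 0 < P ∧ Agree T (l + 1) (P - 1) P)
    (h : BlocksOK (Agree T (l + 1)) (fun p => s.imem (tb + 2 * (p * E + l)))
      (fun p => s.imem (tb + 2 * (p * E + l) + 1)) P) :
    Runs S inp tableLevel s 12 fun s' => s'.ireg 15 = l + 1 ∧
      s'.ireg 16 = tb + 2 * (P * E + (l + 1)) ∧ (∀ x < tb, s'.imem x = s.imem x) ∧
      (∀ l' < E, l' ≠ l → ∀ p f, f ≤ 1 → s'.imem (tb + 2 * (p * E + l') + f) =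
        s.imem (tb + 2 * (p * E + l') + f)) ∧
      BlocksOK (Agree T (l + 1)) (fun p => s'.imem (tb + 2 * (p * E + l)))
        (fun p => s'.imem (tb + 2 * (p * E + l) + 1)) (P + 1) := by
  set A := fun p => s.imem (tb + 2 * (p * E + l)) with hA
  set B := fun p => s.imem (tb + 2 * (p * E + l) + 1) with hB
  have eP : P * E + E ≤ N * E := by rw [← Nat.succ_mul]; exact Nat.mul_le_mul_right _ hP
  have e3 : N ≤ N * E := Nat.le_mul_of_pos_right _ (by omega)
  refine Runs.seq 3 9 (by omega) (Q := fun s' =>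
    ((0 < P ∧ Agree T (l + 1) (P - 1) P ∧ s'.ireg 17 = A (P - 1)) ∨
      ((P = 0 ∨ ¬ Agree T (l + 1) (P - 1) P) ∧ s'.ireg 17 = P))) ?_ ?_
  · refine Runs.ite 2 (by omega) (fun ht => ?_) (fun ht => ?_)
    · simp only [Test.holds, h14, h15] at ht
      obtain ⟨hP0, hag⟩ := (hlcp l hl).1 ht
      have e1 : P * E = (P - 1) * E + E := by
        rw [← Nat.succ_mul]; congr 1; omega
      have e2 : tb + 2 * (P * E + l) - 2 * E = tb + 2 * ((P - 1) * E + l) := by omega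
      refine Runs.block (by simp) ?_
      simp only [wps, Instr.wp, IntOp.eval, h16, h36, e2]
      refine ⟨by omega, by simp; omega, Or.inl ⟨hP0, hag, by simp [hA]⟩⟩
    · simp only [Test.holds, h14, h15, hlcp l hl] at ht
      refine Runs.block (by simp) ?_
      simp only [wps, Instr.wp, IntOp.eval, h31, hc.r24]
      exact ⟨by omega, Or.inr ⟨by by_contra hh; push Not at hh; exact ht ⟨by omega, hh.2⟩,
        by simp⟩⟩
  · intro s1 hf1 hq
    have c1 := hc.frame hf1 rfl
    generalize ha : s1.ireg 17 = a at hq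
    have haP : a ≤ P := by
      rcases hq with ⟨h1, -, h2⟩ | ⟨-, h2⟩
      · have : A (P - 1) ≤ P - 1 := (h (P - 1) (by omega)).1
        omega
      · omega
    have eA : a * E + E ≤ N * E := by
      rw [← Nat.succ_mul]; exact Nat.mul_le_mul_right _ (by omega)
    have a15 : s1.ireg 15 = l := by rw [hf1.i 15 rfl, h15]
    have a16 : s1.ireg 16 = tb + 2 * (P * E + l) := by rw [hf1.i 16 rfl, h16]
    have a18 : s1.ireg 18 = P + 1 := by rw [hf1.i 18 rfl, h18]
    have a35 : s1.ireg 35 = tb := by rw [hf1.i 35 rfl, h35]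
    have a36 : s1.ireg 36 = 2 * E := by rw [hf1.i 36 rfl, h36]
    have aim : s1.imem = s.imem := hf1.im rfl
    have ead : a * (2 * E) + tb + l + l + 1 = tb + 2 * (a * E + l) + 1 := by ring
    have e4 : a * (2 * E) = 2 * (a * E) := by ring
    refine Runs.block (by simp) ?_
    simp [wps, Instr.wp, IntOp.eval, c1.r20, c1.r21, ha, a15, a16, a18, a35, a36, aim, ead]
    refine ⟨by omega, by omega, by omega, by omega, by omega, by omega, by omega, by omega,
      by omega, by ring, ?_, ?_, ?_⟩
    · intro x hx
      rw [Function.update_of_ne (by omega), Function.update_of_ne (by omega)]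
    · intro l' hl' hne p f hf
      rw [Function.update_of_ne, Function.update_of_ne]
      · intro hh
        exact hne (rowAddr_inj (E := E) hl' (by omega) (show p * E + l' = P * E + l by omega)).2
      · intro hh
        exact hne (rowAddr_inj (E := E) hl' (by omega) (show p * E + l' = a * E + l by omega)).2
    · refine BlocksOK.step (a := a) h (fun x => fun _ _ => rfl) (fun x y => Agree.symm)
        (fun x y z => Agree.trans) ?_ hq ?_ ?_ ?_ ?_
      · intro c hc hag
        have := hT.agree (b := P - 1) (by omega) (by omega) hP (by omega) hag
        exact this.symm.trans hag
      · intro p hp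
        rw [Function.update_of_ne (by omega), Function.update_of_ne]
        intro hh
        have := (rowAddr_inj (E := E) (by omega) (by omega)
          (show p * E + l = P * E + l by omega)).1
        omega
      · rw [Function.update_of_ne (by omega), Function.update_self]
      · intro p hp hne
        rw [Function.update_of_ne, Function.update_of_ne (by omega)]
        intro hh
        exact hne (rowAddr_inj (E := E) (by omega) (by omega)
          (show p * E + l = a * E + l by omega)).1
      · rw [Function.update_self]

end

/-! ### The tables -/

/-- The sorted rows of the data structure: the integer cells from `2` on hold the numbers of the
rows in increasing order. -/
def tableRow (s : State) (E c j : ℕ) : ℝ := s.rmem (1 + s.imem (c + 2) * E + j)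

/-- The row `p` differs from its predecessor. -/
def IsNew (T : ℕ → ℕ → ℝ) (E p : ℕ) : Prop := p = 0 ∨ ¬ Agree T E (p - 1) p

/-- The tables for the first `P` rows: the numbers of the distinct rows, and the blocks of rows with
a common prefix. -/
structure TablesOK (T : ℕ → ℕ → ℝ) (imem : ℕ → ℕ) (D N P : ℕ) : Prop where
  count_zero : imem (2 * N + 2) = 0
  count_new : ∀ p < P, IsNew T (D + 1) p → imem (2 * N + 2 + (p + 1)) = imem (2 * N + 2 + p) + 1
  count_old : ∀ p < P, ¬ IsNew T (D + 1) p → imem (2 * N + 2 + (p + 1)) = imem (2 * N + 2 + p)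
  blocks : ∀ l < D, BlocksOK (Agree T (l + 1))
    (fun p => imem (3 * N + 3 + 2 * (p * (D + 1) + l)))
    (fun p => imem (3 * N + 3 + 2 * (p * (D + 1) + l) + 1)) P

theorem TablesOK.count_le {T : ℕ → ℕ → ℝ} {imem : ℕ → ℕ} {D N P : ℕ} (h : TablesOK T imem D N P) :
    ∀ p ≤ P, imem (2 * N + 2 + p) ≤ p := by
  intro p
  induction p with
  | zero => simp [h.count_zero]
  | succ p ih =>
    intro hp
    have := ih (by omega)
    by_cases hn : IsNew T (D + 1) p
    · rw [h.count_new p (by omega) hn]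
      omega
    · rw [h.count_old p (by omega) hn]
      omega

/-- A row is new when the common prefix with its predecessor is shorter than all md + 1 entries, the
number of the curve included. The very first row is not compared; its prefix length stays 0, so it
counts as new. -/
def tableStep : Cmd :=
  .seq (block [.intConst 14 0])
    (.seq (.ite (.intLt 24 31) (.seq (block [.intOp .add 19 31 21, .intLoad 13 19,
        .intOp .sub 19 19 20, .intLoad 12 19]) compareRows) .skip)
      (.seq (block [.intOp .add 19 34 31, .intLoad 17 19])
        (.seq (.ite (.intLt 14 4) (block [.intOp .add 17 17 20]) .skip)
          (.seq (block [.intOp .add 19 19 20, .intStore 19 17, .intOp .mul 16 31 36,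
              .intOp .add 16 16 35, .intConst 15 0, .intOp .add 18 31 20])
            (.seq (.while (.intLt 15 3) tableLevel) (block [.intOp .add 31 31 20]))))))

section

variable {S : ℕ} {inp : ℕ → ℝ} {n m d K : ℕ}

theorem tableStep_spec {s : State} (hc : Consts n m d K s) (E D N P : ℕ)
    (hD : D = m * d) (hE : E = D + 1) (T : ℕ → ℕ → ℝ)
    (hTdef : ∀ c < N, ∀ j, T c j = s.rmem (1 + s.imem (c + 2) * E + j))
    (hT : SortedTable T E N) (hσ : ∀ x < N, s.imem (x + 2) < N)
    (h31 : s.ireg 31 = P) (h34 : s.ireg 34 = 2 * N + 2) (h35 : s.ireg 35 = 3 * N + 3)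
    (h36 : s.ireg 36 = 2 * E) (hP : P < N) (hS : 3 * N + 3 + 2 * (N * E) + 2 ≤ S)
    (h : TablesOK T s.imem D N P) :
    Runs S inp tableStep s (8 * E + 13 * D + 27) fun s' => s'.ireg 31 = P + 1 ∧
      (∀ x < 2 * N + 2, s'.imem x = s.imem x) ∧ TablesOK T s'.imem D N (P + 1) := by
  have hrow : ∀ x < N, 1 + s.imem (x + 2) * E + E ≤ S := by
    intro x hx
    have : s.imem (x + 2) * E + E ≤ N * E := by
      rw [← Nat.succ_mul]; exact Nat.mul_le_mul_right _ (hσ x hx)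
    omega
  have eP : P * E + E ≤ N * E := by rw [← Nat.succ_mul]; exact Nat.mul_le_mul_right _ hP
  refine Runs.seq 1 (8 * E + 13 * D + 26) (by omega) (Q := fun s' => s'.ireg 14 = 0) ?_ ?_
  · refine Runs.block (by simp) ?_
    simp [wps, Instr.wp]
  intro s1 hf1 g14
  have c1 := hc.frame hf1 rfl
  have a31 : s1.ireg 31 = P := by rw [hf1.i 31 rfl, h31]
  have aim : s1.imem = s.imem := hf1.im rfl
  have arm : s1.rmem = s.rmem := hf1.rm rfl
  refine Runs.seq (8 * E + 13) (13 * D + 13) (by omega) (Q := fun s' => ∃ lcp, s'.ireg 14 = lcp ∧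
    (∀ l < E, l < lcp ↔ 0 < P ∧ Agree T (l + 1) (P - 1) P) ∧ lcp ≤ E) ?_ ?_
  · refine Runs.ite (8 * E + 12) (by omega) (fun ht => ?_) (fun ht => ?_)
    · simp only [Test.holds, c1.r24, a31] at ht
      have e1 : P + 2 - 1 = P - 1 + 2 := by omega
      refine Runs.seq 4 (8 * E + 8) (by omega) (Q := fun s' => s'.ireg 13 = s.imem (P + 2) ∧
        s'.ireg 12 = s.imem (P - 1 + 2)) ?_ ?_
      · refine Runs.block (by simp) ?_
        simp [wps, Instr.wp, IntOp.eval, c1.r20, c1.r21, a31, aim, e1]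
        omega
      rintro s2 hf2 ⟨b13, b12⟩
      have brm : s2.rmem = s.rmem := by rw [hf2.rm rfl, arm]
      refine (compareRows_spec (S := S) (inp := inp) (c1.frame hf2 rfl) E _ _ (by omega) b12 b13
        (hrow _ (by omega)) (hrow _ (by omega))).mono le_rfl ?_
      rintro s3 - ⟨l, hl, q1, q2, q3, -⟩
      simp only [brm, ← hTdef (P - 1) (by omega), ← hTdef P hP] at q2 q3
      refine ⟨l, q1, fun l' hl' => ⟨fun hh => ⟨ht, fun j hj => q2 j (by omega)⟩, ?_⟩, hl⟩
      rintro ⟨-, hag⟩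
      by_contra hh
      exact q3 (by omega) (hag l (by omega))
    · simp only [Test.holds, c1.r24, a31] at ht
      exact Runs.skip ⟨0, g14, fun l _ => by simp [ht], by omega⟩
  rintro s2 hf2 ⟨lcp, b14, hlcp, hlE⟩
  have c2 := c1.frame hf2 rfl
  have b31 : s2.ireg 31 = P := by rw [hf2.i 31 rfl, a31]
  have b34 : s2.ireg 34 = 2 * N + 2 := by rw [hf2.i 34 rfl, hf1.i 34 rfl, h34]
  have bim : s2.imem = s.imem := by rw [hf2.im rfl, aim]
  have hnew : lcp < E ↔ IsNew T E P := by
    have := hlcp D (by omega)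
    rw [← hE] at this
    unfold IsNew
    by_cases hP0 : P = 0
    · subst hP0; simp only [lt_irrefl, false_and, iff_false] at this; simp; omega
    · by_cases ha : Agree T E (P - 1) P
      · have := this.2 ⟨by omega, ha⟩
        simp [hP0, ha]; omega
      · have : ¬ (D < lcp) := fun hh => ha (this.1 hh).2
        simp [ha]; omega
  refine Runs.seq 2 (13 * D + 11) (by omega) (Q := fun s' => s'.ireg 19 = 2 * N + 2 + P ∧
    s'.ireg 17 = s.imem (2 * N + 2 + P)) ?_ ?_
  · refine Runs.block (by simp) ?_
    simp [wps, Instr.wp, IntOp.eval, b31, b34, bim]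
    omega
  rintro s3 hf3 ⟨d19, d17⟩
  have c3 := c2.frame hf3 rfl
  have hcl := h.count_le P le_rfl
  refine Runs.seq 2 (13 * D + 9) (by omega) (Q := fun s' =>
    (IsNew T E P → s'.ireg 17 = s.imem (2 * N + 2 + P) + 1) ∧
    (¬ IsNew T E P → s'.ireg 17 = s.imem (2 * N + 2 + P))) ?_ ?_
  · refine Runs.ite 1 (by omega) (fun ht => ?_) (fun ht => ?_)
    · simp only [Test.holds, c3.r4, hf3.i 14 rfl, b14, ← hD, ← hE, hnew] at ht
      refine Runs.block (by simp) ?_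
      simp [wps, Instr.wp, IntOp.eval, c3.r20, d17, ht]
      omega
    · simp only [Test.holds, c3.r4, hf3.i 14 rfl, b14, ← hD, ← hE, hnew] at ht
      exact Runs.skip ⟨fun hh => absurd hh ht, fun _ => d17⟩
  rintro s4 hf4 ⟨e17, e17'⟩
  have c4 := c3.frame hf4 rfl
  have e19 : s4.ireg 19 = 2 * N + 2 + P := by rw [hf4.i 19 rfl, d19]
  have e31 : s4.ireg 31 = P := by rw [hf4.i 31 rfl, hf3.i 31 rfl, b31]
  have e35 : s4.ireg 35 = 3 * N + 3 := by
    rw [hf4.i 35 rfl, hf3.i 35 rfl, hf2.i 35 rfl, hf1.i 35 rfl, h35]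
  have e36 : s4.ireg 36 = 2 * E := by
    rw [hf4.i 36 rfl, hf3.i 36 rfl, hf2.i 36 rfl, hf1.i 36 rfl, h36]
  have eim : s4.imem = s.imem := by rw [hf4.im rfl, hf3.im rfl, bim]
  have e14 : s4.ireg 14 = lcp := by rw [hf4.i 14 rfl, hf3.i 14 rfl, b14]
  have e4 : P * (2 * E) = 2 * (P * E) := by ring
  refine Runs.seq 6 (13 * D + 3) (by omega) (Q := fun s' => s'.ireg 15 = 0 ∧
    s'.ireg 16 = 3 * N + 3 + 2 * (P * E) ∧ s'.ireg 18 = P + 1 ∧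
    s'.imem = Function.update s.imem (2 * N + 2 + (P + 1)) (s4.ireg 17)) ?_ ?_
  · refine Runs.block (by simp) ?_
    simp [wps, Instr.wp, IntOp.eval, c4.r20, e19, e31, e35, e36, eim, Nat.add_assoc]
    omega
  rintro s5 hf5 ⟨g15, g16, g18, gim⟩
  have c5 := c4.frame hf5 rfl
  set v := s4.ireg 17 with hv
  have hold : ∀ x, x ≠ 2 * N + 2 + (P + 1) → s5.imem x = s.imem x := fun x hx => by
    rw [gim, Function.update_of_ne hx]
  refine Runs.seq (D * 13 + 1) 1 (by omega) (Q := fun s' =>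
    (∀ x < 3 * N + 3, s'.imem x = s5.imem x) ∧ ∀ l < D, BlocksOK (Agree T (l + 1))
    (fun p => s'.imem (3 * N + 3 + 2 * (p * E + l)))
    (fun p => s'.imem (3 * N + 3 + 2 * (p * E + l) + 1)) (P + 1)) ?_ ?_
  -- Midway, the levels below l already describe P + 1 rows while the others still describe P.
  · refine Runs.for (fun l s' => s'.ireg 15 = l ∧ s'.ireg 16 = 3 * N + 3 + 2 * (P * E + l) ∧
      (∀ x < 3 * N + 3, s'.imem x = s5.imem x) ∧
      ∀ l' < D, BlocksOK (Agree T (l' + 1))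
        (fun p => s'.imem (3 * N + 3 + 2 * (p * E + l')))
        (fun p => s'.imem (3 * N + 3 + 2 * (p * E + l') + 1)) (if l' < l then P + 1 else P))
      D 12 le_rfl ?_ ?_ ?_ ?_
    · refine ⟨g15, g16, fun _ _ => rfl, fun l' hl' => ?_⟩
      have := h.blocks l' hl'
      rw [← hE] at this
      simp only [Nat.not_lt_zero, if_false]
      convert this using 2 with p p
      · exact hold _ (by omega)
      · exact hold _ (by omega)
    · rintro l s' hf hl ⟨q1, -⟩
      simp only [Test.holds, q1, (c5.frame hf rfl).r3, ← hD]
    · rintro l s' hf hl ⟨q1, q2, q3, q4⟩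
      have hb := q4 l hl
      rw [if_neg (lt_irrefl _)] at hb
      refine (tableLevel_spec (S := S) (inp := inp) (c5.frame hf rfl) E D N l lcp P (3 * N + 3)
        hD hE T hT (by rw [hf.i 14 rfl, hf5.i 14 rfl, e14]) q1 q2 (by rw [hf.i 18 rfl, g18])
        (by rw [hf.i 31 rfl, hf5.i 31 rfl, e31]) (by rw [hf.i 35 rfl, hf5.i 35 rfl, e35])
        (by rw [hf.i 36 rfl, hf5.i 36 rfl, e36]) hl hP hS (fun l hl => hlcp l (by omega))
        hb).mono le_rfl ?_
      rintro s'' - ⟨p1, p2, p3, p4, p5⟩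
      refine ⟨p1, p2, fun x hx => by rw [p3 x hx, q3 x hx], fun l' hl' => ?_⟩
      rcases Nat.lt_trichotomy l' l with hh | rfl | hh
      · have := q4 l' hl'
        rw [if_pos hh] at this
        rw [if_pos (by omega)]
        convert this using 2 with p p
        · exact p4 l' (by omega) (by omega) p 0 (by omega)
        · exact p4 l' (by omega) (by omega) p 1 (by omega)
      · rw [if_pos (by omega)]
        exact p5
      · have := q4 l' hl'
        rw [if_neg (by omega)] at this
        rw [if_neg (by omega)]
        convert this using 2 with p p
        · exact p4 l' (by omega) (by omega) p 0 (by omega)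
        · exact p4 l' (by omega) (by omega) p 1 (by omega)
    · rintro s' hf ⟨-, -, q3, q4⟩
      refine ⟨q3, fun l hl => ?_⟩
      have := q4 l hl
      rwa [if_pos hl] at this
  · rintro s6 hf6 ⟨q1, q2⟩
    have c6 := c5.frame hf6 rfl
    have j31 : s6.ireg 31 = P := by rw [hf6.i 31 rfl, hf5.i 31 rfl, e31]
    have e3 : N ≤ N * E := Nat.le_mul_of_pos_right _ (by omega)
    refine Runs.block (by simp) ?_
    simp only [wps, Instr.wp, IntOp.eval, c6.r20, j31]
    refine ⟨by omega, by simp, ?_, ?_, ?_, ?_, ?_⟩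
    · intro x hx
      rw [q1 x (by omega), hold x (by omega)]
    · rw [q1 _ (by omega), hold _ (by omega), h.count_zero]
    · intro p hp hn
      rw [q1 _ (by omega), q1 _ (by omega), hold (2 * N + 2 + p) (by omega)]
      rcases Nat.lt_succ_iff_lt_or_eq.1 hp with hp | rfl
      · rw [hold _ (by omega), h.count_new p hp hn]
      · rw [gim, Function.update_self, e17 (by rwa [hE])]
    · intro p hp hn
      rw [q1 _ (by omega), q1 _ (by omega), hold (2 * N + 2 + p) (by omega)]
      rcases Nat.lt_succ_iff_lt_or_eq.1 hp with hp | rfl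
      · rw [hold _ (by omega), h.count_old p hp hn]
      · rw [gim, Function.update_self, e17' (by rwa [hE])]
    · rw [← hE]
      exact q2

/-- The integer memory is divided as follows: the header in the cells 0 and 1, the sorted order from
2 on, the merge buffer from N + 2 on, N + 1 prefix counts from 2N + 2 on, and the blocks from 3N + 3
on. The header and the side in real cell 0 are written last. -/
def buildTables : Cmd :=
  .seq (block [.intOp .mul 34 7 21, .intOp .add 34 34 21, .intOp .add 35 34 7,
      .intOp .add 35 35 20, .intOp .mul 36 4 21, .intStore 34 24, .intConst 31 0])
    (.seq (.while (.intLt 31 7) tableStep)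
      (block [.intStore 24 7, .intStore 20 3, .realStore 24 3]))

/-- The memories hold the data structure for `N` rows of `D + 1` entries. -/
structure IsIndex (s : State) (D N : ℕ) (sd : ℝ) : Prop where
  size : s.imem 0 = N
  dim : s.imem 1 = D
  side : s.rmem 0 = sd
  lt : ∀ x < N, s.imem (x + 2) < N
  sorted : SortedTable (tableRow s (D + 1)) (D + 1) N
  tables : TablesOK (tableRow s (D + 1)) s.imem D N N

theorem Agree.congr {T T' : ℕ → ℕ → ℝ} {l a b : ℕ} (ha : ∀ j, T a j = T' a j)
    (hb : ∀ j, T b j = T' b j) : Agree T l a b ↔ Agree T' l a b := by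
  simp only [Agree, ha, hb]

theorem SortedTable.congr {T T' : ℕ → ℕ → ℝ} {E N : ℕ} (hT : ∀ c < N, ∀ j, T c j = T' c j)
    (h : SortedTable T E N) : SortedTable T' E N := by
  intro a b hab hb j hj hag
  rw [← hT a (by omega), ← hT b hb]
  exact h a b hab hb j hj ((Agree.congr (hT a (by omega)) (hT b hb)).2 hag)

/-- For writing the header: the tables live in cells from 2 on, and only the first N rows matter. -/
theorem TablesOK.congr {T T' : ℕ → ℕ → ℝ} {imem imem' : ℕ → ℕ} {D N : ℕ}
    (hT : ∀ c < N, ∀ j, T c j = T' c j) (hi : ∀ x ≥ 2, imem' x = imem x)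
    (h : TablesOK T imem D N N) : TablesOK T' imem' D N N := by
  have hnew : ∀ p < N, IsNew T' (D + 1) p ↔ IsNew T (D + 1) p := fun p hp => by
    simp only [IsNew, Agree.congr (hT (p - 1) (by omega)) (hT p hp)]
  refine ⟨?_, ?_, ?_, ?_⟩
  · rw [hi _ (by omega), h.count_zero]
  · intro p hp hn
    rw [hi _ (by omega), hi _ (by omega), h.count_new p hp ((hnew p hp).1 hn)]
  · intro p hp hn
    rw [hi _ (by omega), hi _ (by omega), h.count_old p hp (fun hh => hn ((hnew p hp).2 hh))]
  · intro l hl p hp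
    obtain ⟨h1, h2, h3, h4⟩ := h.blocks l hl p hp
    simp only [hi _ (show 3 * N + 3 + 2 * (p * (D + 1) + l) ≥ 2 by omega)]
    simp only [hi _ (show 3 * N + 3 + 2 * (imem (3 * N + 3 + 2 * (p * (D + 1) + l)) * (D + 1) + l)
      + 1 ≥ 2 by omega)]
    refine ⟨h1, h2, h3, fun c hc => ?_⟩
    rw [h4 c hc, Agree.congr (hT c hc) (hT p hp)]

theorem buildTables_spec {s : State} (hc : Consts n m d K s) (E D N : ℕ) (sd : ℝ)
    (hD : D = m * d) (hE : E = D + 1) (h7 : s.ireg 7 = N) (h3 : s.rreg 3 = sd)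
    (hT : SortedTable (tableRow s E) E N) (hσ : ∀ x < N, s.imem (x + 2) < N)
    (hS : 3 * N + 3 + 2 * (N * E) + 2 * E + 2 ≤ S) :
    Runs S inp buildTables s (N * (8 * E + 13 * D + 28) + 11) fun s' =>
      IsIndex s' D N sd ∧ (∀ x ≥ 1, s'.rmem x = s.rmem x) ∧
      ∀ x < N, s'.imem (x + 2) = s.imem (x + 2) := by
  refine Runs.seq 7 (N * (8 * E + 13 * D + 28) + 4) (by omega) (Q := fun s' =>
    s'.ireg 34 = 2 * N + 2 ∧ s'.ireg 35 = 3 * N + 3 ∧ s'.ireg 36 = 2 * E ∧ s'.ireg 31 = 0 ∧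
    s'.imem = Function.update s.imem (2 * N + 2) 0) ?_ ?_
  · refine Runs.block (by simp) ?_
    simp [wps, Instr.wp, IntOp.eval, hc.r20, hc.r21, hc.r4, hc.r24, h7, ← hD, ← hE, mul_comm N 2,
      mul_comm E 2]
    omega
  rintro s1 hf1 ⟨g34, g35, g36, g31, gim⟩
  have c1 := hc.frame hf1 rfl
  have a7 : s1.ireg 7 = N := by rw [hf1.i 7 rfl, h7]
  have arm : s1.rmem = s.rmem := hf1.rm rfl
  refine Runs.seq (N * (8 * E + 13 * D + 28) + 1) 3 (by omega) (Q := fun s' =>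
    (∀ x < 2 * N + 2, s'.imem x = s.imem x) ∧ TablesOK (tableRow s E) s'.imem D N N) ?_ ?_
  · refine Runs.for (fun P s' => s'.ireg 31 = P ∧ (∀ x < 2 * N + 2, s'.imem x = s.imem x) ∧
      TablesOK (tableRow s E) s'.imem D N P) N (8 * E + 13 * D + 27) le_rfl ?_ ?_ ?_ ?_
    · refine ⟨g31, fun x hx => by rw [gim, Function.update_of_ne (by omega)], ?_, by simp, by simp,
        fun l hl p hp => by omega⟩
      rw [gim, Function.update_self]
    · rintro P s' hf hP ⟨q1, -⟩
      simp only [Test.holds, q1, hf.i 7 rfl, a7]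
    · rintro P s' hf hP ⟨q1, q2, q3⟩
      have hfr : s'.rmem = s.rmem := by rw [hf.rm rfl, arm]
      refine (tableStep_spec (S := S) (inp := inp) (c1.frame hf rfl) E D N P hD hE (tableRow s E)
        (fun c hc j => by rw [hfr, q2 _ (by omega), tableRow]) hT
        (fun x hx => by rw [q2 _ (by omega)]; exact hσ x hx) q1 (by rw [hf.i 34 rfl, g34])
        (by rw [hf.i 35 rfl, g35]) (by rw [hf.i 36 rfl, g36]) hP (by omega) q3).mono le_rfl ?_
      rintro s'' - ⟨p1, p2, p3⟩
      exact ⟨p1, fun x hx => by rw [p2 x hx, q2 x hx], p3⟩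
    · rintro s' hf ⟨-, q2, q3⟩
      exact ⟨q2, q3⟩
  · rintro s2 hf2 ⟨q1, q2⟩
    have c2 := c1.frame hf2 rfl
    have b7 : s2.ireg 7 = N := by rw [hf2.i 7 rfl, a7]
    have b3 : s2.rreg 3 = sd := by rw [hf2.r 3 rfl, hf1.r 3 rfl, h3]
    have brm : s2.rmem = s.rmem := by rw [hf2.rm rfl, arm]
    refine Runs.block (by simp) ?_
    simp only [wps, Instr.wp, c2.r20, c2.r24, c2.r3, ← hD, b7, b3, brm]
    have key : ∀ c < N, ∀ j, tableRow s E c j = Function.update s.rmem 0 sd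
        (1 + Function.update (Function.update s2.imem 0 N) 1 D (c + 2) * (D + 1) + j) := by
      intro c hc j
      rw [Function.update_of_ne (by omega), Function.update_of_ne (by omega),
        Function.update_of_ne (by omega), q1 _ (by omega), tableRow, hE]
    have him : ∀ x ≥ 2, Function.update (Function.update s2.imem 0 N) 1 D x = s2.imem x := by
      intro x hx
      rw [Function.update_of_ne (by omega), Function.update_of_ne (by omega)]
    refine ⟨by omega, by omega, by omega, ⟨by simp, by simp, by simp, ?_, ?_, ?_⟩, ?_, ?_⟩
    · intro x hx
      simp only [him (x + 2) (by omega), q1 (x + 2) (by omega)]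
      exact hσ x hx
    · rw [← hE]
      refine hT.congr fun c hc j => ?_
      rw [key c hc j, hE]
      rfl
    · refine TablesOK.congr (fun c hc j => ?_) him q2
      rw [key c hc j]
      rfl
    · intro x hx
      rw [Function.update_of_ne (by omega)]
    · intro x hx
      simp only [him (x + 2) (by omega), q1 (x + 2) (by omega)]

end

/-! ### The query -/

/-- One coordinate of the middle row is compared with the rounded query. If it differs, half of the
interval is discarded. If it agrees, the interval is replaced by the block of rows sharing one more
coordinate with the middle row, read from the tables in constant time. An empty interval ends the
search. -/
def queryStep : Cmd :=
  .ite (.intLt 26 28)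
    (.seq (block [.intOp .add 27 26 28, .intOp .div 27 27 21, .intOp .add 19 27 21, .intLoad 12 19,
        .intOp .mul 16 12 4, .intOp .add 16 16 14, .intOp .add 16 16 20, .realLoad 8 16,
        .input 6 14, .realOp .div 6 6 3, .floor 6 6])
      (.ite (.realLt 6 8) (block [.intOp .add 28 27 24])
        (.ite (.realLt 8 6) (block [.intOp .add 26 27 20])
          (block [.intOp .mul 19 27 4, .intOp .add 19 19 14, .intOp .mul 19 19 21,
            .intOp .add 19 19 35, .intLoad 26 19, .intOp .mul 19 26 4, .intOp .add 19 19 14,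
            .intOp .mul 19 19 21, .intOp .add 19 19 35, .intOp .add 19 19 20, .intLoad 28 19,
            .intOp .add 14 14 20]))))
    (block [.intOp .add 14 3 24])

def query : Cmd :=
  .seq (block [.intConst 20 1, .intConst 21 2, .intConst 24 0, .intLoad 7 24, .intLoad 3 20,
      .intOp .add 4 3 20, .realLoad 3 24, .intOp .mul 34 7 21, .intOp .add 34 34 21,
      .intOp .add 35 34 7, .intOp .add 35 35 20, .intConst 26 0, .intOp .add 28 7 24,
      .intConst 14 0])
    (.seq (.while (.intLt 14 3) queryStep)
      (block [.intOp .add 19 34 28, .intLoad 0 19, .intOp .add 19 34 26, .intLoad 1 19,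
        .intOp .sub 0 0 1]))

section

variable {S : ℕ} {inp : ℕ → ℝ}

/-- The state of the search: the rows that match in one more coordinate are in `[lo, hi)`, and the
rows in `[lo, hi)` match in the first `l` coordinates. -/
structure SearchOK (T : ℕ → ℕ → ℝ) (g : ℕ → ℝ) (D N l lo hi : ℕ) : Prop where
  l_le : l ≤ D
  lo_le : lo ≤ hi
  hi_le : hi ≤ N
  agree : ∀ c, lo ≤ c → c < hi → ∀ j < l, T c j = g j
  mem : ∀ c < N, (∀ j < l + 1, j < D → T c j = g j) → lo ≤ c ∧ c < hi

theorem queryStep_spec {s : State} (T : ℕ → ℕ → ℝ) (g : ℕ → ℝ) (D N E l lo hi : ℕ) (sd : ℝ)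
    (hE : E = D + 1) (hI : IsIndex s D N sd) (hT : T = tableRow s E)
    (hg : ∀ l, g l = ⌊inp l / sd⌋) (h : SearchOK T g D N l lo hi)
    (h3 : s.ireg 3 = D) (h4 : s.ireg 4 = E) (h14 : s.ireg 14 = l) (h20 : s.ireg 20 = 1)
    (h21 : s.ireg 21 = 2) (h24 : s.ireg 24 = 0) (h26 : s.ireg 26 = lo) (h28 : s.ireg 28 = hi)
    (h35 : s.ireg 35 = 3 * N + 3) (hs : s.rreg 3 = sd) (hl : l < D)
    (hS : 3 * N + 3 + 2 * (N * E) + 2 * E + 2 ≤ S) :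
    Runs S inp queryStep s 26 fun s' => ∃ l' lo' hi', s'.ireg 14 = l' ∧ s'.ireg 26 = lo' ∧
      s'.ireg 28 = hi' ∧ SearchOK T g D N l' lo' hi' ∧
      ((l < l' ∧ hi' - lo' ≤ hi - lo) ∨ (l = l' ∧ lo < hi ∧ 2 * (hi' - lo') ≤ hi - lo)) := by
  have hsort : SortedTable T E N := by rw [hT, hE]; exact hI.sorted
  have htab : TablesOK T s.imem D N N := by rw [hT, hE]; exact hI.tables
  have h_lo := h.lo_le
  have h_hi := h.hi_le
  refine Runs.ite 25 (by omega) (fun ht => ?_) (fun ht => ?_)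
  · simp only [Test.holds, h26, h28] at ht
    set mid := (lo + hi) / 2 with hmid
    have hmN : mid < N := by omega
    have eM : mid * E + E ≤ N * E := by rw [← Nat.succ_mul]; exact Nat.mul_le_mul_right _ hmN
    have eI : s.imem (mid + 2) * E + E ≤ N * E := by
      rw [← Nat.succ_mul]; exact Nat.mul_le_mul_right _ (hI.lt _ hmN)
    refine Runs.seq 11 14 (by omega) (Q := fun s' => s'.ireg 27 = mid ∧ s'.rreg 8 = T mid l ∧
      s'.rreg 6 = g l) ?_ ?_
    · refine Runs.block (by simp) ?_
      simp [wps, Instr.wp, IntOp.eval, RealOp.eval, h26, h28, h21, h20, h14, h4, hs, ← hmid, hg, hT,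
        tableRow, show s.imem (mid + 2) * E + l + 1 = 1 + s.imem (mid + 2) * E + l by omega]
      omega
    rintro s1 hf1 ⟨a27, a8, a6⟩
    have aim : s1.imem = s.imem := hf1.im rfl
    have a3 : s1.ireg 3 = D := by rw [hf1.i 3 rfl, h3]
    have a4 : s1.ireg 4 = E := by rw [hf1.i 4 rfl, h4]
    have a14 : s1.ireg 14 = l := by rw [hf1.i 14 rfl, h14]
    have a20 : s1.ireg 20 = 1 := by rw [hf1.i 20 rfl, h20]
    have a21 : s1.ireg 21 = 2 := by rw [hf1.i 21 rfl, h21]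
    have a24 : s1.ireg 24 = 0 := by rw [hf1.i 24 rfl, h24]
    have a26 : s1.ireg 26 = lo := by rw [hf1.i 26 rfl, h26]
    have a28 : s1.ireg 28 = hi := by rw [hf1.i 28 rfl, h28]
    have a35 : s1.ireg 35 = 3 * N + 3 := by rw [hf1.i 35 rfl, h35]
    have hmag : ∀ j < l, T mid j = g j := h.agree mid (by omega) (by omega)
    refine Runs.ite 13 (by omega) (fun hlt => ?_) (fun hlt => ?_)
    · simp only [Test.holds, a8, a6] at hlt
      refine Runs.block (by simp) ?_
      simp only [wps, Instr.wp, IntOp.eval, a27, a24]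
      refine ⟨by omega, l, lo, mid, by simp [a14], by simp [a26], by simp,
        ⟨h.l_le, by omega, by omega, fun c h1 h2 => h.agree c h1 (by omega), fun c hc hm => ?_⟩,
        Or.inr ⟨rfl, ht, by omega⟩⟩
      refine ⟨(h.mem c hc hm).1, ?_⟩
      -- A matching row beyond the middle one agrees with it in the first l coordinates, so by
      -- sortedness its coordinate l could not be smaller.
      by_contra hge
      have := hsort mid c (by omega) hc l (by omega) fun j hj => by
        rw [hmag j hj, hm j (by omega) (by omega)]
      rw [hm l (by omega) hl] at this
      exact absurd hlt (not_lt.2 this)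
    refine Runs.ite 12 (by omega) (fun hgt => ?_) (fun hgt => ?_)
    · simp only [Test.holds, a8, a6] at hgt
      refine Runs.block (by simp) ?_
      simp only [wps, Instr.wp, IntOp.eval, a27, a20]
      refine ⟨by omega, l, mid + 1, hi, by simp [a14], by simp, by simp [a28],
        ⟨h.l_le, by omega, by omega, fun c h1 h2 => h.agree c (by omega) h2, fun c hc hm => ?_⟩,
        Or.inr ⟨rfl, ht, by omega⟩⟩
      refine ⟨?_, (h.mem c hc hm).2⟩
      by_contra hge
      have := hsort c mid (by omega) hmN l (by omega) fun j hj => by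
        rw [hmag j hj, hm j (by omega) (by omega)]
      rw [hm l (by omega) hl] at this
      exact absurd hgt (not_lt.2 this)
    · simp only [Test.holds, a8, a6] at hlt hgt
      have heq : T mid l = g l := le_antisymm (not_lt.1 hlt) (not_lt.1 hgt)
      have hmag' : ∀ j < l + 1, T mid j = g j := fun j hj => by
        rcases Nat.lt_succ_iff_lt_or_eq.1 hj with hj | rfl
        · exact hmag j hj
        · exact heq
      obtain ⟨b1, b2, b3, b4⟩ := htab.blocks l hl mid hmN
      beta_reduce at b1 b2 b3 b4
      rw [← hE] at b1 b2 b3 b4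
      set lo' := s.imem (3 * N + 3 + 2 * (mid * E + l)) with hlo'
      set hi' := s.imem (3 * N + 3 + 2 * (lo' * E + l) + 1) with hhi'
      have eL : lo' * E + E ≤ N * E := by
        rw [← Nat.succ_mul]; exact Nat.mul_le_mul_right _ (by omega)
      have hmatch : ∀ c, lo' ≤ c → c < hi' → ∀ j < l + 1, T c j = g j := fun c h1 h2 j hj => by
        rw [← hmag' j hj]
        exact (b4 c (by omega)).1 ⟨h1, h2⟩ j hj
      -- The first and the last row of the block match in l + 1 coordinates and hence lie in the old
      -- interval; so the interval does not grow when l advances.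
      have m1 := h.mem lo' (by omega) fun j hj _ => hmatch lo' le_rfl (by omega) j hj
      have m2 := h.mem (hi' - 1) (by omega) fun j hj _ =>
        hmatch (hi' - 1) (by omega) (by omega) j hj
      have x1 : (mid * E + l) * 2 + (3 * N + 3) = 3 * N + 3 + 2 * (mid * E + l) := by ring
      have x2 : (lo' * E + l) * 2 + (3 * N + 3) + 1 = 3 * N + 3 + 2 * (lo' * E + l) + 1 := by ring
      have x3 : N ≤ N * E := Nat.le_mul_of_pos_right _ (by omega)
      refine Runs.block (by simp) ?_
      simp only [wps, Instr.wp, IntOp.eval]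
      simp [a27, a4, a14, a20, a21, a35, aim, x1, ← hlo', x2, ← hhi']
      refine ⟨by omega, by omega, by omega, by omega, by omega, by omega, by omega, by omega,
        by omega, by omega, by omega, by omega,
        ⟨by omega, by omega, b3, fun c h1 h2 => hmatch c h1 h2, fun c hc hm => ?_⟩, by omega⟩
      refine (b4 c hc).2 fun j hj => ?_
      rw [hmag' j hj, hm j (by omega) (by omega)]
  · simp only [Test.holds, h26, h28] at ht
    refine Runs.block (by simp) ?_
    simp only [wps, Instr.wp, IntOp.eval, h3, h24]
    refine ⟨by omega, D, lo, hi, by simp, by simp [h26], by simp [h28],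
      ⟨le_rfl, h.lo_le, h.hi_le, fun c h1 h2 => by omega,
        fun c hc hm => h.mem c hc fun j hj hjD => hm j (by omega) hjD⟩, Or.inl ⟨hl, le_rfl⟩⟩

theorem query_spec {s : State} (D N L : ℕ) (sd : ℝ) (hI : IsIndex s D N sd) (hN : N ≤ 2 ^ L)
    (hS : 3 * N + 3 + 2 * (N * (D + 1)) + 2 * (D + 1) + 2 ≤ S) :
    Runs S inp query s (27 * (D + L + 1) + 20) fun s' => s'.imem = s.imem ∧ s'.rmem = s.rmem ∧
      ∃ lo hi, lo ≤ hi ∧ hi ≤ N ∧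
        (∀ c < N, (lo ≤ c ∧ c < hi) ↔ ∀ j < D, tableRow s (D + 1) c j = ⌊inp j / sd⌋) ∧
        s'.ireg 0 = s.imem (2 * N + 2 + hi) - s.imem (2 * N + 2 + lo) := by
  refine (Runs.mono (T := 27 * (D + L + 1) + 20) (P := fun s' => ∃ lo hi, lo ≤ hi ∧ hi ≤ N ∧
        (∀ c < N, (lo ≤ c ∧ c < hi) ↔ ∀ j < D, tableRow s (D + 1) c j = ⌊inp j / sd⌋) ∧
        s'.ireg 0 = s.imem (2 * N + 2 + hi) - s.imem (2 * N + 2 + lo)) ?_ le_rfl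
        fun s' hf h => ⟨hf.im rfl, hf.rm rfl, h⟩)
  refine Runs.seq 14 (27 * (D + L + 1) + 6) (by omega) (Q := fun s' => s'.ireg 3 = D ∧
    s'.ireg 4 = D + 1 ∧ s'.ireg 14 = 0 ∧ s'.ireg 20 = 1 ∧ s'.ireg 21 = 2 ∧ s'.ireg 24 = 0 ∧
    s'.ireg 26 = 0 ∧ s'.ireg 28 = N ∧ s'.ireg 34 = 2 * N + 2 ∧ s'.ireg 35 = 3 * N + 3 ∧
    s'.rreg 3 = sd) ?_ ?_
  · refine Runs.block (by simp) ?_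
    simp [wps, Instr.wp, IntOp.eval, hI.size, hI.dim, hI.side, mul_comm N 2]
    omega
  rintro s1 hf1 ⟨a3, a4, a14, a20, a21, a24, a26, a28, a34, a35, as⟩
  have aim : s1.imem = s.imem := hf1.im rfl
  have arm : s1.rmem = s.rmem := hf1.rm rfl
  set T := tableRow s (D + 1) with hT
  refine Runs.seq ((D + L + 1) * 27 + 1) 5 (by omega) (Q := fun s' => ∃ lo hi,
    s'.ireg 26 = lo ∧ s'.ireg 28 = hi ∧ SearchOK T (fun j => ⌊inp j / sd⌋) D N D lo hi) ?_ ?_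
  -- The potential k is the number D − l of open coordinates plus a bound j on the binary length of
  -- the interval. Each step lowers one of the two without raising the other, except for the jump to
  -- D on an empty interval; there j is raised so that k still drops by exactly one.
  · refine Runs.while (fun k s' => ∃ l lo hi j, s'.ireg 14 = l ∧ s'.ireg 26 = lo ∧
      s'.ireg 28 = hi ∧ SearchOK T (fun j => ⌊inp j / sd⌋) D N l lo hi ∧ k + l = D + j ∧
      hi - lo < 2 ^ j) (D + L + 1) 26 (by omega) ?_ ?_ ?_
    · refine ⟨0, 0, N, L + 1, a14, a26, a28, ⟨by omega, by omega, le_rfl, by simp, fun c hc _ =>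
        ⟨by omega, hc⟩⟩, by omega, ?_⟩
      rw [pow_succ]
      have := Nat.one_le_two_pow (n := L)
      omega
    · rintro k s' hf ⟨l, lo, hi, j, k14, k26, k28, hk, hkj, hj⟩ ht
      simp only [Test.holds, k14, hf.i 3 rfl, a3] at ht
      have kim : s'.imem = s.imem := by rw [hf.im rfl, aim]
      have krm : s'.rmem = s.rmem := by rw [hf.rm rfl, arm]
      have hT' : tableRow s' = tableRow s := by
        funext a b c
        simp only [tableRow, kim, krm]
      have hI' : IsIndex s' D N sd := by
        obtain ⟨i1, i2, i3, i4, i5, i6⟩ := hI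
        refine ⟨by rwa [kim], by rwa [kim], by rwa [krm], by rwa [kim], by rwa [hT'], ?_⟩
        rwa [hT', kim]
      have hrun := queryStep_spec (S := S) (inp := inp) T (fun j => ⌊inp j / sd⌋) D N (D + 1) l lo
        hi sd rfl hI' (by rw [hT, hT']) (fun _ => rfl) hk (by rw [hf.i 3 rfl, a3])
        (by rw [hf.i 4 rfl, a4]) k14 (by rw [hf.i 20 rfl, a20]) (by rw [hf.i 21 rfl, a21])
        (by rw [hf.i 24 rfl, a24]) k26 k28 (by rw [hf.i 35 rfl, a35]) (by rw [hf.r 3 rfl, as])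
        ht (by omega)
      refine ⟨k - 1, by omega, hrun.mono le_rfl ?_⟩
      rintro s'' - ⟨l', lo', hi', p14, p26, p28, hp, hor⟩
      have hk' := hp.l_le
      rcases hor with ⟨h1, h2⟩ | ⟨rfl, h1, h2⟩
      · exact ⟨l', lo', hi', j + (l' - l - 1), p14, p26, p28, hp, by omega, lt_of_lt_of_le (lt_of_le_of_lt h2 hj)
          (Nat.pow_le_pow_right (by norm_num) (by omega))⟩
      · obtain _ | j := j
        · simp at hj
          omega
        · rw [pow_succ] at hj
          exact ⟨l, lo', hi', j, p14, p26, p28, hp, by omega, by omega⟩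
    · rintro k s' hf ⟨l, lo, hi, j, k14, k26, k28, hk, -, -⟩ ht
      simp only [Test.holds, k14, hf.i 3 rfl, a3] at ht
      have := hk.l_le
      obtain rfl : l = D := by omega
      exact ⟨lo, hi, k26, k28, hk⟩
  · rintro s2 hf2 ⟨lo, hi, b26, b28, hb⟩
    have h1 := hb.lo_le
    have h2 := hb.hi_le
    have b34 : s2.ireg 34 = 2 * N + 2 := by rw [hf2.i 34 rfl, a34]
    have bim : s2.imem = s.imem := by rw [hf2.im rfl, aim]
    have hc := hI.tables.count_le hi h2
    refine Runs.block (by simp) ?_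
    simp [wps, Instr.wp, IntOp.eval, b26, b28, b34, bim]
    refine ⟨by omega, by omega, by omega, by omega, by omega, lo, hi, h1, h2, ?_, rfl⟩
    intro c hc
    exact ⟨fun hh j hj => hb.agree c hh.1 hh.2 j hj, fun hh => hb.mem c hc fun j _ hj => hh j hj⟩

end

/-! ### The preprocessing -/

/-- The side of the grid. -/
noncomputable def side (m d : ℕ) (p ε r : ℝ) : ℝ :=
  ε * r / ((d : ℝ) ^ ((1 : ℝ) / 2) * 2 * (2 * m : ℝ) ^ (1 / p))

/-- The bound for the `p`-th powers of the costs. -/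
noncomputable def threshold (p ε r : ℝ) : ℝ := ((1 + ε / 2) * r) ^ p

/-- `codeBase` codes for every coordinate are enough for everything but the last digit. -/
def codeBase : ℕ := 9437184

/-- The number of codes. -/
def codeCount (n m d K : ℕ) : ℕ := n * (codeBase * K) ^ (m * d)

/-- Real numbers never become integers on this machine, so K = ⌈1/ε⌉ is found by counting up until
it reaches 1/ε. These K rounds are negligible compared with the number of codes. -/
def setup : Cmd :=
  .seq (block [.intConst 20 1, .intConst 21 2, .intConst 22 3, .intConst 23 4, .intConst 24 0,
      .intOp .mul 3 1 2, .intOp .add 4 3 20, .intConst 5 0, .ofInt 7 5, .ofInt 8 20,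
      .realOp .div 8 8 0])
    (.seq (.while (.realLt 7 8) (block [.intOp .add 5 5 20, .ofInt 7 5]))
      (.seq (block [.ofInt 8 21, .ofInt 9 20, .realOp .div 9 9 8, .ofInt 6 2,
          .realOp .pow 6 6 9, .realOp .mul 6 6 8, .ofInt 9 1, .realOp .mul 9 8 9, .ofInt 5 20,
          .realOp .div 5 5 2, .realOp .pow 9 9 5, .realOp .mul 6 6 9, .realOp .mul 3 0 1,
          .realOp .div 3 3 6])
        (.seq (block [.realOp .div 4 0 8, .ofInt 9 20, .realOp .add 4 9 4, .realOp .mul 4 4 1,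
            .realOp .pow 4 4 2, .realOp .div 10 2 8])
          (.seq (block [.intConst 15 codeBase, .intOp .mul 15 15 5, .intOp .add 6 0 24,
              .intConst 14 0])
            (.while (.intLt 14 3) (block [.intOp .mul 6 6 15, .intOp .add 14 14 20]))))))

section

variable {S : ℕ} {inp : ℕ → ℝ} {n m d : ℕ}

theorem setup_spec {s : State} (p ε r : ℝ) (K : ℕ) (hK : K = ⌈1 / ε⌉₊) (h0 : s.ireg 0 = n)
    (h1 : s.ireg 1 = m) (h2 : s.ireg 2 = d) (r0 : s.rreg 0 = ε) (r1 : s.rreg 1 = r)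
    (r2 : s.rreg 2 = p) (hn : 1 ≤ n) (hm : 1 ≤ m) (hd : 1 ≤ d) (hε : 0 < ε) (hr : 0 < r)
    (hS : 16 * codeCount n m d K * (m * d + 1) ≤ S) :
    Runs S inp setup s (K * 3 + m * d * 3 + 37) fun s' => Consts n m d K s' ∧
      s'.rreg 3 = side m d p ε r ∧ s'.rreg 4 = threshold p ε r ∧ s'.rreg 7 = K ∧
      s'.rreg 10 = p / 2 ∧ s'.ireg 6 = codeCount n m d K := by
  have hK1 : 1 ≤ K := by
    rw [hK, Nat.one_le_ceil_iff]
    positivity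
  have hD1 : 1 ≤ m * d := Nat.mul_pos hm hd
  have hBK : codeBase * K ≤ codeCount n m d K := by
    have h1 : codeBase * K ≤ (codeBase * K) ^ (m * d) := Nat.le_self_pow (by omega) _
    have h2 : (codeBase * K) ^ (m * d) ≤ n * (codeBase * K) ^ (m * d) := Nat.le_mul_of_pos_left _ hn
    exact h1.trans h2
  have hZn : n ≤ codeCount n m d K := Nat.le_mul_of_pos_right _ (by
    apply Nat.pow_pos; simp only [codeBase]; omega)
  have hZE : codeCount n m d K * (m * d + 1) = codeCount n m d K * (m * d) + codeCount n m d K := by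
    ring
  have hS' : 16 * codeCount n m d K * (m * d + 1) =
      16 * (codeCount n m d K * (m * d)) + 16 * codeCount n m d K := by ring
  have hZD : m * d ≤ codeCount n m d K * (m * d) := Nat.le_mul_of_pos_left _ (by omega)
  have hKB : K ≤ codeBase * K := Nat.le_mul_of_pos_left _ (by simp [codeBase])
  have hB : codeBase ≤ codeBase * K := Nat.le_mul_of_pos_right _ hK1
  refine Runs.seq 11 (K * 3 + m * d * 3 + 26) (by omega) (Q := fun s' => s'.ireg 20 = 1 ∧
    s'.ireg 21 = 2 ∧ s'.ireg 22 = 3 ∧ s'.ireg 23 = 4 ∧ s'.ireg 24 = 0 ∧ s'.ireg 3 = m * d ∧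
    s'.ireg 4 = m * d + 1 ∧ s'.ireg 5 = 0 ∧ s'.rreg 7 = 0 ∧ s'.rreg 8 = 1 / ε) ?_ ?_
  · refine Runs.block (by simp) ?_
    simp [wps, Instr.wp, IntOp.eval, RealOp.eval, h1, h2, r0]
    omega
  rintro s1 hf1 ⟨a20, a21, a22, a23, a24, a3, a4, a5, a7, a8⟩
  refine Runs.seq (K * 3 + 1) (m * d * 3 + 25) (by omega) (Q := fun s' => s'.ireg 5 = K ∧
    s'.rreg 7 = K) ?_ ?_
  · refine Runs.for (fun k s' => s'.ireg 5 = k ∧ s'.rreg 7 = k) K 2 le_rfl ?_ ?_ ?_ ?_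
    · exact ⟨a5, by simpa using a7⟩
    · rintro k s' hf hk ⟨q1, q2⟩
      simp only [Test.holds, q2, hf.r 8 rfl, a8]
      rw [hK, Nat.lt_ceil]
    · rintro k s' hf hk ⟨q1, q2⟩
      refine Runs.block (by simp) ?_
      simp [wps, Instr.wp, IntOp.eval, q1, hf.i 20 rfl, a20]
      omega
    · exact fun s' _ h => h
  rintro s2 hf2 ⟨b5, b7⟩
  have c2 : Consts n m d K s2 :=
    ⟨by rw [hf2.i 0 rfl, hf1.i 0 rfl, h0], by rw [hf2.i 1 rfl, hf1.i 1 rfl, h1],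
      by rw [hf2.i 2 rfl, hf1.i 2 rfl, h2], by rw [hf2.i 3 rfl, a3], by rw [hf2.i 4 rfl, a4], b5,
      by rw [hf2.i 20 rfl, a20], by rw [hf2.i 21 rfl, a21], by rw [hf2.i 22 rfl, a22],
      by rw [hf2.i 23 rfl, a23], by rw [hf2.i 24 rfl, a24]⟩
  have b0 : s2.rreg 0 = ε := by rw [hf2.r 0 rfl, hf1.r 0 rfl, r0]
  have b1 : s2.rreg 1 = r := by rw [hf2.r 1 rfl, hf1.r 1 rfl, r1]
  have b2 : s2.rreg 2 = p := by rw [hf2.r 2 rfl, hf1.r 2 rfl, r2]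
  have hmax : max (2 * (m : ℝ)) 0 = 2 * m := max_eq_left (by positivity)
  have hmaxd : max (d : ℝ) 0 = d := max_eq_left (by positivity)
  refine Runs.seq 14 (m * d * 3 + 11) (by omega) (Q := fun s' => s'.rreg 3 = side m d p ε r ∧
    s'.rreg 8 = 2) ?_ ?_
  · refine Runs.block (by simp) ?_
    simp [wps, Instr.wp, RealOp.eval, c2.r21, c2.r20, c2.r2, c2.r1, b0, b1, b2, side]
  rintro s3 hf3 ⟨d3, d8⟩
  have c3 := c2.frame hf3 rfl
  have d0 : s3.rreg 0 = ε := by rw [hf3.r 0 rfl, b0]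
  have d1 : s3.rreg 1 = r := by rw [hf3.r 1 rfl, b1]
  have d2 : s3.rreg 2 = p := by rw [hf3.r 2 rfl, b2]
  have hmaxt : max ((1 + ε / 2) * r) 0 = (1 + ε / 2) * r := max_eq_left (by positivity)
  refine Runs.seq 6 (m * d * 3 + 5) (by omega) (Q := fun s' => s'.rreg 4 = threshold p ε r ∧
    s'.rreg 10 = p / 2) ?_ ?_
  · refine Runs.block (by simp) ?_
    simp [wps, Instr.wp, RealOp.eval, c3.r20, d0, d1, d2, d8, threshold, hmaxt]
  rintro s4 hf4 ⟨e4, e10⟩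
  have c4 := c3.frame hf4 rfl
  refine Runs.seq 4 (m * d * 3 + 1) (by omega) (Q := fun s' => s'.ireg 15 = codeBase * K ∧
    s'.ireg 6 = n ∧ s'.ireg 14 = 0) ?_ ?_
  · refine Runs.block (by simp) ?_
    simp [wps, Instr.wp, IntOp.eval, c4.r5, c4.r24, c4.r0]
    omega
  rintro s5 hf5 ⟨g15, g6, g14⟩
  have c5 := c4.frame hf5 rfl
  refine Runs.for (fun t s' => s'.ireg 14 = t ∧ s'.ireg 6 = n * (codeBase * K) ^ t) (m * d) 2 le_rfl
    ?_ ?_ ?_ ?_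
  · exact ⟨g14, by simpa using g6⟩
  · rintro t s' hf ht ⟨q1, -⟩
    simp only [Test.holds, q1, (c5.frame hf rfl).r3]
  · rintro t s' hf ht ⟨q1, q2⟩
    have e1 : n * (codeBase * K) ^ t * (codeBase * K) = n * (codeBase * K) ^ (t + 1) := by ring
    have e2 : n * (codeBase * K) ^ (t + 1) ≤ codeCount n m d K :=
      Nat.mul_le_mul_left _ (Nat.pow_le_pow_right (Nat.mul_pos (by simp [codeBase]) hK1) (by omega))
    refine Runs.block (by simp) ?_
    simp only [wps, Instr.wp, IntOp.eval, q2, hf.i 15 rfl, g15, e1]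
    refine ⟨e2.trans (by omega), ?_⟩
    simp [q1, (c5.frame hf rfl).r20]
    omega
  · rintro s' hf ⟨-, q2⟩
    have c' := c5.frame hf rfl
    exact ⟨c', by rw [hf.r 3 rfl, hf5.r 3 rfl, hf4.r 3 rfl, d3],
      by rw [hf.r 4 rfl, hf5.r 4 rfl, e4],
      by rw [hf.r 7 rfl, hf5.r 7 rfl, hf4.r 7 rfl, hf3.r 7 rfl, b7],
      by rw [hf.r 10 rfl, hf5.r 10 rfl, e10], q2⟩

def prep : Cmd := .seq setup (.seq enumerate (.seq mergeSort buildTables))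

/-- The sorted row `c` is the one that belongs to the code `z`. -/
def TableRowIs (inp : ℕ → ℝ) (n m d K : ℕ) (sd : ℝ) (s : State) (c z : ℕ) : Prop :=
  (∀ l < m * d, tableRow s (m * d + 1) c l =
    guessRow K d sd (inputPoint inp m d (z % n)) (z / n) l) ∧
  tableRow s (m * d + 1) c (m * d) = (z % n : ℕ)

/-- The time bound for the preprocessing, for at most `Z ≤ 2 ^ L` codes. -/
def prepTime (m d K Z L : ℕ) : ℕ :=
  (K * 3 + m * d * 3 + 37) + (Z * (m * d * (15 * L + 39) + 2 * m * (10 * d + 20) + 21) + 3) +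
    (L * (Z * (8 * (m * d + 1) + 45) + 6) + Z * 4 + 5) +
    (Z * (8 * (m * d + 1) + 13 * (m * d) + 28) + 11)

theorem prep_spec {s : State} (p ε r : ℝ) (K Z L : ℕ) (hK : K = ⌈1 / ε⌉₊)
    (hZ : Z = codeCount n m d K) (hZL : Z ≤ 2 ^ L) (h0 : s.ireg 0 = n)
    (h1 : s.ireg 1 = m) (h2 : s.ireg 2 = d) (r0 : s.rreg 0 = ε) (r1 : s.rreg 1 = r)
    (r2 : s.rreg 2 = p) (hn : 1 ≤ n) (hm : 1 ≤ m) (hd : 1 ≤ d) (hε : 0 < ε) (hr : 0 < r)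
    (hS : 16 * Z * (m * d + 1) ≤ S) :
    Runs S inp prep s (prepTime m d K Z L) fun s' => ∃ N ≤ Z, IsIndex s' (m * d) N (side m d p ε r) ∧
      (∀ c < N, ∃ z < Z, Emits inp n m d K (side m d p ε r) (p / 2) (threshold p ε r) z ∧
        TableRowIs inp n m d K (side m d p ε r) s' c z) ∧
      ∀ z < Z, Emits inp n m d K (side m d p ε r) (p / 2) (threshold p ε r) z →
        ∃ c < N, TableRowIs inp n m d K (side m d p ε r) s' c z := by
  set D := m * d with hD
  set sd := side m d p ε r with hsd
  have hK1 : 1 ≤ K := by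
    rw [hK, Nat.one_le_ceil_iff]
    positivity
  have hD1 : 1 ≤ D := Nat.mul_pos hm hd
  have hZn : n ≤ Z := hZ ▸ Nat.le_mul_of_pos_right _ (by
    apply Nat.pow_pos; simp only [codeBase]; omega)
  have hdD : d ≤ D := Nat.le_mul_of_pos_left _ hm
  have hS' : 16 * Z * (D + 1) = 16 * (Z * D) + 16 * Z := by ring
  have hZD : D ≤ Z * D := Nat.le_mul_of_pos_left _ (by omega)
  have hZE : Z * (D + 1) = Z * D + Z := by ring
  have hnD : n * m * d ≤ Z * D := by
    rw [Nat.mul_assoc]; exact Nat.mul_le_mul_right _ hZn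
  have hZd : Z * d ≤ Z * D := Nat.mul_le_mul_left _ hdD
  have hnmz : (n * m + Z) * d = n * m * d + Z * d := by ring
  unfold prepTime
  simp only [Nat.add_assoc (K * 3 + m * d * 3 + 37)]
  refine Runs.seq _ _ le_rfl (setup_spec (S := S) (inp := inp) p ε r K hK h0 h1 h2 r0 r1 r2 hn hm
    hd hε hr (hZ ▸ hS)) ?_
  rintro s1 hf1 ⟨c1, a3, a4, a7, a10, a6⟩
  rw [← hZ] at a6
  rw [Nat.add_assoc (_ + 3)]
  refine Runs.seq _ _ le_rfl (enumerate_spec (S := S) (inp := inp) c1 sd (p / 2) (threshold p ε r) Z L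
    a3 a4 a7 a10 a6 hZL hn hm hd (by omega) (by rw [← hD]; omega)) ?_
  rintro s2 hf2 ⟨N, hN, b7, bsound, bcompl⟩
  have c2 := c1.frame hf2 rfl
  have hNE : N * (D + 1) ≤ Z * (D + 1) := Nat.mul_le_mul_right _ hN
  have hsort := mergeSort_spec (S := S) (inp := inp) c2 (D + 1) N L rfl b7 (hN.trans hZL) (by omega)
    (by omega)
  refine Runs.seq _ _ le_rfl (hsort.mono ?_ fun _ _ h => h) ?_
  · gcongr
  rintro s3 hf3 ⟨dperm, dsort⟩
  have c3 := c2.frame hf3 rfl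
  have drm : s3.rmem = s2.rmem := hf3.rm rfl
  have hσ := seg_perm_range dperm
  have hT : SortedTable (tableRow s3 (D + 1)) (D + 1) N := by
    have := sortedTable_of_rowsSorted dsort
    rw [← drm] at this
    exact this
  refine (buildTables_spec (S := S) (inp := inp) c3 (D + 1) D N sd hD rfl (by rw [hf3.i 7 rfl, b7])
    (by rw [hf3.r 3 rfl, hf2.r 3 rfl, a3]) hT hσ (by omega)).mono ?_ ?_
  · gcongr
  rintro s4 - ⟨e1, e2, e3⟩
  have hrow : ∀ c < N, ∀ z, HoldsRow inp n m d K sd s2.rmem (s3.imem (c + 2)) z →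
      TableRowIs inp n m d K sd s4 c z := by
    rintro c hc z ⟨g1, g2⟩
    refine ⟨fun l hl => ?_, ?_⟩
    · rw [tableRow, e2 _ (by omega), e3 c hc, drm, g1 l hl]
    · rw [tableRow, e2 _ (by omega), e3 c hc, drm, g2]
  refine ⟨N, hN, e1, fun c hc => ?_, fun z hz hE => ?_⟩
  · obtain ⟨z, hz, hE, hr⟩ := bsound _ (hσ c hc)
    exact ⟨z, hz, hE, hrow c hc z hr⟩
  · obtain ⟨k, hk, hr⟩ := bcompl z hz hE
    -- The sorted order is a permutation, so the row k of the memory occurs at some position c.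
    rw [← List.mem_range, ← dperm.mem_iff, seg, List.mem_map] at hk
    obtain ⟨c, hc, rfl⟩ := hk
    rw [List.mem_range'_1] at hc
    exact ⟨c, by omega, hrow c (by omega) z hr⟩

end

/-! ### Alignments and walks -/

/-- The pair `x`, followed by the pairs in the list, is the end of an alignment. -/
inductive AlignTail {m : ℕ} : Fin m × Fin m → List (Fin m × Fin m) → Prop
  | nil {x : Fin m × Fin m} (h₁ : (x.1 : ℕ) + 1 = m) (h₂ : (x.2 : ℕ) + 1 = m) : AlignTail x []
  | cons {x y : Fin m × Fin m} {τ : List (Fin m × Fin m)} (h : AlignStep x y)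
      (hτ : AlignTail y τ) : AlignTail x (y :: τ)

theorem alignTail_iff {m : ℕ} {x : Fin m × Fin m} {τ : List (Fin m × Fin m)} :
    AlignTail x τ ↔ (x :: τ).IsChain AlignStep ∧
      ∃ b, (x :: τ).getLast? = some b ∧ (b.1 : ℕ) + 1 = m ∧ (b.2 : ℕ) + 1 = m := by
  induction τ generalizing x with
  | nil =>
    constructor
    · rintro ⟨h₁, h₂⟩
      exact ⟨by simp, x, by simp, h₁, h₂⟩
    · rintro ⟨-, b, hb, h₁, h₂⟩
      simp only [List.getLast?_singleton, Option.some.injEq] at hb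
      subst hb
      exact .nil h₁ h₂
  | cons y τ ih =>
    rw [List.isChain_cons_cons, List.getLast?_cons_cons]
    constructor
    · rintro (_ | ⟨h, hτ⟩)
      have := ih.1 hτ
      exact ⟨⟨h, this.1⟩, this.2⟩
    · rintro ⟨⟨h, hc⟩, hb⟩
      exact .cons h (ih.2 ⟨hc, hb⟩)

theorem isAlignment_iff {m : ℕ} {τ : List (Fin m × Fin m)} :
    IsAlignment τ ↔ ∃ x τ', τ = x :: τ' ∧ (x.1 : ℕ) = 0 ∧ (x.2 : ℕ) = 0 ∧ AlignTail x τ' := by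
  constructor
  · rintro ⟨⟨a, ha, ha1, ha2⟩, hl, hc⟩
    rw [List.head?_eq_some_iff] at ha
    obtain ⟨τ', rfl⟩ := ha
    exact ⟨a, τ', rfl, ha1, ha2, alignTail_iff.2 ⟨hc, hl⟩⟩
  · rintro ⟨x, τ', rfl, h1, h2, h⟩
    obtain ⟨hc, hl⟩ := alignTail_iff.1 h
    exact ⟨⟨x, by simp, h1, h2⟩, hl, hc⟩

/-- The pair of natural numbers of a pair of indices. -/
def natPair {m : ℕ} (x : Fin m × Fin m) : ℕ × ℕ := (x.1, x.2)

theorem AlignTail.length_le {m : ℕ} {x : Fin m × Fin m} {τ : List (Fin m × Fin m)}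
    (h : AlignTail x τ) : (x.1 : ℕ) + x.2 + τ.length + 2 ≤ 2 * m := by
  induction h with
  | nil h₁ h₂ => simp; omega
  | cons h hτ ih =>
    simp only [List.length_cons]
    rcases h with h | h | h <;> omega

theorem IsAlignment.length_le {m : ℕ} {τ : List (Fin m × Fin m)} (h : IsAlignment τ) :
    τ.length ≤ 2 * m := by
  obtain ⟨x, τ', rfl, -, -, h⟩ := isAlignment_iff.1 h
  have := h.length_le
  simp only [List.length_cons]
  omega

/-- One ternary digit per pair names the step that follows it; the last pair gets the diagonal digit
0, which leads to (m, m). The bound is stated for q + 1 because this form is multiplicative: c + 3q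
+ 1 ≤ 3(q + 1) for a digit c. -/
theorem AlignTail.exists_walk {m : ℕ} {x : Fin m × Fin m} {τ : List (Fin m × Fin m)}
    (h : AlignTail x τ) : ∃ q, q + 1 ≤ 3 ^ (τ.length + 1) ∧ ∀ f, τ.length + 1 ≤ f →
      walk m f q x.1 x.2 = some ((x :: τ).map natPair) := by
  induction h with
  | @nil x h₁ h₂ =>
    refine ⟨0, by simp, fun f hf => ?_⟩
    obtain ⟨f, rfl⟩ : ∃ j, f = j + 1 := ⟨f - 1, by simp at hf; omega⟩
    rw [walk, if_pos x.1.2, if_pos x.2.2, if_neg (by simp), if_neg (by simp), h₁, h₂, walk_end]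
    simp [natPair]
  | @cons x y τ h hτ ih =>
    obtain ⟨q, hq, hw⟩ := ih
    obtain ⟨c, hc, hx1, hx2⟩ : ∃ c, c < 3 ∧ (if c = 2 then (x.1 : ℕ) else x.1 + 1) = y.1 ∧
        (if c = 1 then (x.2 : ℕ) else x.2 + 1) = y.2 := by
      rcases h with h | h | h
      · exact ⟨1, by norm_num, by simp [h.1], by simp [h.2]⟩
      · exact ⟨2, by norm_num, by simp [h.1], by simp [h.2]⟩
      · exact ⟨0, by norm_num, by simp [h.1], by simp [h.2]⟩
    refine ⟨c + 3 * q, ?_, fun f hf => ?_⟩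
    · rw [List.length_cons, pow_succ]
      omega
    · obtain ⟨f, rfl⟩ : ∃ j, f = j + 1 := ⟨f - 1, by simp at hf; omega⟩
      have e1 : (c + 3 * q) % 3 = c := by omega
      have e2 : (c + 3 * q) / 3 = q := by omega
      rw [walk, if_pos x.1.2, if_pos x.2.2, e1, e2, hx1, hx2,
        hw f (by simp only [List.length_cons] at hf ⊢; omega)]
      simp [natPair]

/-- The first alternative is the position past the last pair. From a pair inside the square it is
reached only by a diagonal step from the last pair, since the other steps would need an index equal
to m already. -/
theorem exists_alignTail_of_walk {m f q a b : ℕ} {τ : List (ℕ × ℕ)} (h : walk m f q a b = some τ) :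
    (a = m ∧ b = m ∧ τ = []) ∨ ∃ x τ', (x : Fin m × Fin m).1 = a ∧ (x.2 : ℕ) = b ∧
      τ = (x :: τ').map natPair ∧ AlignTail x τ' := by
  induction f generalizing q a b τ with
  | zero =>
    simp only [walk] at h
    split_ifs at h with h1
    exact Or.inl ⟨h1.1, h1.2, (Option.some.inj h).symm⟩
  | succ f ih =>
    rw [walk] at h
    by_cases h1 : a < m
    · by_cases h2 : b < m
      · rw [if_pos h1, if_pos h2, Option.map_eq_some_iff] at h
        obtain ⟨τ', h, rfl⟩ := h
        right
        rcases ih h with ⟨ha, hb, rfl⟩ | ⟨x, τ'', hx1, hx2, rfl, hx⟩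
        · refine ⟨(⟨a, h1⟩, ⟨b, h2⟩), [], rfl, rfl, rfl, .nil ?_ ?_⟩
          · simp only
            split_ifs at ha <;> omega
          · simp only
            split_ifs at hb <;> omega
        · refine ⟨(⟨a, h1⟩, ⟨b, h2⟩), x :: τ'', rfl, rfl, rfl, .cons ?_ hx⟩
          have : q % 3 < 3 := Nat.mod_lt _ (by norm_num)
          unfold AlignStep
          simp only
          split_ifs at hx1 hx2 <;> omega
      · simp [h1, h2] at h
    · rw [if_neg h1] at h
      split_ifs at h with h3
      exact Or.inl ⟨h3.1, h3.2, (Option.some.inj h).symm⟩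

theorem exists_isAlignment_of_walk {m f q : ℕ} {τ : List (ℕ × ℕ)} (hm : 1 ≤ m)
    (h : walk m f q 0 0 = some τ) :
    ∃ τ' : List (Fin m × Fin m), IsAlignment τ' ∧ τ = τ'.map natPair := by
  rcases exists_alignTail_of_walk h with ⟨h, -⟩ | ⟨x, τ', h1, h2, rfl, hx⟩
  · omega
  · exact ⟨x :: τ', isAlignment_iff.2 ⟨x, τ', rfl, h1, h2, hx⟩, rfl⟩

theorem IsAlignment.exists_walk {m : ℕ} {τ : List (Fin m × Fin m)} (h : IsAlignment τ) :
    ∃ q, q + 1 ≤ 3 ^ (2 * m) ∧ walk m (2 * m) q 0 0 = some (τ.map natPair) := by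
  have hl := h.length_le
  obtain ⟨x, τ', rfl, h1, h2, h⟩ := isAlignment_iff.1 h
  obtain ⟨q, hq, hw⟩ := h.exists_walk
  simp only [List.length_cons] at hl
  refine ⟨q, hq.trans (Nat.pow_le_pow_right (by norm_num) hl), ?_⟩
  rw [← hw _ hl, h1, h2]

/-- Every point of the second curve is matched with a point of the first one, in monotone order. -/
theorem AlignTail.exists_monotone {m : ℕ} {x : Fin m × Fin m} {τ : List (Fin m × Fin m)}
    (h : AlignTail x τ) (F : ℕ × ℕ → ℝ) (hF : ∀ y, 0 ≤ F y) :
    ∃ A : ℕ → ℕ, (∀ b, A b < m) ∧ (∀ b, (x.1 : ℕ) ≤ A b) ∧ (∀ b b', b ≤ b' → A b ≤ A b') ∧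
      ∑ b ∈ Finset.Ico (x.2 : ℕ) m, F (A b, b) ≤ (((x :: τ).map natPair).map F).sum := by
  induction h with
  | @nil x h₁ h₂ =>
    refine ⟨fun _ => x.1, fun _ => x.1.2, fun _ => le_rfl, fun _ _ _ => le_rfl, ?_⟩
    rw [show Finset.Ico (x.2 : ℕ) m = {(x.2 : ℕ)} from by ext b; simp; omega]
    simp [natPair]
  | @cons x y τ h hτ ih =>
    obtain ⟨A, hA1, hA2, hA3, hA4⟩ := ih
    have h1 : (x.1 : ℕ) ≤ y.1 := by rcases h with h | h | h <;> omega
    have h2 : (y.2 : ℕ) = x.2 ∨ (y.2 : ℕ) = x.2 + 1 := by rcases h with h | h | h <;> omega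
    rw [List.map_cons, List.map_cons, List.sum_cons]
    -- The function A assigns to b its last partner in the alignment. If the next pair keeps the
    -- second index, the present pair is dropped, at no loss since F ≥ 0; otherwise it is the last
    -- one with this second index.
    rcases h2 with h2 | h2
    · refine ⟨A, hA1, fun b => h1.trans (hA2 b), hA3, ?_⟩
      rw [← h2]
      have := hF (natPair x)
      linarith
    · refine ⟨fun b => if b ≤ x.2 then x.1 else A b, fun b => ?_, fun b => ?_, fun b b' hb => ?_, ?_⟩
      · simp only
        split_ifs
        exacts [x.1.2, hA1 b]
      · simp only
        split_ifs
        exacts [le_rfl, h1.trans (hA2 b)]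
      · simp only
        split_ifs
        · exact le_rfl
        · exact h1.trans (hA2 _)
        · omega
        · exact hA3 _ _ hb
      · rw [Finset.sum_eq_sum_Ico_succ_bot x.2.2]
        beta_reduce
        rw [if_pos le_rfl, ← h2]
        have : ∑ b ∈ Finset.Ico (y.2 : ℕ) m, F (if b ≤ x.2 then (x.1 : ℕ) else A b, b) =
            ∑ b ∈ Finset.Ico (y.2 : ℕ) m, F (A b, b) := by
          refine Finset.sum_congr rfl fun b hb => ?_
          have := (Finset.mem_Ico.1 hb).1
          rw [if_neg (by omega)]
        rw [this]
        exact add_le_add le_rfl hA4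

/-! ### Codes for rows -/

theorem guess_stop (K : ℝ) (f : ℕ → ℝ) (q a : ℕ) (x : ℝ) : guess K f (4 * q) a x = (q, a, x) := by
  rw [guess_zero (by omega)]
  congr 1
  omega

/-- Each advance puts one digit 3 below the code. As for walks, q + 1 grows at most by the factor 4
per digit. -/
theorem exists_guess_advance (K : ℝ) (f : ℕ → ℝ) (q a j : ℕ) :
    ∃ q', q' + 1 ≤ 4 ^ j * (q + 1) ∧ guess K f q' a (f a) = guess K f q (a + j) (f (a + j)) := by
  induction j generalizing a with
  | zero => exact ⟨q, by simp, rfl⟩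
  | succ j ih =>
    obtain ⟨q', hq', h⟩ := ih (a + 1)
    refine ⟨3 + 4 * q', ?_, ?_⟩
    · rw [pow_succ]
      have : 4 ^ j * 4 * (q + 1) = 4 * (4 ^ j * (q + 1)) := by ring
      omega
    · rw [guess, if_neg (by omega), if_neg (by omega), if_neg (by omega),
        show (3 + 4 * q') / 4 = q' by omega, h, show a + 1 + j = a + (j + 1) by omega]

theorem exists_guess_shift (K : ℝ) (f : ℕ → ℝ) (q a : ℕ) (x : ℝ) (b : ℤ) :
    ∃ q', q' + 1 ≤ 4 ^ b.natAbs * (q + 1) ∧ guess K f q' a x = guess K f q a (x + K * b) := by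
  induction hj : b.natAbs generalizing b x with
  | zero =>
    obtain rfl : b = 0 := by omega
    exact ⟨q, by simp, by simp⟩
  | succ j ih =>
    rcases lt_or_gt_of_ne (show b ≠ 0 by omega) with hb | hb
    · obtain ⟨q', hq', h⟩ := ih (x - K) (b + 1) (by omega)
      refine ⟨2 + 4 * q', ?_, ?_⟩
      · rw [pow_succ]
        have : 4 ^ j * 4 * (q + 1) = 4 * (4 ^ j * (q + 1)) := by ring
        omega
      · rw [guess, if_neg (by omega), if_neg (by omega), if_pos (by omega),
          show (2 + 4 * q') / 4 = q' by omega, h]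
        congr 1
        push_cast
        ring
    · obtain ⟨q', hq', h⟩ := ih (x + K) (b - 1) (by omega)
      refine ⟨1 + 4 * q', ?_, ?_⟩
      · rw [pow_succ]
        have : 4 ^ j * 4 * (q + 1) = 4 * (4 ^ j * (q + 1)) := by ring
        omega
      · rw [guess, if_neg (by omega), if_pos (by omega),
          show (1 + 4 * q') / 4 = q' by omega, h]
        congr 1
        push_cast
        ring

/-- The number of steps by `K` that are needed to get to `v`. -/
noncomputable def stepCount (K : ℕ) (sd : ℝ) (X : ℕ → ℕ → ℝ) (a k : ℕ) (v : ℤ) : ℕ :=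
  ((v - ⌊X a k / sd⌋) / (K : ℤ)).natAbs

/-- From the lowest digit on, the code consists of j digits 3 to reach the partner point, the steps
of length K as digits 1 or 2, the stop digit 0, and one digit to the base K for the remainder. The
advances come first because a digit 3 discards the value accumulated so far. -/
theorem exists_guessValue (K : ℕ) (hK : 1 ≤ K) (sd : ℝ) (X : ℕ → ℕ → ℝ) (k q a j : ℕ) (v : ℤ) :
    ∃ q', q' + 1 ≤ 4 ^ (j + stepCount K sd X (a + j) k v + 1) * K * (q + 1) ∧
      guessValue K sd X k q' a = (q, a + j, (v : ℝ)) := by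
  set w : ℤ := v - ⌊X (a + j) k / sd⌋ with hw
  have hK0 : (0 : ℤ) < K := by exact_mod_cast hK
  have he := Int.emod_nonneg w hK0.ne'
  have he' := Int.emod_lt_of_pos w hK0
  obtain ⟨e, heq⟩ : ∃ e : ℕ, (e : ℤ) = w % K := ⟨(w % K).toNat, by omega⟩
  have heK : e < K := by omega
  set f : ℕ → ℝ := fun a => ⌊X a k / sd⌋ with hf
  obtain ⟨q₂, h2, g2⟩ := exists_guess_shift K f (4 * (e + K * q)) (a + j) (f (a + j)) (w / K)
  obtain ⟨q₁, h1, g1⟩ := exists_guess_advance K f q₂ a j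
  refine ⟨q₁, ?_, ?_⟩
  · have h3 : 4 * (e + K * q) + 1 ≤ 4 * (K * (q + 1)) := by
      rw [Nat.mul_add K q 1]; omega
    calc q₁ + 1 ≤ 4 ^ j * (q₂ + 1) := h1
      _ ≤ 4 ^ j * (4 ^ (w / K).natAbs * (4 * (K * (q + 1)))) :=
          Nat.mul_le_mul_left _ (h2.trans (Nat.mul_le_mul_left _ h3))
      _ = _ := by
          rw [stepCount, ← hw]
          ring
  · have hg : guess K (fun a => ⌊X a k / sd⌋) q₁ a ⌊X a k / sd⌋ =
        (e + K * q, a + j, f (a + j) + K * (w / K : ℤ)) := by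
      change guess K f q₁ a (f a) = _
      rw [g1, g2, guess_stop]
    unfold guessValue
    rw [hg]
    simp only [Prod.mk.injEq, true_and]
    refine ⟨?_, ?_⟩
    · rw [Nat.add_mul_div_left _ _ hK, Nat.div_eq_of_lt heK, Nat.zero_add]
    · rw [Nat.add_mul_mod_self_left, Nat.mod_eq_of_lt heK]
      have h5 : ((K : ℤ) * (w / K) + e : ℤ) = w := by rw [heq]; exact Int.mul_ediv_add_emod w K
      have h6 : (v : ℝ) = ((⌊X (a + j) k / sd⌋ + (K * (w / K) + e) : ℤ) : ℝ) := by
        rw [h5, hw]; congr 1; ring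
      rw [h6, hf]
      push_cast
      ring

/-- The index of the point after `l` coordinates. -/
def pointBefore (d : ℕ) (A : ℕ → ℕ) : ℕ → ℕ
  | 0 => 0
  | l + 1 => A (l / d)

/-- Since A is monotone, the advances telescope: they cost `pointBefore d A l` digits in all, not
per coordinate. The code q left over is arbitrary, because the coordinates decoded first occupy the
lowest digits and the induction inserts the last coordinate below q. -/
theorem exists_guessRow (K d : ℕ) (hK : 1 ≤ K) (sd : ℝ) (X : ℕ → ℕ → ℝ) (A : ℕ → ℕ)
    (hA : ∀ b b', b ≤ b' → A b ≤ A b') (v : ℕ → ℤ) (l q : ℕ) :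
    ∃ q', q' + 1 ≤ 4 ^ (pointBefore d A l +
        ∑ i ∈ Finset.range l, (stepCount K sd X (A (i / d)) (i % d) (v i) + 1)) * K ^ l * (q + 1) ∧
      guessState K d sd X q' l = (q, pointBefore d A l) ∧
      ∀ i < l, guessRow K d sd X q' i = v i := by
  induction l generalizing q with
  | zero => exact ⟨q, by simp [pointBefore], rfl, by simp⟩
  | succ l ih =>
    have hle : pointBefore d A l ≤ A (l / d) := by
      cases l with
      | zero => exact Nat.zero_le _
      | succ l => exact hA _ _ (Nat.div_le_div_right (Nat.le_succ l))
    obtain ⟨q₁, h1, g1⟩ := exists_guessValue K hK sd X (l % d) q (pointBefore d A l)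
      (A (l / d) - pointBefore d A l) (v l)
    rw [Nat.add_sub_cancel' hle] at h1 g1
    obtain ⟨q₂, h2, g2, r2⟩ := ih q₁
    refine ⟨q₂, ?_, ?_, ?_⟩
    · refine h2.trans ((Nat.mul_le_mul_left _ h1).trans (le_of_eq ?_))
      rw [Finset.sum_range_succ, pointBefore]
      generalize stepCount K sd X (A (l / d)) (l % d) (v l) = c
      generalize ∑ i ∈ Finset.range l, (stepCount K sd X (A (i / d)) (i % d) (v i) + 1) = e
      obtain ⟨j, hj⟩ := Nat.exists_eq_add_of_le hle
      rw [hj, Nat.add_sub_cancel_left]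
      ring
    · rw [guessState, g2, g1, pointBefore]
    · intro i hi
      rcases Nat.lt_succ_iff_lt_or_eq.1 hi with hi | rfl
      · exact r2 i hi
      · rw [guessRow, g2, g1]

/-! ### Distances of curves -/

/-- The sum of the `p`-th powers of the distances of the matched points. -/
noncomputable def lpSum {m d : ℕ} (p : ℝ) (P Q : Curve m d) (τ : List (Fin m × Fin m)) : ℝ :=
  (τ.map fun a => ‖P a.1 - Q a.2‖ ^ p).sum

theorem lpSum_nonneg {m d : ℕ} (p : ℝ) (P Q : Curve m d) (τ : List (Fin m × Fin m)) :
    0 ≤ lpSum p P Q τ := by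
  refine List.sum_nonneg fun x hx => ?_
  obtain ⟨a, -, rfl⟩ := List.mem_map.1 hx
  positivity

theorem walk_diagonal (m f a : ℕ) (h : m ≤ a + f) (ha : a ≤ m) : ∃ τ, walk m f 0 a a = some τ := by
  induction f generalizing a with
  | zero =>
    obtain rfl : a = m := by omega
    exact ⟨[], by simp [walk]⟩
  | succ f ih =>
    rcases ha.lt_or_eq with ha | rfl
    · obtain ⟨τ, hτ⟩ := ih (a + 1) (by omega) ha
      simp [walk, ha, hτ]
    · simp [walk]

theorem exists_isAlignment {m : ℕ} (hm : 1 ≤ m) : ∃ τ : List (Fin m × Fin m), IsAlignment τ := by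
  obtain ⟨τ, h⟩ := walk_diagonal m m 0 (by omega) (by omega)
  obtain ⟨τ', h', -⟩ := exists_isAlignment_of_walk hm h
  exact ⟨τ', h'⟩

/-- The index sum grows along an alignment, so alignments have bounded length and there are finitely
many; the diagonal is one. The infimum is then a minimum. -/
theorem exists_isAlignment_min {m : ℕ} (hm : 1 ≤ m) (F : List (Fin m × Fin m) → ℝ) :
    (∃ τ, IsAlignment τ ∧ sInf {x | ∃ τ, IsAlignment τ ∧ x = F τ} = F τ) ∧
      ∀ τ, IsAlignment τ → sInf {x | ∃ τ, IsAlignment τ ∧ x = F τ} ≤ F τ := by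
  have hfin : {x | ∃ τ, IsAlignment τ ∧ x = F τ}.Finite := by
    refine ((List.finite_length_le (Fin m × Fin m) (2 * m)).image F).subset ?_
    rintro x ⟨τ, hτ, rfl⟩
    exact ⟨τ, hτ.length_le, rfl⟩
  obtain ⟨τ, hτ⟩ := exists_isAlignment hm
  have hne : {x | ∃ τ, IsAlignment τ ∧ x = F τ}.Nonempty := ⟨_, τ, hτ, rfl⟩
  exact ⟨hne.csInf_mem hfin,
    fun τ' hτ' => csInf_le hfin.bddBelow ⟨τ', hτ', rfl⟩⟩

theorem exists_lpDist_eq {m d : ℕ} (hm : 1 ≤ m) (p : ℝ) (P Q : Curve m d) :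
    ∃ τ, IsAlignment τ ∧ lpDist p P Q = lpCost p P Q τ :=
  (exists_isAlignment_min hm (lpCost p P Q)).1

theorem lpDist_le {m d : ℕ} (hm : 1 ≤ m) (p : ℝ) (P Q : Curve m d) {τ : List (Fin m × Fin m)}
    (h : IsAlignment τ) : lpDist p P Q ≤ lpCost p P Q τ :=
  (exists_isAlignment_min hm (lpCost p P Q)).2 τ h

theorem lpDist_le_iff {m d : ℕ} (hm : 1 ≤ m) {p : ℝ} (hp : 1 ≤ p) (P Q : Curve m d) {R : ℝ}
    (hR : 0 ≤ R) : lpDist p P Q ≤ R ↔ ∃ τ, IsAlignment τ ∧ lpSum p P Q τ ≤ R ^ p := by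
  have key : ∀ τ, lpCost p P Q τ ≤ R ↔ lpSum p P Q τ ≤ R ^ p := fun τ => by
    rw [lpCost, one_div]
    exact Real.rpow_inv_le_iff_of_pos (lpSum_nonneg p P Q τ) hR (by linarith)
  constructor
  · intro h
    obtain ⟨τ, hτ, h'⟩ := exists_lpDist_eq hm p P Q
    exact ⟨τ, hτ, (key τ).1 (h' ▸ h)⟩
  · rintro ⟨τ, hτ, h⟩
    exact (lpDist_le hm p P Q hτ).trans ((key τ).2 h)

/-- Minkowski's inequality over the pairs of one fixed alignment; the constant vector η has ℓ_p-norm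
(length)^(1/p) · η, and the length is at most 2m. -/
theorem lpCost_le_add {m d : ℕ} {p : ℝ} (hp : 1 ≤ p) (P Q G : Curve m d) {η : ℝ}
    (hη : ∀ b, ‖G b - Q b‖ ≤ η) (hη0 : 0 ≤ η) {τ : List (Fin m × Fin m)} (hτ : IsAlignment τ) :
    lpCost p P Q τ ≤ lpCost p P G τ + (2 * m : ℝ) ^ (1 / p) * η := by
  have hp0 : 0 < p := by linarith
  simp only [lpCost, ← Fin.sum_univ_fun_getElem]
  refine le_trans ?_ ((Real.Lp_add_le_of_nonneg Finset.univ
    (f := fun i : Fin τ.length => ‖P τ[i.1].1 - G τ[i.1].2‖) (g := fun _ => η) hp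
    (fun i _ => norm_nonneg _) (fun i _ => hη0)).trans (add_le_add le_rfl ?_))
  · refine Real.rpow_le_rpow (Finset.sum_nonneg fun i _ => by positivity)
      (Finset.sum_le_sum fun i _ => Real.rpow_le_rpow (norm_nonneg _) ?_ hp0.le) (by positivity)
    have h1 : P τ[i.1].1 - Q τ[i.1].2 =
        (P τ[i.1].1 - G τ[i.1].2) + (G τ[i.1].2 - Q τ[i.1].2) := by abel
    rw [h1]
    exact (norm_add_le _ _).trans (add_le_add le_rfl (hη _))
  · rw [Finset.sum_const, Finset.card_univ, Fintype.card_fin, nsmul_eq_mul,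
      Real.mul_rpow (by positivity) (by positivity), ← Real.rpow_mul hη0, mul_one_div_cancel hp0.ne',
      Real.rpow_one]
    have h2 : (τ.length : ℝ) ≤ 2 * m := by exact_mod_cast hτ.length_le
    gcongr

theorem lpDist_le_add {m d : ℕ} (hm : 1 ≤ m) {p : ℝ} (hp : 1 ≤ p) (P Q G : Curve m d) {η : ℝ}
    (hη : ∀ b, ‖G b - Q b‖ ≤ η) (hη0 : 0 ≤ η) :
    lpDist p P Q ≤ lpDist p P G + (2 * m : ℝ) ^ (1 / p) * η := by
  obtain ⟨τ, hτ, h⟩ := exists_lpDist_eq hm p P G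
  rw [h]
  exact (lpDist_le hm p P Q hτ).trans (lpCost_le_add hp P Q G hη hη0 hτ)

/-- The curve with the coordinates `g l * sd`. -/
noncomputable def gridCurve (m d : ℕ) (sd : ℝ) (g : ℕ → ℝ) : Curve m d :=
  fun b => WithLp.toLp 2 fun k => g (b * d + k) * sd

theorem gridCurve_congr {m d : ℕ} (sd : ℝ) {g g' : ℕ → ℝ} (h : ∀ l < m * d, g l = g' l) :
    gridCurve m d sd g = gridCurve m d sd g' := by
  funext b
  ext k
  have : (b : ℕ) * d + k < m * d := by
    calc (b : ℕ) * d + k < b * d + d := by omega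
      _ = (b + 1) * d := by ring
      _ ≤ m * d := Nat.mul_le_mul_right _ b.2
  simp [gridCurve, h _ this]

theorem norm_floor_sub_le {m d : ℕ} (Q : Curve m d) {inp : ℕ → ℝ} (hQ : EncodesCurve inp Q) {sd : ℝ}
    (hsd : 0 < sd) (b : Fin m) :
    ‖gridCurve m d sd (fun l => ⌊inp l / sd⌋) b - Q b‖ ≤ (d : ℝ) ^ ((1 : ℝ) / 2) * sd := by
  rw [EuclideanSpace.norm_eq, ← Real.sqrt_eq_rpow]
  refine Real.sqrt_le_iff.2 ⟨by positivity, ?_⟩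
  rw [mul_pow, Real.sq_sqrt (by positivity)]
  have : ∀ k : Fin d, ‖(gridCurve m d sd (fun l => ⌊inp l / sd⌋) b - Q b) k‖ ^ 2 ≤ sd ^ 2 := by
    intro k
    refine pow_le_pow_left₀ (norm_nonneg _) ?_ 2
    simp only [gridCurve, PiLp.sub_apply, ← hQ b k, Real.norm_eq_abs]
    set x := inp (b * d + k)
    have h1 := Int.floor_le (x / sd)
    have h2 := Int.lt_floor_add_one (x / sd)
    rw [le_div_iff₀ hsd] at h1
    rw [div_lt_iff₀ hsd] at h2
    rw [abs_le]
    constructor <;> linarith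
  calc _ ≤ ∑ _k : Fin d, sd ^ 2 := Finset.sum_le_sum fun k _ => this k
    _ = _ := by simp

theorem side_pos {m d : ℕ} {p ε r : ℝ} (hm : 1 ≤ m) (hd : 1 ≤ d) (hε : 0 < ε) (hr : 0 < r) :
    0 < side m d p ε r := by
  have : (0 : ℝ) < m := by exact_mod_cast hm
  have : (0 : ℝ) < d := by exact_mod_cast hd
  unfold side
  positivity

/-- The defining property of the side: the factors √d for the diagonal of a cell and (2m)^(1/p) for
the length of an alignment are divided out, so that rounding costs exactly half of the tolerance. -/
theorem side_mul {m d : ℕ} {p ε r : ℝ} (hm : 1 ≤ m) (hd : 1 ≤ d) :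
    (2 * m : ℝ) ^ (1 / p) * ((d : ℝ) ^ ((1 : ℝ) / 2) * side m d p ε r) = ε / 2 * r := by
  have : (0 : ℝ) < m := by exact_mod_cast hm
  have : (0 : ℝ) < d := by exact_mod_cast hd
  unfold side
  have h1 : (0 : ℝ) < (2 * m : ℝ) ^ (1 / p) := by positivity
  have h2 : (0 : ℝ) < (d : ℝ) ^ ((1 : ℝ) / 2) := by positivity
  field_simp

/-- Rounding the query curve changes its distances by at most `ε / 2 * r`. -/
theorem lpDist_floor {m d : ℕ} {p ε r : ℝ} (hm : 1 ≤ m) (hd : 1 ≤ d) (hp : 1 ≤ p) (hε : 0 < ε)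
    (hr : 0 < r) (P Q : Curve m d) {inp : ℕ → ℝ} (hQ : EncodesCurve inp Q) :
    (lpDist p P Q ≤ r → lpDist p P (gridCurve m d (side m d p ε r)
      (fun l => ⌊inp l / side m d p ε r⌋)) ≤ (1 + ε / 2) * r) ∧
    (lpDist p P (gridCurve m d (side m d p ε r)
      (fun l => ⌊inp l / side m d p ε r⌋)) ≤ (1 + ε / 2) * r → lpDist p P Q ≤ (1 + ε) * r) := by
  have hs : 0 < side m d p ε r := side_pos hm hd hε hr
  have h := norm_floor_sub_le Q hQ hs
  have h0 : (0 : ℝ) ≤ (d : ℝ) ^ ((1 : ℝ) / 2) * side m d p ε r := by positivity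
  constructor
  · intro h1
    have := lpDist_le_add hm hp P _ Q (fun b => (norm_sub_rev _ _).trans_le (h b)) h0
    rw [side_mul hm hd] at this
    linarith
  · intro h1
    have := lpDist_le_add hm hp P Q _ h h0
    rw [side_mul hm hd] at this
    linarith

/-! ### The codes cover all close grid curves -/

theorem pairCost_eq {m d : ℕ} (p : ℝ) (P G : Curve m d) {X : ℕ → ℕ → ℝ} {g : ℕ → ℕ → ℝ}
    (hX : ∀ (a : Fin m) (k : Fin d), X a k = P a k) (hg : ∀ (b : Fin m) (k : Fin d), g b k = G b k)
    (a b : Fin m) : pairCost d (p / 2) (X a) (g b) = ‖P a - G b‖ ^ p := by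
  have h : ∑ k ∈ Finset.range d, (X a k - g b k) * (X a k - g b k) =
      ∑ k : Fin d, ‖(P a - G b) k‖ ^ 2 := by
    rw [Finset.sum_range]
    refine Finset.sum_congr rfl fun k _ => ?_
    rw [hX, hg, Real.norm_eq_abs, sq_abs, PiLp.sub_apply]
    ring
  rw [pairCost, h, max_eq_left (by positivity), EuclideanSpace.norm_eq, Real.sqrt_eq_rpow,
    ← Real.rpow_mul (by positivity)]
  congr 1
  ring

theorem sum_pairCost_eq {m d : ℕ} (p sd : ℝ) (P : Curve m d) {X : ℕ → ℕ → ℝ} (g : ℕ → ℝ)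
    (hX : ∀ (a : Fin m) (k : Fin d), X a k = P a k) (τ : List (Fin m × Fin m)) :
    ((τ.map natPair).map fun x => pairCost d (p / 2) (X x.1) fun k => g (x.2 * d + k) * sd).sum =
      lpSum p P (gridCurve m d sd g) τ := by
  rw [List.map_map, lpSum]
  congr 1
  refine List.map_congr_left fun x _ => ?_
  exact pairCost_eq p P _ (g := fun b k => g (b * d + k) * sd) hX (fun b k => rfl) x.1 x.2

theorem sum_range_mul {M : Type*} [AddCommMonoid M] (f : ℕ → M) (m d : ℕ) :
    ∑ l ∈ Finset.range (m * d), f l =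
      ∑ b ∈ Finset.range m, ∑ k ∈ Finset.range d, f (b * d + k) := by
  induction m with
  | zero => simp
  | succ m ih => rw [Nat.succ_mul, Finset.sum_range_add, ih, Finset.sum_range_succ]

/-- Cauchy–Schwarz: the ℓ₁-norm in dimension d is at most √d times the ℓ₂-norm, which is the cost to
the power 1/p. -/
theorem sum_abs_le_pairCost (d : ℕ) {p : ℝ} (hp : 0 < p) (x y : ℕ → ℝ) :
    ∑ k ∈ Finset.range d, |x k - y k| ≤
      (d : ℝ) ^ ((1 : ℝ) / 2) * pairCost d (p / 2) x y ^ (1 / p) := by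
  have h0 : 0 ≤ ∑ k ∈ Finset.range d, (x k - y k) * (x k - y k) :=
    Finset.sum_nonneg fun k _ => mul_self_nonneg _
  rw [pairCost, max_eq_left h0, ← Real.rpow_mul h0, show p / 2 * (1 / p) = 1 / 2 by field_simp,
    ← Real.mul_rpow (by positivity) h0, ← Real.sqrt_eq_rpow]
  refine Real.le_sqrt_of_sq_le ?_
  have := sq_sum_le_card_mul_sum_sq (s := Finset.range d) (f := fun k => |x k - y k|)
  simpa only [sq_abs, Finset.card_range, pow_two, abs_mul_abs_self] using this

/-- The power mean inequality gives m^(1 − 1/p) · R. The base is enlarged from m to 2m so that the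
factor (2m)^(1/p) later cancels against the one in the side of the grid. -/
theorem sum_rpow_inv_le {m : ℕ} {p R : ℝ} (hm : 1 ≤ m) (hp : 1 ≤ p) (hR : 0 ≤ R) (c : ℕ → ℝ)
    (hc : ∀ b, 0 ≤ c b) (h : ∑ b ∈ Finset.range m, c b ≤ R ^ p) :
    ∑ b ∈ Finset.range m, c b ^ (1 / p) ≤ 2 * m / (2 * m : ℝ) ^ (1 / p) * R := by
  have hp0 : 0 < p := by linarith
  have hm0 : (0 : ℝ) < m := by exact_mod_cast hm
  have h1 := Real.rpow_sum_le_const_mul_sum_rpow_of_nonneg (Finset.range m)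
    (f := fun b => c b ^ (1 / p)) hp (fun b _ => by have := hc b; positivity)
  have h2 : ∑ b ∈ Finset.range m, (c b ^ (1 / p)) ^ p = ∑ b ∈ Finset.range m, c b :=
    Finset.sum_congr rfl fun b _ => by
      rw [← Real.rpow_mul (hc b), one_div_mul_cancel hp0.ne', Real.rpow_one]
  rw [h2, Finset.card_range] at h1
  refine (Real.rpow_le_rpow_iff (Finset.sum_nonneg fun b _ => by have := hc b; positivity)
    (by positivity) hp0).1 (h1.trans ?_)
  rw [Real.mul_rpow (by positivity) hR, Real.div_rpow (by positivity) (by positivity),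
    ← Real.rpow_mul (by positivity), one_div_mul_cancel hp0.ne', Real.rpow_one,
    ← Real.rpow_sub_one (by positivity)]
  have : (m : ℝ) ^ (p - 1) ≤ (2 * m : ℝ) ^ (p - 1) :=
    Real.rpow_le_rpow hm0.le (by linarith) (by linarith)
  exact mul_le_mul this h (Finset.sum_nonneg fun b _ => hc b) (by positivity)

/-- Of the slack 2K, one K pays for the remainder modulo K and the other for rounding the starting
value, which costs at most 1 ≤ K. -/
theorem mul_stepCount_le {K : ℕ} (hK : 1 ≤ K) (sd : ℝ) (X : ℕ → ℕ → ℝ) (a k : ℕ) (v : ℤ) :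
    (K : ℝ) * stepCount K sd X a k v ≤ |v - X a k / sd| + 2 * K := by
  have hK0 : (0 : ℤ) < K := by exact_mod_cast hK
  have hK1 : (1 : ℝ) ≤ K := by exact_mod_cast hK
  set w : ℤ := v - ⌊X a k / sd⌋ with hw
  have h1 := Int.mul_ediv_add_emod w K
  have h2 := Int.emod_nonneg w hK0.ne'
  have h3 := Int.emod_lt_of_pos w hK0
  have h4 : (stepCount K sd X a k v : ℝ) = |((w / K : ℤ) : ℝ)| := by
    rw [stepCount, ← hw, ← Int.cast_abs, Int.abs_eq_natAbs, Int.cast_natCast]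
  have h1' : (K : ℝ) * (w / K : ℤ) = w - (w % K : ℤ) := by
    rw [eq_sub_iff_add_eq]; exact_mod_cast h1
  have h2' : (0 : ℝ) ≤ (w % K : ℤ) := by exact_mod_cast h2
  have h3' : ((w % K : ℤ) : ℝ) ≤ K := by exact_mod_cast h3.le
  have h5 : (w : ℝ) = v - ⌊X a k / sd⌋ := by rw [hw]; push_cast; ring
  have h6 := Int.floor_le (X a k / sd)
  have h7 := Int.lt_floor_add_one (X a k / sd)
  rw [h4, ← abs_of_nonneg (show (0 : ℝ) ≤ K by linarith), ← abs_mul, h1',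
    abs_of_nonneg (show (0 : ℝ) ≤ K by linarith), h5, abs_le]
  have h8 := le_abs_self (v - X a k / sd)
  have h9 := neg_abs_le (v - X a k / sd)
  constructor <;> linarith

/-- The key estimate: a close grid curve deviates from its partners by O(1/ε) grid units per
coordinate on average, independently of p and of the dimension. Both powers in the side are matched:
√d by Cauchy–Schwarz within a point, (2m)^(1/p) by the power mean over the points. -/
theorem sum_abs_sub_le {m d : ℕ} {p ε r : ℝ} (hm : 1 ≤ m) (hd : 1 ≤ d) (hp : 1 ≤ p) (hε : 0 < ε)
    (hε1 : ε ≤ 1) (hr : 0 < r) (X : ℕ → ℕ → ℝ) (A : ℕ → ℕ) (g : ℕ → ℝ)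
    (h : ∑ b ∈ Finset.range m, pairCost d (p / 2) (X (A b))
      (fun k => g (b * d + k) * side m d p ε r) ≤ threshold p ε r) :
    ∑ l ∈ Finset.range (m * d), |g l - X (A (l / d)) (l % d) / side m d p ε r| ≤
      6 * (m * d) / ε := by
  have hs : 0 < side m d p ε r := side_pos hm hd hε hr
  have hsm := side_mul (p := p) (ε := ε) (r := r) hm hd
  set sd := side m d p ε r
  have hm0 : (0 : ℝ) < m := by exact_mod_cast hm
  have hd0 : (0 : ℝ) < d := by exact_mod_cast hd
  have hT : (0 : ℝ) < (2 * m : ℝ) ^ (1 / p) := by positivity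
  have hdd : (d : ℝ) ^ ((1 : ℝ) / 2) * (d : ℝ) ^ ((1 : ℝ) / 2) = d := by
    rw [← Real.rpow_add hd0]; norm_num
  have hw : (0 : ℝ) < (d : ℝ) ^ ((1 : ℝ) / 2) := by positivity
  set T := (2 * m : ℝ) ^ (1 / p) with hTdef
  set w := (d : ℝ) ^ ((1 : ℝ) / 2)
  have h1 := sum_rpow_inv_le hm hp (by positivity : 0 ≤ (1 + ε / 2) * r)
    (fun b => pairCost d (p / 2) (X (A b)) (fun k => g (b * d + k) * sd))
    (fun b => Real.rpow_nonneg (le_max_right _ _) _) h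
  rw [← hTdef] at h1
  have h2 : ∀ b ∈ Finset.range m, ∑ k ∈ Finset.range d,
      |g (b * d + k) - X (A ((b * d + k) / d)) ((b * d + k) % d) / sd| ≤
      w / sd * pairCost d (p / 2) (X (A b)) (fun k => g (b * d + k) * sd) ^ (1 / p) := by
    intro b _
    have h3 := sum_abs_le_pairCost d (by linarith : 0 < p) (X (A b)) fun k => g (b * d + k) * sd
    rw [div_mul_eq_mul_div, le_div_iff₀ hs, Finset.sum_mul]
    refine le_trans (le_of_eq (Finset.sum_congr rfl fun k hk => ?_)) h3
    have hk := Finset.mem_range.1 hk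
    rw [show (b * d + k) / d = b by
        rw [Nat.mul_comm, Nat.mul_add_div hd, Nat.div_eq_of_lt hk, Nat.add_zero],
      show (b * d + k) % d = k by rw [Nat.mul_comm, Nat.mul_add_mod, Nat.mod_eq_of_lt hk],
      abs_sub_comm, ← abs_of_pos hs, ← abs_mul, abs_of_pos hs]
    congr 1
    field_simp
  rw [sum_range_mul]
  refine (Finset.sum_le_sum h2).trans ?_
  rw [← Finset.mul_sum]
  refine (mul_le_mul_of_nonneg_left h1 (by positivity)).trans ?_
  have h4 : w / sd * (2 * m / T * ((1 + ε / 2) * r)) =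
      2 * m * (1 + ε / 2) * r * (w * w) / (T * (w * sd)) := by
    field_simp
  rw [h4, hsm, hdd]
  -- The constant 6 is 4 + 2ε for ε ≤ 1.
  have h5 : 2 * m * (1 + ε / 2) * r * d / (ε / 2 * r) = (4 + 2 * ε) * (m * d) / ε := by
    field_simp
    ring
  rw [h5]
  gcongr
  linarith

theorem pointBefore_le {d m : ℕ} {A : ℕ → ℕ} (hA : ∀ b, A b < m) (l : ℕ) : pointBefore d A l ≤ m := by
  cases l with
  | zero => exact Nat.zero_le _
  | succ l => exact (hA _).le

/-- A successful walk is an alignment, whatever the code was meant to be, and any alignment bounds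
the distance from above. -/
theorem Emits.lpDist_le {inp : ℕ → ℝ} {n m d K z : ℕ} {p ε r sd : ℝ} (hm : 1 ≤ m) (hp : 1 ≤ p)
    (hε : 0 < ε) (hr : 0 < r) (P : Curve m d)
    (hP : ∀ (a : Fin m) (k : Fin d), inputPoint inp m d (z % n) a k = P a k)
    (h : Emits inp n m d K sd (p / 2) (threshold p ε r) z) :
    lpDist p P (gridCurve m d sd (guessRow K d sd (inputPoint inp m d (z % n)) (z / n))) ≤
      (1 + ε / 2) * r := by
  obtain ⟨τ, hw, h⟩ := h
  obtain ⟨τ', hτ', rfl⟩ := exists_isAlignment_of_walk hm hw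
  rw [lpDist_le_iff hm hp _ _ (by positivity)]
  refine ⟨τ', hτ', ?_⟩
  rw [sum_pairCost_eq p sd P _ hP] at h
  exact h

/-- Completeness of the enumeration. An alignment of sufficiently small cost supplies the ternary
code of the walk and also the partners A that make the code of the row short; the walk is the code
left over after the row. -/
theorem exists_emits {inp : ℕ → ℝ} {n m d K i : ℕ} {p ε r : ℝ} (hm : 1 ≤ m) (hd : 1 ≤ d)
    (hp : 1 ≤ p) (hε : 0 < ε) (hε1 : ε ≤ 1) (hr : 0 < r) (hK : K = ⌈1 / ε⌉₊) (hi : i < n)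
    (P : Curve m d) (hP : ∀ (a : Fin m) (k : Fin d), inputPoint inp m d i a k = P a k) (v : ℕ → ℤ)
    (h : lpDist p P (gridCurve m d (side m d p ε r) fun l => v l) ≤ (1 + ε / 2) * r) :
    ∃ z < codeCount n m d K, z % n = i ∧
      Emits inp n m d K (side m d p ε r) (p / 2) (threshold p ε r) z ∧
      ∀ l < m * d, guessRow K d (side m d p ε r) (inputPoint inp m d i) (z / n) l = v l := by
  set sd := side m d p ε r with hsd
  set X := inputPoint inp m d i
  have hεK : 1 / ε ≤ K := hK ▸ Nat.le_ceil _
  have hK0 : (0 : ℝ) < K := lt_of_lt_of_le (by positivity) hεK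
  have hK1 : 1 ≤ K := by exact_mod_cast hK0
  rw [lpDist_le_iff hm hp _ _ (by positivity)] at h
  obtain ⟨τ, hτ, hsum⟩ := h
  obtain ⟨q₂, hq₂, hw⟩ := hτ.exists_walk
  have hA : ∃ A : ℕ → ℕ, (∀ b, A b < m) ∧ (∀ b b', b ≤ b' → A b ≤ A b') ∧
      ∑ b ∈ Finset.range m, pairCost d (p / 2) (X (A b)) (fun k => v (b * d + k) * sd) ≤
        threshold p ε r := by
    obtain ⟨x, τ', rfl, h1, h2, ht⟩ := isAlignment_iff.1 hτ
    obtain ⟨A, hA1, -, hA3, hA4⟩ := ht.exists_monotone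
      (fun x => pairCost d (p / 2) (X x.1) fun k => v (x.2 * d + k) * sd)
      (fun y => Real.rpow_nonneg (le_max_right _ _) _)
    refine ⟨A, hA1, hA3, ?_⟩
    rw [h2, ← Finset.range_eq_Ico, sum_pairCost_eq p sd P (fun l => (v l : ℝ)) hP] at hA4
    exact hA4.trans hsum
  obtain ⟨A, hA1, hA2, hA3⟩ := hA
  obtain ⟨q, hq, hst, hrow⟩ := exists_guessRow K d hK1 sd X A hA2 v (m * d) q₂
  have hcount : ∑ l ∈ Finset.range (m * d), stepCount K sd X (A (l / d)) (l % d) (v l) ≤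
      8 * (m * d) := by
    have h1 := sum_abs_sub_le hm hd hp hε hε1 hr X A (fun l => (v l : ℝ)) hA3
    have h2 : (K : ℝ) * ∑ l ∈ Finset.range (m * d),
        (stepCount K sd X (A (l / d)) (l % d) (v l) : ℝ) ≤ K * (8 * (m * d)) := by
      rw [Finset.mul_sum]
      refine (Finset.sum_le_sum fun l _ => mul_stepCount_le hK1 sd X (A (l / d)) (l % d) (v l)).trans ?_
      rw [Finset.sum_add_distrib, Finset.sum_const, Finset.card_range, nsmul_eq_mul]
      have h3 : 6 * (m * d : ℝ) / ε ≤ 6 * (m * d) * K := by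
        rw [div_eq_mul_one_div]
        gcongr
      push_cast
      linarith
    have h3 := le_of_mul_le_mul_left h2 hK0
    exact_mod_cast h3
  have hmd : m ≤ m * d := Nat.le_mul_of_pos_right m hd
  have hpb := pointBefore_le (d := d) hA1 (m * d)
  have hq' : q + 1 ≤ (codeBase * K) ^ (m * d) := by
    refine hq.trans ?_
    -- At most m advances, 8md steps and md stop digits.
    have h1 : pointBefore d A (m * d) + ∑ l ∈ Finset.range (m * d),
        (stepCount K sd X (A (l / d)) (l % d) (v l) + 1) ≤ 10 * (m * d) := by
      rw [Finset.sum_add_distrib, Finset.sum_const, Finset.card_range, smul_eq_mul]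
      omega
    -- This is where `codeBase` comes from: it equals 4^10 · 3^2, with the ternary digits of the
    -- walk generously charged to all md coordinates.
    calc _ ≤ 4 ^ (10 * (m * d)) * K ^ (m * d) * 3 ^ (2 * (m * d)) := by
          refine Nat.mul_le_mul (Nat.mul_le_mul_right _ (Nat.pow_le_pow_right (by norm_num) h1))
            (hq₂.trans (Nat.pow_le_pow_right (by norm_num) (by omega)))
      _ = (codeBase * K) ^ (m * d) := by
          rw [pow_mul 4 10, pow_mul 3 2, ← mul_pow, ← mul_pow, codeBase]
          congr 1
          ring
  have hmod : (i + n * q) % n = i := by rw [Nat.add_mul_mod_self_left, Nat.mod_eq_of_lt hi]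
  have hdiv : (i + n * q) / n = q := by
    rw [Nat.add_mul_div_left _ _ (by omega), Nat.div_eq_of_lt hi, Nat.zero_add]
  refine ⟨i + n * q, ?_, hmod, ?_, ?_⟩
  · calc i + n * q < n * (q + 1) := by rw [Nat.mul_add]; omega
      _ ≤ _ := Nat.mul_le_mul_left n hq'
  · refine ⟨τ.map natPair, ?_, ?_⟩
    · rw [hmod, hdiv, hst]
      exact hw
    · rw [hmod, hdiv, sum_pairCost_eq p sd P _ hP]
      rw [gridCurve_congr sd hrow]
      exact hsum
  · rw [hdiv]
    exact hrow

/-! ### Counting -/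

/-- The counts increase by one exactly at the new rows, so the difference telescopes. -/
theorem TablesOK.card_new {T : ℕ → ℕ → ℝ} {imem : ℕ → ℕ} {D N : ℕ} (h : TablesOK T imem D N N)
    {lo hi : ℕ} (hlo : lo ≤ hi) (hhi : hi ≤ N) [DecidablePred (IsNew T (D + 1))] :
    imem (2 * N + 2 + hi) - imem (2 * N + 2 + lo) =
      ((Finset.Ico lo hi).filter (IsNew T (D + 1))).card := by
  have key : imem (2 * N + 2 + hi) =
      imem (2 * N + 2 + lo) + ((Finset.Ico lo hi).filter (IsNew T (D + 1))).card := by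
    induction hi, hlo using Nat.le_induction with
    | base => simp
    | succ k hk ih =>
      have ih := ih (by omega)
      rw [← Finset.insert_Ico_right_eq_Ico_add_one hk, Finset.filter_insert]
      by_cases hn : IsNew T (D + 1) k
      · rw [if_pos hn, Finset.card_insert_of_notMem (by simp), h.count_new k (by omega) hn, ih]
        omega
      · rw [if_neg hn, h.count_old k (by omega) hn, ih]
  omega

/-- The number of new rows in the block of a rounded query curve is a valid answer. -/
theorem isApproxRangeCount_index {n m d K N lo hi : ℕ} {p ε r : ℝ} {s : State} {inp qinp : ℕ → ℝ}
    (hn : 1 ≤ n) (hm : 1 ≤ m) (hd : 1 ≤ d) (hp : 1 ≤ p) (hε : 0 < ε) (hε1 : ε ≤ 1) (hr : 0 < r)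
    (hK : K = ⌈1 / ε⌉₊) (C : Fin n → Curve m d) (hC : EncodesCurves inp C)
    (hI : IsIndex s (m * d) N (side m d p ε r))
    (hsound : ∀ c < N, ∃ z < codeCount n m d K,
      Emits inp n m d K (side m d p ε r) (p / 2) (threshold p ε r) z ∧
        TableRowIs inp n m d K (side m d p ε r) s c z)
    (hcomplete : ∀ z < codeCount n m d K,
      Emits inp n m d K (side m d p ε r) (p / 2) (threshold p ε r) z →
        ∃ c < N, TableRowIs inp n m d K (side m d p ε r) s c z)
    (Q : Curve m d) (hQ : EncodesCurve qinp Q) (hlo : lo ≤ hi) (hhi : hi ≤ N)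
    (hblock : ∀ c < N, (lo ≤ c ∧ c < hi) ↔
      ∀ j < m * d, tableRow s (m * d + 1) c j = ⌊qinp j / side m d p ε r⌋) :
    IsApproxRangeCount (lpDist p) ε r C Q
      (s.imem (2 * N + 2 + hi) - s.imem (2 * N + 2 + lo)) := by
  classical
  set sd := side m d p ε r
  set D := m * d
  set T := tableRow s (D + 1) with hT
  set G := gridCurve m d sd fun l => ⌊qinp l / sd⌋
  have hX : ∀ (i : Fin n) (a : Fin m) (k : Fin d), inputPoint inp m d i a k = C i a k :=
    fun i a k => hC i a k
  -- The middle radius leaves room for the rounding error (ε/2)r on both sides.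
  refine ⟨Finset.univ.filter fun i => lpDist p (C i) G ≤ (1 + ε / 2) * r, ?_, ?_, ?_⟩
  · intro i hi
    simp only [Finset.mem_filter, Finset.mem_univ, true_and]
    exact (lpDist_floor hm hd hp hε hr (C i) Q hQ).1 hi
  · intro i hi
    simp only [Finset.mem_filter, Finset.mem_univ, true_and] at hi
    exact (lpDist_floor hm hd hp hε hr (C i) Q hQ).2 hi
  · rw [hI.tables.card_new hlo hhi, ← Finset.card_map Fin.valEmbedding]
    -- The last entry of a row is the number of its curve. It maps the new rows of the block
    -- bijectively to the answer set; the rounding only converts the stored real number to a natural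
    -- number.
    refine Finset.card_nbij (fun c => ⌊T c D⌋₊) ?_ ?_ ?_
    · intro c hc
      simp only [Finset.coe_filter, Finset.mem_Ico, Set.mem_ofPred_eq] at hc
      obtain ⟨z, hz, hem, hrow, hlast⟩ := hsound c (by omega)
      have hrows := (hblock c (by omega)).1 hc.1
      have hzn : z % n < n := Nat.mod_lt _ hn
      simp only [Finset.coe_map, Set.mem_image, Finset.coe_filter, Finset.mem_univ, true_and,
        Set.mem_ofPred_eq]
      refine ⟨⟨z % n, hzn⟩, ?_, ?_⟩
      · have h1 := hem.lpDist_le hm hp hε hr (C ⟨z % n, hzn⟩) (hX ⟨z % n, hzn⟩)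
        rwa [gridCurve_congr (g' := fun l => (⌊qinp l / sd⌋ : ℝ)) sd
          (fun l hl => (hrow l hl).symm.trans (hrows l hl))] at h1
      · rw [hT, hlast, Nat.floor_natCast]
        rfl
    -- Rows of the block with equal last entries are equal throughout, hence equal to all rows
    -- between them; the later one is then not new.
    · have key : ∀ c c', c < c' → lo ≤ c → c' < hi → IsNew T (D + 1) c' →
          ⌊T c D⌋₊ ≠ ⌊T c' D⌋₊ := by
        intro c c' hcc h1 h2 hnew he
        have hcN : c < N := by omega
        have hcN' : c' < N := by omega
        obtain ⟨z, -, -, -, hl⟩ := hsound c hcN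
        obtain ⟨z', -, -, -, hl'⟩ := hsound c' hcN'
        have hag : Agree T (D + 1) c c' := by
          intro j hj
          rcases Nat.lt_succ_iff_lt_or_eq.1 hj with hj | rfl
          · rw [(hblock c hcN).1 ⟨h1, by omega⟩ j hj, (hblock c' hcN').1 ⟨by omega, h2⟩ j hj]
          · rw [hT, hl, hl', Nat.floor_natCast, Nat.floor_natCast] at he
            rw [hT, hl, hl', he]
        rcases hnew with hnew | hnew
        · omega
        · exact hnew ((hI.sorted.agree (by omega : c ≤ c' - 1) (by omega) hcN' le_rfl hag).symm.trans hag)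
      intro c hc c' hc' he
      simp only [Finset.coe_filter, Finset.mem_Ico, Set.mem_ofPred_eq] at hc hc'
      rcases lt_trichotomy c c' with h | h | h
      · exact absurd he (key c c' h hc.1.1 hc'.1.2 hc'.2)
      · exact h
      · exact absurd he.symm (key c' c h hc'.1.1 hc.1.2 hc.2)
    · intro i hi
      simp only [Finset.coe_map, Set.mem_image, Finset.coe_filter, Finset.mem_univ, true_and,
        Set.mem_ofPred_eq] at hi
      obtain ⟨i, hi, rfl⟩ := hi
      obtain ⟨z, hz, hzi, hem, hv⟩ := exists_emits hm hd hp hε hε1 hr hK i.2 (C i) (hX i)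
        (fun l => ⌊qinp l / sd⌋) hi
      obtain ⟨c, hc, hrow, hlast⟩ := hcomplete z hz hem
      -- Among all copies of the row, the first one in the sorted order is new: a predecessor that
      -- agrees with it would be an earlier copy.
      have hex : ∃ c, c < N ∧ (∀ j < D, T c j = ⌊qinp j / sd⌋) ∧ T c D = (i : ℕ) :=
        ⟨c, hc, fun j hj => by rw [hT, hrow j hj, hzi, hv j hj], by rw [hT, hlast, hzi]⟩
      obtain ⟨h1, h2, h3⟩ := Nat.find_spec hex
      have hmin := fun c' => Nat.find_min hex (m := c')
      set c₀ := Nat.find hex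
      refine ⟨c₀, ?_, ?_⟩
      · simp only [Finset.coe_filter, Finset.mem_Ico, Set.mem_ofPred_eq]
        refine ⟨(hblock c₀ h1).2 h2, ?_⟩
        by_contra hnew
        simp only [IsNew, not_or, not_not] at hnew
        refine hmin (c₀ - 1) (by omega) ⟨by omega, fun j hj => ?_, ?_⟩
        · exact (hnew.2 j (by omega)).trans (h2 j hj)
        · exact (hnew.2 D (by omega)).trans h3
      · simp only [h3, Nat.floor_natCast]
        rfl

/-! ### The data structure and its size -/

theorem exists_index {n m d K Z L S : ℕ} {p ε r : ℝ} {s₀ : State} {inp : ℕ → ℝ}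
    (hn : 1 ≤ n) (hm : 1 ≤ m) (hd : 1 ≤ d) (hp : 1 ≤ p) (hε : 0 < ε) (hε1 : ε ≤ 1) (hr : 0 < r)
    (hK : K = ⌈1 / ε⌉₊) (hZ : Z = codeCount n m d K) (hZL : Z ≤ 2 ^ L)
    (hS : S = 16 * Z * (m * d + 1)) (h0 : s₀.ireg 0 = n)
    (h1 : s₀.ireg 1 = m) (h2 : s₀.ireg 2 = d) (r0 : s₀.rreg 0 = ε) (r1 : s₀.rreg 1 = r)
    (r2 : s₀.rreg 2 = p) (C : Fin n → Curve m d) (hC : EncodesCurves inp C) :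
    Runs S inp prep s₀ (prepTime m d K Z L) fun s =>
      ∀ (Q : Curve m d) (qinp : ℕ → ℝ), EncodesCurve qinp Q →
        ∃ (s' : State) (t' : ℕ), t' ≤ 27 * (m * d + L + 1) + 20 ∧
          Exec S qinp query s.clearRegs s' t' ∧
          s'.imem = s.imem ∧ s'.rmem = s.rmem ∧
          IsApproxRangeCount (lpDist p) ε r C Q (s'.ireg 0) := by
  refine (prep_spec p ε r K Z L hK hZ hZL h0 h1 h2 r0 r1 r2 hn hm hd hε hr hS.ge).mono le_rfl ?_
  rintro s - ⟨N, hNZ, hI, hsound, hcomplete⟩ Q qinp hQ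
  have hZ1 : 1 ≤ Z := by
    have hK1 : 1 ≤ K := by
      rw [hK, Nat.one_le_ceil_iff]
      positivity
    rw [hZ, codeCount]
    exact Nat.mul_pos hn (pow_pos (Nat.mul_pos (by norm_num [codeBase]) hK1) _)
  have hSq : 3 * N + 3 + 2 * (N * (m * d + 1)) + 2 * (m * d + 1) + 2 ≤ S := by
    have e1 : N * (m * d + 1) ≤ Z * (m * d + 1) := Nat.mul_le_mul_right _ hNZ
    have e2 : 1 * (m * d + 1) ≤ Z * (m * d + 1) := Nat.mul_le_mul_right _ hZ1
    have e3 : Z * 1 ≤ Z * (m * d + 1) := Nat.mul_le_mul_left _ (by omega)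
    rw [hS, Nat.mul_assoc]
    omega
  have hI' : IsIndex s.clearRegs (m * d) N (side m d p ε r) :=
    ⟨hI.size, hI.dim, hI.side, hI.lt, hI.sorted, hI.tables⟩
  obtain ⟨s', t', hex, ht', him, hrm, lo, hi, hlo, hhi, hblock, hans⟩ :=
    query_spec (inp := qinp) (m * d) N L _ hI' (hNZ.trans hZL) hSq
  refine ⟨s', t', ht', hex, him, hrm, ?_⟩
  rw [hans]
  subst hZ
  exact isApproxRangeCount_index hn hm hd hp hε hε1 hr hK C hC hI hsound hcomplete Q hQ hlo hhi hblock

/-- The 2 inside the logarithm keeps it away from 0, so that additive constants can be absorbed. -/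
theorem half_le_log {n : ℕ} {ε : ℝ} (hn : 1 ≤ n) (hε : 0 < ε) (hε1 : ε ≤ 1) :
    1 / 2 ≤ Real.log (2 * n / ε) := by
  have h1 : (1 : ℝ) ≤ n := by exact_mod_cast hn
  have h2 : (2 : ℝ) ≤ 2 * n / ε := by
    rw [le_div_iff₀ hε]
    nlinarith
  have := Real.log_le_log two_pos h2
  linarith [Real.log_two_gt_d9]

theorem codeCount_le {n m d K : ℕ} {ε : ℝ} (hKε : (K : ℝ) ≤ 4 / ε) :
    (codeCount n m d K : ℝ) ≤ n * (4 * codeBase / ε) ^ (m * d) := by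
  rw [codeCount]
  push_cast
  have : (codeBase * K : ℝ) ≤ 4 * codeBase / ε := by
    calc (codeBase * K : ℝ) ≤ codeBase * (4 / ε) := by gcongr
      _ = _ := by ring
  gcongr

theorem one_le_codeCount {n m d K : ℕ} (hn : 1 ≤ n) (hK : 1 ≤ K) : 1 ≤ codeCount n m d K :=
  Nat.mul_pos hn (pow_pos (Nat.mul_pos (by norm_num [codeBase]) hK) _)

/-- The number of codes is at most n(2^26/ε)^(md), since 4 · `codeBase` ≤ 2^26. Multiplied by log 2,
the left side is at most 28 times the bracket, and log 2 ≥ 1/2 doubles this to 56. -/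
theorem log_codeCount_le {n m d K : ℕ} {ε : ℝ} (hn : 1 ≤ n) (hm : 1 ≤ m) (hd : 1 ≤ d) (hε : 0 < ε)
    (hε1 : ε ≤ 1) (hK : 1 ≤ K) (hKε : (K : ℝ) ≤ 4 / ε) :
    ((Nat.log 2 (codeCount n m d K) + 1 : ℕ) : ℝ) ≤ 56 * (m * d * Real.log (2 * n / ε)) := by
  have hZ := one_le_codeCount (m := m) (d := d) hn hK
  have h1 : Real.log 2 * Nat.log 2 (codeCount n m d K) ≤ Real.log (codeCount n m d K) := by
    have := Nat.pow_log_le_self 2 (x := codeCount n m d K) (by omega)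
    have h2 : ((2 : ℝ) ^ Nat.log 2 (codeCount n m d K)) ≤ codeCount n m d K := by exact_mod_cast this
    have h3 := Real.log_le_log (by positivity) h2
    rwa [Real.log_pow, mul_comm] at h3
  have hn1 : (1 : ℝ) ≤ n := by exact_mod_cast hn
  have hK1 : (1 : ℝ) ≤ K := by exact_mod_cast hK
  have hD : (1 : ℝ) ≤ m * d := by exact_mod_cast Nat.mul_pos hm hd
  have h4 : Real.log (codeCount n m d K) ≤
      Real.log n + m * d * (26 * Real.log 2 + Real.log (1 / ε)) := by
    have hB : (0 : ℝ) < codeBase := by norm_num [codeBase]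
    rw [codeCount]
    push_cast
    rw [Real.log_mul (by positivity) (by positivity), Real.log_pow]
    push_cast
    have h5 : Real.log (codeBase * K) ≤ 26 * Real.log 2 + Real.log (1 / ε) := by
      have h6 : (26 : ℝ) * Real.log 2 = Real.log (2 ^ 26) := by rw [Real.log_pow]; norm_num
      rw [h6, ← Real.log_mul (by positivity) (by positivity)]
      refine Real.log_le_log (by positivity) ?_
      calc (codeBase * K : ℝ) ≤ codeBase * (4 / ε) := by gcongr
        _ = 4 * codeBase * (1 / ε) := by ring
        _ ≤ 2 ^ 26 * (1 / ε) := by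
            gcongr
            norm_num [codeBase]
    gcongr
  have h7 : Real.log (2 * n / ε) = Real.log 2 + Real.log n + Real.log (1 / ε) := by
    rw [← Real.log_mul (by positivity) (by positivity),
      ← Real.log_mul (by positivity) (by positivity)]
    congr 1
    ring
  have h8 : 0 ≤ Real.log n := Real.log_nonneg hn1
  have h9 : 0 ≤ Real.log (1 / ε) := Real.log_nonneg (by rw [le_div_iff₀ hε]; linarith)
  have h10 := Real.log_two_gt_d9
  push_cast
  rw [h7]
  set a := Real.log n
  set b := Real.log (1 / ε)
  set t := Real.log 2
  set D : ℝ := m * d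
  have e1 : a ≤ D * a := le_mul_of_one_le_left h8 hD
  have e2 : t ≤ D * t := le_mul_of_one_le_left (by linarith) hD
  have e3 : 0 ≤ D * b := by positivity
  have e4 : t * (Nat.log 2 (codeCount n m d K) + 1) ≤ 28 * (D * (t + a + b)) := by nlinarith
  have e5 : (0 : ℝ) ≤ Nat.log 2 (codeCount n m d K) := by positivity
  nlinarith

theorem query_time_le {n m d L : ℕ} {ε c : ℝ} (hn : 1 ≤ n) (hm : 1 ≤ m) (hd : 1 ≤ d) (hε : 0 < ε)
    (hε1 : ε ≤ 1) (hL : (L : ℝ) ≤ 56 * (m * d * Real.log (2 * n / ε))) (hc : 2000 ≤ c) :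
    ((27 * (m * d + L + 1) + 20 : ℕ) : ℝ) ≤ c * (m * d * Real.log (2 * (n * m * d) / ε)) := by
  have hx := half_le_log hn hε hε1
  have hD : (1 : ℝ) ≤ m * d := by exact_mod_cast Nat.mul_pos hm hd
  have hn1 : (1 : ℝ) ≤ n := by exact_mod_cast hn
  have hlog : Real.log (2 * n / ε) ≤ Real.log (2 * (n * m * d) / ε) := by
    refine Real.log_le_log (by positivity) ?_
    gcongr
    rw [mul_assoc]
    exact le_mul_of_one_le_right (by linarith) hD
  have h1 : (m * d : ℝ) ≤ 2 * (m * d * Real.log (2 * n / ε)) := by nlinarith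
  calc ((27 * (m * d + L + 1) + 20 : ℕ) : ℝ) = 27 * (m * d + L + 1) + 20 := by push_cast; ring
    _ ≤ 2000 * (m * d * Real.log (2 * n / ε)) := by nlinarith
    _ ≤ c * (m * d * Real.log (2 * (n * m * d) / ε)) := by gcongr

/-- A multiple of a power of the dimension is absorbed by the base of the power. -/
theorem mul_pow_le_pow {a x : ℝ} {D : ℕ} (ha : 1 ≤ a) (hx : 0 ≤ x) (hD : 1 ≤ D) :
    a * (D : ℝ) ^ 2 * x ^ D ≤ (4 * a * x) ^ D := by
  rw [mul_pow, mul_pow]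
  have h1 : (D : ℝ) ^ 2 ≤ 4 ^ D := by
    have : (D : ℝ) ≤ 2 ^ D := by exact_mod_cast Nat.lt_two_pow_self.le
    calc (D : ℝ) ^ 2 ≤ (2 ^ D) ^ 2 := by gcongr
      _ = 4 ^ D := by rw [← pow_mul, mul_comm, pow_mul]; norm_num
  have h2 : a ≤ a ^ D := le_self_pow₀ ha (by omega)
  calc a * (D : ℝ) ^ 2 * x ^ D ≤ a ^ D * 4 ^ D * x ^ D := by gcongr
    _ = _ := by ring

theorem space_le {n m d K : ℕ} {ε c : ℝ} (hm : 1 ≤ m) (hd : 1 ≤ d) (hε : 0 < ε)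
    (hKε : (K : ℝ) ≤ 4 / ε) (hc : c = 10 ^ 12) :
    2 * ((16 * codeCount n m d K * (m * d + 1) : ℕ) : ℝ) ≤ n * (c / ε) ^ (m * d) := by
  have hD : 1 ≤ m * d := Nat.mul_pos hm hd
  have hD1 : (1 : ℝ) ≤ (m * d : ℕ) := by exact_mod_cast hD
  have hZ := codeCount_le (n := n) (m := m) (d := d) hKε
  calc 2 * ((16 * codeCount n m d K * (m * d + 1) : ℕ) : ℝ)
      = 32 * codeCount n m d K * ((m * d : ℕ) + 1) := by push_cast; ring
    _ ≤ 32 * (n * (4 * codeBase / ε) ^ (m * d)) * (2 * ((m * d : ℕ) : ℝ) ^ 2) := by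
        gcongr
        nlinarith
    _ = n * (64 * ((m * d : ℕ) : ℝ) ^ 2 * (4 * codeBase / ε) ^ (m * d)) := by ring
    _ ≤ n * (4 * 64 * (4 * codeBase / ε)) ^ (m * d) := by
        gcongr
        exact mul_pow_le_pow (by norm_num) (by positivity) hD
    _ ≤ n * (c / ε) ^ (m * d) := by
        rw [show 4 * 64 * (4 * codeBase / ε) = (1024 * codeBase) / ε by ring]
        gcongr
        rw [hc]
        norm_num [codeBase]

/-- Every summand is a multiple of Z · md, possibly times L. The added 100 leaves room for the
conversion of the parameters in the Fréchet case. -/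
theorem prepTime_le {m d K Z L : ℕ} (hm : 1 ≤ m) (hd : 1 ≤ d) (hZ : 1 ≤ Z) (hK : K ≤ Z) :
    prepTime m d K Z L + 100 ≤ Z * (m * d) * (400 + 82 * L) := by
  have a1 : 1 ≤ m * d := Nat.mul_pos hm hd
  have a2 : Z ≤ Z * (m * d) := Nat.le_mul_of_pos_right _ a1
  have a3 : m * d ≤ Z * (m * d) := Nat.le_mul_of_pos_left _ hZ
  have a4 : Z * m ≤ Z * (m * d) := Nat.mul_le_mul_left _ (Nat.le_mul_of_pos_right _ hd)
  have a5 : L * Z ≤ L * (Z * (m * d)) := Nat.mul_le_mul_left _ a2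
  have a6 : L ≤ L * Z := Nat.le_mul_of_pos_right _ hZ
  unfold prepTime
  linarith

/-- This bound dictates c = 10^12, as 96000 · `codeBase` is just below it. One factor md comes from
the length of a row and another from the logarithm of the number of codes; both vanish by
`mul_pow_le_pow`. -/
theorem prepTime_le_real {n m d K L : ℕ} {ε c : ℝ} (hn : 1 ≤ n) (hm : 1 ≤ m) (hd : 1 ≤ d)
    (hε : 0 < ε) (hε1 : ε ≤ 1) (hK : 1 ≤ K) (hKε : (K : ℝ) ≤ 4 / ε)
    (hL : (L : ℝ) ≤ 56 * (m * d * Real.log (2 * n / ε))) (hc : c = 10 ^ 12) :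
    ((prepTime m d K (codeCount n m d K) L + 100 : ℕ) : ℝ) ≤
      n * Real.log (2 * n / ε) * (c / ε) ^ (m * d) := by
  have hD : 1 ≤ m * d := Nat.mul_pos hm hd
  have hD1 : (1 : ℝ) ≤ (m * d : ℕ) := by exact_mod_cast hD
  have hx := half_le_log hn hε hε1
  have hZ := codeCount_le (n := n) (m := m) (d := d) hKε
  have hKZ : K ≤ codeCount n m d K := by
    have h1 : K ≤ codeBase * K := Nat.le_mul_of_pos_left _ (by norm_num [codeBase])
    have h2 : codeBase * K ≤ (codeBase * K) ^ (m * d) := Nat.le_self_pow (by omega) _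
    exact (h1.trans h2).trans (Nat.le_mul_of_pos_left _ hn)
  have h1 := prepTime_le (L := L) hm hd (one_le_codeCount (m := m) (d := d) hn hK) hKZ
  have h1' : ((prepTime m d K (codeCount n m d K) L + 100 : ℕ) : ℝ) ≤
      codeCount n m d K * (m * d : ℕ) * (400 + 82 * L) := by exact_mod_cast h1
  have hmd : (m : ℝ) * d = (m * d : ℕ) := by push_cast; ring
  rw [hmd] at hL
  set D := m * d
  set x := Real.log (2 * n / ε)
  have hDx : 1 ≤ 2 * (D * x) := by nlinarith
  calc ((prepTime m d K (codeCount n m d K) L + 100 : ℕ) : ℝ)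
      ≤ codeCount n m d K * D * (400 + 82 * L) := h1'
    _ ≤ (n * (4 * codeBase / ε) ^ D) * D * (6000 * (D * x)) := by
        gcongr
        linarith
    _ = n * x * (6000 * (D : ℝ) ^ 2 * (4 * codeBase / ε) ^ D) := by ring
    _ ≤ n * x * (4 * 6000 * (4 * codeBase / ε)) ^ D := by
        gcongr
        exact mul_pow_le_pow (by norm_num) (by positivity) hD
    _ ≤ n * x * (c / ε) ^ D := by
        rw [show 4 * 6000 * (4 * codeBase / ε) = (96000 * codeBase) / ε by ring]
        gcongr
        rw [hc]
        norm_num [codeBase]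

/-! ### The discrete Fréchet distance -/

theorem frechetCost_nonneg {m d : ℕ} (P Q : Curve m d) (τ : List (Fin m × Fin m)) :
    0 ≤ frechetCost P Q τ := by
  unfold frechetCost
  induction τ with
  | nil => simp
  | cons a τ ih => exact le_max_of_le_right ih

theorem frechetCost_le_iff {m d : ℕ} (P Q : Curve m d) (τ : List (Fin m × Fin m)) {R : ℝ}
    (hR : 0 ≤ R) : frechetCost P Q τ ≤ R ↔ ∀ a ∈ τ, ‖P a.1 - Q a.2‖ ≤ R := by
  unfold frechetCost
  induction τ with
  | nil => simpa using hR
  | cons a τ ih => simp only [List.map_cons, List.foldr_cons, max_le_iff, ih, List.forall_mem_cons]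

theorem frechetDist_le_lpDist {m d : ℕ} (hm : 1 ≤ m) {p : ℝ} (hp : 1 ≤ p) (P Q : Curve m d) :
    frechetDist P Q ≤ lpDist p P Q := by
  obtain ⟨τ, hτ, h⟩ := exists_lpDist_eq hm p P Q
  have hs := lpSum_nonneg p P Q τ
  have h0 : 0 ≤ lpCost p P Q τ := Real.rpow_nonneg hs _
  rw [h]
  refine ((exists_isAlignment_min hm (frechetCost P Q)).2 τ hτ).trans
    ((frechetCost_le_iff P Q τ h0).2 fun a ha => ?_)
  rw [lpCost, one_div]
  refine (Real.le_rpow_inv_iff_of_pos (norm_nonneg _) hs (by linarith)).2 ?_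
  refine List.single_le_sum (fun x hx => ?_) _ (List.mem_map.2 ⟨a, ha, rfl⟩)
  obtain ⟨b, -, rfl⟩ := List.mem_map.1 hx
  positivity

/-- An optimal Fréchet alignment has at most 2m pairs, each contributing at most the p-th power of
the maximum. -/
theorem lpDist_le_frechetDist {m d : ℕ} (hm : 1 ≤ m) {p : ℝ} (hp : 1 ≤ p) (P Q : Curve m d) :
    lpDist p P Q ≤ (2 * m : ℝ) ^ (1 / p) * frechetDist P Q := by
  obtain ⟨τ, hτ, h⟩ := (exists_isAlignment_min hm (frechetCost P Q)).1
  have h0 := frechetCost_nonneg P Q τ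
  have hp0 : 0 < p := by linarith
  rw [frechetDist, h, lpDist_le_iff hm hp _ _ (by positivity)]
  refine ⟨τ, hτ, ?_⟩
  rw [Real.mul_rpow (by positivity) h0, ← Real.rpow_mul (by positivity),
    one_div_mul_cancel hp0.ne', Real.rpow_one]
  have h1 : lpSum p P Q τ ≤ τ.length * frechetCost P Q τ ^ p := by
    have := List.sum_le_card_nsmul (τ.map fun a => ‖P a.1 - Q a.2‖ ^ p) (frechetCost P Q τ ^ p)
      fun x hx => by
        obtain ⟨a, ha, rfl⟩ := List.mem_map.1 hx
        exact Real.rpow_le_rpow (norm_nonneg _) ((frechetCost_le_iff P Q τ h0).1 le_rfl a ha) hp0.le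
    simpa [lpSum] using this
  have h2 : (τ.length : ℝ) ≤ 2 * m := by exact_mod_cast hτ.length_le
  refine h1.trans ?_
  gcongr

/-- Bernoulli's inequality: (1 + ε/4)^p ≥ 1 + pε/4 = 1 + 2m for p = 8m/ε. -/
theorem two_mul_rpow_le {m : ℕ} {ε : ℝ} (hm : 1 ≤ m) (hε : 0 < ε) (hε1 : ε ≤ 1) :
    1 ≤ 8 * m / ε ∧ (2 * m : ℝ) ^ (1 / (8 * m / ε)) ≤ 1 + ε / 4 := by
  have hm1 : (1 : ℝ) ≤ m := by exact_mod_cast hm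
  have hp : 1 ≤ 8 * m / ε := by
    rw [le_div_iff₀ hε]
    linarith
  refine ⟨hp, ?_⟩
  rw [one_div]
  refine (Real.rpow_inv_le_iff_of_pos (by positivity) (by positivity) (by linarith)).2 ?_
  refine le_trans ?_ (one_add_mul_self_le_rpow_one_add (by linarith : -1 ≤ ε / 4) hp)
  have : 8 * m / ε * (ε / 4) = 2 * m := by
    field_simp
    norm_num
  linarith

/-- The Fréchet distance is at most the ℓ_{p,2}-distance, which exceeds it at most by the factor 1 +
ε/4. Enlarging r by this factor loses no close curve, and (1 + ε/3)(1 + ε/4) ≤ 1 + ε for ε ≤ 1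
limits the additional ones. -/
theorem IsApproxRangeCount.frechet {n m d N : ℕ} {ε r : ℝ} (hm : 1 ≤ m) (hε : 0 < ε)
    (hε1 : ε ≤ 1) (hr : 0 < r) {C : Fin n → Curve m d} {Q : Curve m d}
    (h : IsApproxRangeCount (lpDist (8 * m / ε)) (ε / 3) (r * (1 + ε / 4)) C Q N) :
    IsApproxRangeCount frechetDist ε r C Q N := by
  obtain ⟨hp, hT⟩ := two_mul_rpow_le hm hε hε1
  obtain ⟨A, h1, h2, h3⟩ := h
  refine ⟨A, fun i hi => h1 i ?_, fun i hi => ?_, h3⟩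
  · calc lpDist (8 * m / ε) (C i) Q
        ≤ (2 * m : ℝ) ^ (1 / (8 * m / ε)) * frechetDist (C i) Q := lpDist_le_frechetDist hm hp _ _
      _ ≤ (2 * m : ℝ) ^ (1 / (8 * m / ε)) * r := by gcongr
      _ ≤ r * (1 + ε / 4) := by
          rw [mul_comm r]
          gcongr
  · calc frechetDist (C i) Q ≤ lpDist (8 * m / ε) (C i) Q := frechetDist_le_lpDist hm hp _ _
      _ ≤ (1 + ε / 3) * (r * (1 + ε / 4)) := h2 i hi
      _ = (1 + 7 / 12 * ε + ε * ε / 12) * r := by ring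
      _ ≤ (1 + ε) * r := mul_le_mul_of_nonneg_right (by nlinarith) hr.le

/-- Replace the parameters `ε`, `r` by those of the `ℓ_{p,2}`-distance for a large `p`. -/
def frechetParams : Cmd :=
  block [.intConst 3 8, .ofInt 3 3, .ofInt 4 1, .realOp .mul 3 3 4, .realOp .div 2 3 0,
    .intConst 3 4, .ofInt 3 3, .realOp .div 3 0 3, .intConst 4 1, .ofInt 4 4, .realOp .add 3 4 3,
    .realOp .mul 1 1 3, .intConst 3 3, .ofInt 3 3, .realOp .div 0 0 3]

theorem frechetParams_spec {S : ℕ} {inp : ℕ → ℝ} {s : State} {n m d : ℕ} {ε r : ℝ} (hS : 8 ≤ S)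
    (h0 : s.ireg 0 = n) (h1 : s.ireg 1 = m) (h2 : s.ireg 2 = d) (r0 : s.rreg 0 = ε)
    (r1 : s.rreg 1 = r) :
    Runs S inp frechetParams s 15 fun s' => s'.ireg 0 = n ∧ s'.ireg 1 = m ∧ s'.ireg 2 = d ∧
      s'.rreg 0 = ε / 3 ∧ s'.rreg 1 = r * (1 + ε / 4) ∧ s'.rreg 2 = 8 * m / ε := by
  refine Runs.block le_rfl ?_
  simp [wps, Instr.wp, RealOp.eval, h0, h1, h2, r0, r1]
  omega

/-! ### Assembling the bounds for both distances -/

theorem ceil_inv_le {ε : ℝ} (hε : 0 < ε) (hε1 : ε ≤ 1) :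
    1 ≤ ⌈1 / ε⌉₊ ∧ (⌈1 / ε⌉₊ : ℝ) ≤ 2 / ε := by
  refine ⟨Nat.one_le_ceil_iff.2 (by positivity), ?_⟩
  have h1 := (Nat.ceil_lt_add_one (by positivity : 0 ≤ 1 / ε)).le
  have h2 : 1 ≤ 1 / ε := by rw [le_div_iff₀ hε]; linarith
  have h3 : 2 / ε = 1 / ε + 1 / ε := by ring
  linarith

theorem ceil_inv_third_le {ε : ℝ} (hε : 0 < ε) (hε1 : ε ≤ 1) :
    1 ≤ ⌈1 / (ε / 3)⌉₊ ∧ (⌈1 / (ε / 3)⌉₊ : ℝ) ≤ 4 / ε := by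
  refine ⟨Nat.one_le_ceil_iff.2 (by positivity), ?_⟩
  have h1 := (Nat.ceil_lt_add_one (by positivity : 0 ≤ 1 / (ε / 3))).le
  have h2 : 1 ≤ 1 / ε := by rw [le_div_iff₀ hε]; linarith
  have h3 : 1 / (ε / 3) = 3 * (1 / ε) := by field_simp
  have h4 : 4 / ε = 4 * (1 / ε) := by ring
  linarith

theorem codeCount_le_pow (n m d K : ℕ) :
    codeCount n m d K ≤ 2 ^ (Nat.log 2 (codeCount n m d K) + 1) :=
  (Nat.lt_pow_succ_log_self one_lt_two _).le

theorem countsWithin_lpDist {n m d : ℕ} {p ε r : ℝ} (hn : 1 ≤ n) (hm : 1 ≤ m) (hd : 1 ≤ d)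
    (hp : 1 ≤ p) (hε : 0 < ε) (hε1 : ε ≤ 1) (hr : 0 < r) (C : Fin n → Curve m d) :
    CountsWithin prep query (lpDist p) [ε, r, p] ε r C
      (n * (10 ^ 12 / ε) ^ (m * d))
      (n * Real.log (2 * n / ε) * (10 ^ 12 / ε) ^ (m * d))
      (10 ^ 12 * (m * d * Real.log (2 * (n * m * d) / ε))) := by
  intro inp hC
  obtain ⟨hK, hKε⟩ := ceil_inv_le hε hε1
  have hKε : (⌈1 / ε⌉₊ : ℝ) ≤ 4 / ε := hKε.trans (by gcongr; norm_num)
  have hL := log_codeCount_le hn hm hd hε hε1 hK hKε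
  obtain ⟨s, t, hex, ht, hq⟩ := exists_index (s₀ := State.start [n, m, d] [ε, r, p]) hn hm hd hp hε
    hε1 hr rfl rfl (codeCount_le_pow n m d _) rfl rfl rfl rfl rfl rfl rfl C hC
  refine ⟨_, s, t, space_le hm hd hε hKε rfl, ?_, hex, fun Q qinp hQ => ?_⟩
  · refine le_trans ?_ (prepTime_le_real hn hm hd hε hε1 hK hKε hL rfl)
    exact_mod_cast ht.trans (Nat.le_add_right _ _)
  · obtain ⟨s', t', ht', hs'⟩ := hq Q qinp hQ
    refine ⟨s', t', ?_, hs'⟩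
    refine le_trans ?_ (query_time_le hn hm hd hε hε1 hL (by norm_num))
    exact_mod_cast ht'

theorem countsWithin_frechetDist {n m d : ℕ} {ε r : ℝ} (hn : 1 ≤ n) (hm : 1 ≤ m) (hd : 1 ≤ d)
    (hε : 0 < ε) (hε1 : ε ≤ 1) (hr : 0 < r) (C : Fin n → Curve m d) :
    CountsWithin (.seq frechetParams prep) query frechetDist [ε, r] ε r C
      (n * (10 ^ 12 / ε) ^ (m * d))
      (n * Real.log (2 * n / ε) * (10 ^ 12 / ε) ^ (m * d))
      (10 ^ 12 * (m * d * Real.log (2 * (n * m * d) / ε))) := by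
  intro inp hC
  obtain ⟨hK, hKε⟩ := ceil_inv_third_le hε hε1
  have hL := log_codeCount_le hn hm hd hε hε1 hK hKε
  have hp := (two_mul_rpow_le hm hε hε1).1
  set K := ⌈1 / (ε / 3)⌉₊ with hKdef
  set L := Nat.log 2 (codeCount n m d K) + 1
  have hS : 8 ≤ 16 * codeCount n m d K * (m * d + 1) := by
    have h1 := one_le_codeCount (m := m) (d := d) hn hK
    have h2 : 16 * codeCount n m d K ≤ 16 * codeCount n m d K * (m * d + 1) :=
      Nat.le_mul_of_pos_right _ (Nat.succ_pos _)
    omega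
  obtain ⟨s, t, hex, ht, hq⟩ := Runs.seq 15 (prepTime m d K (codeCount n m d K) L)
    (T := prepTime m d K (codeCount n m d K) L + 15) (by omega)
    (frechetParams_spec (inp := inp) (s := State.start [n, m, d] [ε, r]) hS rfl rfl rfl rfl rfl)
    (fun s' _ h => exists_index hn hm hd hp (by positivity) (by linarith) (by positivity) hKdef rfl
      (codeCount_le_pow n m d K) rfl h.1 h.2.1 h.2.2.1 h.2.2.2.1 h.2.2.2.2.1 h.2.2.2.2.2 C hC)
  refine ⟨_, s, t, space_le hm hd hε hKε rfl, ?_, hex, fun Q qinp hQ => ?_⟩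
  · refine le_trans ?_ (prepTime_le_real hn hm hd hε hε1 hK hKε hL rfl)
    exact_mod_cast ht.trans (by omega)
  · obtain ⟨s', t', ht', hex', him, hrm, hcount⟩ := hq Q qinp hQ
    refine ⟨s', t', ?_, hex', him, hrm, hcount.frechet hm hε hε1 hr⟩
    refine le_trans ?_ (query_time_le hn hm hd hε hε1 hL (by norm_num))
    exact_mod_cast ht'

theorem CountsWithin.mono {prep query : Cmd} {n m d : ℕ} {δ : Curve m d → Curve m d → ℝ}
    {params : List ℝ} {ε r : ℝ} {C : Fin n → Curve m d} {a a' b b' c : ℝ}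
    (h : CountsWithin prep query δ params ε r C a b c) (ha : a ≤ a') (hb : b ≤ b') :
    CountsWithin prep query δ params ε r C a' b' c := fun inp hC =>
  let ⟨S, s, t, h1, h2, h3⟩ := h inp hC
  ⟨S, s, t, h1.trans ha, h2.trans hb, h3⟩

end CurveCounting

theorem theorem6p1 :
    (∃ (c : ℝ) (prep query : CurveCounting.Cmd),
      ∀ (n m d : ℕ), 1 ≤ n → 1 ≤ m → 1 ≤ d →
      ∀ (p ε r : ℝ), 1 ≤ p → 0 < ε → ε ≤ 1 → 0 < r →
      ∀ C : Fin n → CurveCounting.Curve m d,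
        CurveCounting.CountsWithin prep query (CurveCounting.lpDist p) [ε, r, p] ε r C
          (n * (c / ε) ^ (m * (d + 1)))
          (n * Real.log (2 * n / ε) * (c / ε) ^ (m * (d + 1)))
          (c * (m * d * Real.log (2 * (n * m * d) / ε)))) ∧
    (∃ (c : ℝ) (prep query : CurveCounting.Cmd),
      ∀ (n m d : ℕ), 1 ≤ n → 1 ≤ m → 1 ≤ d →
      ∀ (ε r : ℝ), 0 < ε → ε ≤ 1 → 0 < r →
      ∀ C : Fin n → CurveCounting.Curve m d,
        CurveCounting.CountsWithin prep query CurveCounting.frechetDist [ε, r] ε r C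
          (n * (c / ε) ^ (m * d))
          (n * Real.log (2 * n / ε) * (c / ε) ^ (m * d))
          (c * (m * d * Real.log (2 * (n * m * d) / ε)))) := by
  refine ⟨⟨10 ^ 12, CurveCounting.prep, CurveCounting.query, ?_⟩,
    ⟨10 ^ 12, .seq CurveCounting.frechetParams CurveCounting.prep, CurveCounting.query, ?_⟩⟩
  · intro n m d hn hm hd p ε r hp hε hε1 hr C
    have hx := CurveCounting.half_le_log hn hε hε1
    -- The construction achieves the exponent md for the ℓ_{p,2}-distance as well; the required
    -- bound is weaker because the base is at least 1.
    have hpow : ((10 : ℝ) ^ 12 / ε) ^ (m * d) ≤ (10 ^ 12 / ε) ^ (m * (d + 1)) := by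
      refine pow_le_pow_right₀ ?_ (Nat.mul_le_mul_left m (Nat.le_succ d))
      rw [le_div_iff₀ hε]
      linarith
    refine (CurveCounting.countsWithin_lpDist hn hm hd hp hε hε1 hr C).mono ?_ ?_ <;> gcongr
  · intro n m d hn hm hd ε r hε hε1 hr C
    exact CurveCounting.countsWithin_frechetDist hn hm hd hε hε1 hr C
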